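/- **Setting.** Let $d\ge1$, $\mathfrak s\in[1,\infty)^d$, $|\mathfrak s|=\sum_i\mathfrak s_i$, $\ell>0$, $\|x\|_{\mathfrak s}=\sum_i|x_i|^{1/\mathfrak s_i}$, $t^{\pm\mathfrak s/\ell}x=(t^{\pm\mathfrak s_i/\ell}x_i)_i$, $\varphi(x)=|x_1|^{1/\mathfrak s_1}\wedge1$, $\varphi(x,y)=\varphi(x)\wedge\varphi(y)$. Let $G:\mathbb R^d\to[0,\infty)$ be measurable, $G_t(x)=t^{-|\mathfrak s|/\ell}G(t^{-\mathfrak s/\ell}x)$. A *$G$-controlled weight* is a continuous $w:\mathbb R^d\to(0,1]$ together with a continuous control function $w^*:\mathbb R^d\to[1,\infty)$ such that $w(x+y)\le w^*(x)w(y)$ and $\sup_{0<t\le T}\sup_x\|x\|_{\mathfrak s}^n\,w^*(t^{\mathfrak s/\ell}x)G(x)<\infty$ for all $n\in\mathbb N$, $T>0$. Products of weights carry the products of the control functions. A *$G$-type semigroup* is a family of continuous kernels $Q_t:\mathbb R^d\times\mathbb R^d\to\mathbb R$, $t>0$, with $\int Q_{t-s}(x,z)Q_s(z,y)\,dz=Q_t(x,y)$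 for $0<s<t$, $\int Q_t(x,y)\,dy\to1$ as $t\downarrow0$, $|Q_t(x,y)|\le C_1G_t(x-y)$, and $t\mapsto Q_t(x,y)$ differentiable with $|\partial_tQ_t(x,y)|\le C_2t^{-1}G_t(x-y)$. Fix one, and write $(Q_tf)(x)=Q_t(x,f)=\int Q_t(x,y)f(y)\,dy$. Let $C(w)$ be the space of continuous $f$ with $\|f\|_{L^\infty(w)}=\|fw\|_{L^\infty}<\infty$, let $\|f\|_{C^{\alpha,Q}(w)}=\sup_{0<t\le1}t^{-\alpha/\ell}\|Q_tf\|_{L^\infty(w)}$ for $\alpha\le0$, and let $C^{\alpha,Q}_0(w)$ be the completion of $C(w)$ under this norm; $Q_t$ extends to it. The completions are nested, and $C^{\alpha,Q}(w)$ denotes the space of all $\Lambda\in\bigcap_{\varepsilon>0}C_0^{\alpha-\varepsilon,Q}(w)$ with $\|\Lambda\|_{C^{\alpha,Q}(w)}<\infty$. A *regularity structure* consists of a locally finite set $\mathbf A\subset\mathbb R$ with smallest element $\alpha_0$, Banach spaces $(\mathbf T_\alpha,\|\cdot\|_\alpha)_{\alpha\in\mathbf A}$ with algebraic direct sum $\mathbf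 T$, and a group $\mathbf G$ of continuous linear operators on $\mathbf T$ with $(\Gamma-\mathrm{id})\mathbf T_\alpha\subset\mathbf T_{<\alpha}$. For $\tau\in\mathbf T$, $\|\tau\|_\alpha$ is the norm of its $\mathbf T_\alpha$-component. A *smooth model* is a pair $M=(\Pi,\Gamma)$ of continuous linear $\Pi_x:\mathbf T\to C(w)$ and of $\Gamma_{xy}\in\mathbf G$ with $\Pi_x\Gamma_{xy}=\Pi_y$, $\Gamma_{xx}=\mathrm{id}$, $\Gamma_{xy}\Gamma_{yz}=\Gamma_{xz}$, such that for all $\gamma\in\mathbb R$ $$\|\Pi\|_{\gamma,w}=\max_{\alpha<\gamma}\sup_{0<t\le1,\,x,\,\tau\in\mathbf T_\alpha\setminus\{0\}}t^{-\alpha/\ell}w(x)\frac{|Q_t(x,\Pi_x\tau)|}{\|\tau\|_\alpha}<\infty,\qquad \|\Gamma\|_{\gamma,w}=\max_{\beta<\alpha<\gamma}\sup_{x\ne y,\,\tau\in\mathbf T_\alpha\setminus\{0\}}\frac{w(x)\|\Gamma_{yx}\tau\|_\beta}{w^*(y-x)\|y-x\|_{\mathfrak s}^{\alpha-\beta}\|\tau\|_\alpha}<\infty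 .$$ The space $\mathscr M_w$ of *models* is the completion of the set of smooth models under the pseudo-metrics $\|\Pi^{(1)}-\Pi^{(2)}\|_{\gamma,w}+\|\Gamma^{(1)}-\Gamma^{(2)}\|_{\gamma,w}$, $\gamma\in\mathbb R$. We write $|||M|||_{\gamma,w}=\|\Pi\|_{\gamma,w}+\|\Gamma\|_{\gamma,w}$ and $|||M^{(1)};M^{(2)}|||_{\gamma,w}$ for the pseudo-metric. For $\eta\le\gamma$, $\mathcal D^{\gamma,\eta}_v(\Gamma)$ is the space of $f:(\mathbb R\setminus\{0\})\times\mathbb R^{d-1}\to\mathbf T_{<\gamma}$ for which $|||f|||_{\gamma,\eta,v}$, defined as the sum of $$\max_{\alpha<\gamma}\sup_{x}\frac{v(x)\|f(x)\|_\alpha}{\varphi(x)^{(\eta-\alpha)\wedge0}}\quad\text{and}\quad \max_{\alpha<\gamma}\sup_{x\neq y,\ \|y-x\|_{\mathfrak s}\le\varphi(x,y)}\frac{v(x)\|f(y)-\Gamma_{yx}f(x)\|_\alpha}{\varphi(x,y)^{\eta-\gamma}v^*(x-y)\|y-x\|_{\mathfrak s}^{\gamma-\alpha}},$$ is finite. For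 $f^{(i)}\in\mathcal D^{\gamma,\eta}_v(\Gamma^{(i)})$, $|||f^{(1)};f^{(2)}|||_{\gamma,\eta,v}$ is defined in the same way with $f^{(1)}-f^{(2)}$ in the first term and the difference of the two increments in the second. **Statement.** Let $w,v$ be $G$-controlled weights such that $wv$ and $w^2v$ are $G$-controlled and $w^*$ is symmetric, $w^*(-x)=w^*(x)$. Let $\gamma>0$, $\eta\le\gamma$, and suppose that $\theta:=\eta\wedge\alpha_0\in(\gamma-\mathfrak s_1,\gamma]$; put $\zeta:=\theta\wedge0$. Then there is a constant $C>0$ such that the following holds. (1) For every $M=(\Pi,\Gamma)\in\mathscr M_w$ and $f\in\mathcal D^{\gamma,\eta}_v(\Gamma)$ there is a unique $\mathcal Rf\in C^{\zeta,Q}(w^2v)$ with $$[\![\mathcal Rf]\!]:=\sup_{0<t\le1}\ \sup_{x_1\ne0}\ t^{-\gamma/\ell}\varphi(x)^{\gamma-\theta}(w^2v)(x)\,\big|Q_t\big(x,\mathcal Rf-\Pi_xf(x)\big)\big|<\infty ,$$ and both $\|\mathcal Rf\|_{C^{\zeta,Q}(w^2v)}$ and $[\![\mathcal Rf]\!]$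 are at most $C\,\|\Pi\|_{\gamma,w}(1+\|\Gamma\|_{\gamma,w})\,|||f|||_{\gamma,\eta,v}$. If moreover $\alpha_0>0$, or $\alpha_0<0$ and $\alpha_0<\eta$, then $\mathcal Rf$ belongs to the completion $C_0^{\zeta,Q}(w^2v)$. (2) For all $R\ge0$, $M^{(i)}=(\Pi^{(i)},\Gamma^{(i)})\in\mathscr M_w$ and $f^{(i)}\in\mathcal D^{\gamma,\eta}_v(\Gamma^{(i)})$ ($i=1,2$) with $|||M^{(i)}|||_{\gamma,w}\le R$ and $|||f^{(i)}|||_{\gamma,\eta,v}\le R$, the norm $\|\mathcal Rf^{(1)}-\mathcal Rf^{(2)}\|_{C^{\zeta,Q}(w^2v)}$ and the quantity $$\sup_{0<t\le1}\ \sup_{x_1\ne0}\ t^{-\gamma/\ell}\varphi(x)^{\gamma-\theta}(w^2v)(x)\,\big|Q_t\big(x,\{\mathcal Rf^{(1)}-\Pi^{(1)}_xf^{(1)}(x)\}-\{\mathcal Rf^{(2)}-\Pi^{(2)}_xf^{(2)}(x)\}\big)\big|$$ are both at most $C(1+R)^2\big(|||M^{(1)};M^{(2)}|||_{\gamma,w}+|||f^{(1)};f^{(2)}|||_{\gamma,\eta,v}\big)$.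 -/

import Mathlib

open MeasureTheory Filter Topology
open scoped ENNReal NNReal DirectSum

noncomputable section

/-! ## Scalings and weights -/

/-- The anisotropic size `‖x‖_𝔰 = ∑ i, |x i| ^ (1 / 𝔰 i)`. -/
def scaledSize {d : ℕ} (s : Fin d → ℝ) (x : Fin d → ℝ) : ℝ :=
  ∑ i, |x i| ^ (1 / s i)

/-- The scaled vector `t ^ (𝔰 / ℓ) x`. -/
def scaleBy {d : ℕ} (s : Fin d → ℝ) (ℓ t : ℝ) (x : Fin d → ℝ) : Fin d → ℝ :=
  fun i => t ^ (s i / ℓ) * x i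

/-- `G_t(x) = t ^ (-|𝔰| / ℓ) G (t ^ (-𝔰 / ℓ) x)`. -/
def scaledKernel {d : ℕ} (s : Fin d → ℝ) (ℓ : ℝ) (G : (Fin d → ℝ) → ℝ) (t : ℝ)
    (x : Fin d → ℝ) : ℝ :=
  t ^ (-(∑ i, s i) / ℓ) * G (fun i => t ^ (-(s i) / ℓ) * x i)

/-- The temporal weight `φ(x) = |x₁| ^ (1 / 𝔰₁) ∧ 1`; the first coordinate has index `0`. -/
def temporalWeight {d : ℕ} [NeZero d] (s : Fin d → ℝ) (x : Fin d → ℝ) : ℝ :=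
  min (|x 0| ^ (1 / s 0)) 1

/-- `w` is a `G`-controlled weight, with control function `ws` (written `w^*`). -/
structure IsGControlled {d : ℕ} (s : Fin d → ℝ) (ℓ : ℝ) (G : (Fin d → ℝ) → ℝ)
    (w ws : (Fin d → ℝ) → ℝ) : Prop where
  continuous : Continuous w
  pos : ∀ x, 0 < w x
  le_one : ∀ x, w x ≤ 1
  star_continuous : Continuous ws
  one_le_star : ∀ x, 1 ≤ ws x
  moderate : ∀ x y, w (x + y) ≤ ws x * w y
  decay : ∀ (n : ℕ) (T : ℝ), 0 < T → ∃ K : ℝ, ∀ t, 0 < t → t ≤ T → ∀ x,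
    scaledSize s x ^ n * ws (scaleBy s ℓ t x) * G x ≤ K

/-- A `G`-type semigroup of integral kernels `Q t x y`, `t > 0`. -/
structure IsGTypeSemigroup {d : ℕ} (s : Fin d → ℝ) (ℓ : ℝ) (G : (Fin d → ℝ) → ℝ)
    (Q : ℝ → (Fin d → ℝ) → (Fin d → ℝ) → ℝ) : Prop where
  continuous : ∀ t, 0 < t → Continuous fun p : (Fin d → ℝ) × (Fin d → ℝ) => Q t p.1 p.2
  semigroup : ∀ r t, 0 < r → r < t → ∀ x y, ∫ z, Q (t - r) x z * Q r z y = Q t x y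
  conservative : ∀ x, Tendsto (fun t => ∫ y, Q t x y) (𝓝[>] 0) (𝓝 1)
  upper_bound : ∃ C₁ : ℝ, 0 < C₁ ∧ ∀ t, 0 < t → ∀ x y,
    |Q t x y| ≤ C₁ * scaledKernel s ℓ G t (x - y)
  differentiable : ∀ t, 0 < t → ∀ x y, DifferentiableAt ℝ (fun r => Q r x y) t
  deriv_bound : ∃ C₂ : ℝ, 0 < C₂ ∧ ∀ t, 0 < t → ∀ x y,
    |deriv (fun r => Q r x y) t| ≤ C₂ * t⁻¹ * scaledKernel s ℓ G t (x - y)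

/-! ## Besov spaces associated with the semigroup -/

/-- The supremum of `w |f|`. For continuous `w` and `f` it is the norm of `L^∞(w)`
(see `weightedSup_eq_eLpNorm`). -/
def weightedSup {d : ℕ} (w f : (Fin d → ℝ) → ℝ) : ℝ≥0∞ :=
  ⨆ x, ENNReal.ofReal (w x * |f x|)

theorem weightedSup_eq_eLpNorm {d : ℕ} {w f : (Fin d → ℝ) → ℝ} (hw : Continuous w)
    (hw0 : ∀ x, 0 ≤ w x) (hf : Continuous f) :
    weightedSup w f = eLpNorm (fun x => f x * w x) ∞ volume := by
  have hpt : ∀ x, ENNReal.ofReal (w x * |f x|) = ‖f x * w x‖ₑ := by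
    intro x
    rw [← ofReal_norm, norm_mul, Real.norm_eq_abs, Real.norm_eq_abs,
      abs_of_nonneg (hw0 x), mul_comm]
  rw [eLpNorm_exponent_top]
  unfold weightedSup eLpNormEssSup
  simp only [hpt]
  have hc : Continuous fun x => ‖f x * w x‖ₑ := (hf.mul hw).enorm
  apply le_antisymm
  · refine iSup_le fun x => ?_
    by_contra hlt
    push Not at hlt
    have hopen : IsOpen {y | essSup (fun x => ‖f x * w x‖ₑ) volume < ‖f y * w y‖ₑ} :=
      isOpen_lt continuous_const hc
    have hnull : volume {y | essSup (fun x => ‖f x * w x‖ₑ) volume < ‖f y * w y‖ₑ} = 0 := by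
      have := ENNReal.ae_le_essSup (μ := volume) (fun x => ‖f x * w x‖ₑ)
      rw [ae_iff] at this
      simpa using this
    have := (hopen.measure_eq_zero_iff volume).1 hnull
    exact (this ▸ (show x ∈ {y | essSup (fun x => ‖f x * w x‖ₑ) volume < ‖f y * w y‖ₑ} from hlt) :
      x ∈ (∅ : Set (Fin d → ℝ)))
  · exact essSup_le_of_ae_le _ (Eventually.of_forall fun x => le_iSup (fun y => ‖f y * w y‖ₑ) x)

/-- The space `C(w)` of continuous functions with finite `L^∞(w)` norm. -/
def weightedContinuous {d : ℕ} (w : (Fin d → ℝ) → ℝ) : Set ((Fin d → ℝ) → ℝ) :=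
  {f | Continuous f ∧ weightedSup w f < ∞}

/-- A distribution `Λ` is represented by the family of functions `x ↦ Q_t(x, Λ)`, `0 < t ≤ 1`. -/
abbrev Profile (d : ℕ) : Type := Set.Ioc (0 : ℝ) 1 → (Fin d → ℝ) → ℝ

/-- The family `(Q_t f)` of a function `f`, where `(Q_t f)(x) = Q_t(x, f) = ∫ Q_t(x, y) f(y) dy`. -/
def profile {d : ℕ} (Q : ℝ → (Fin d → ℝ) → (Fin d → ℝ) → ℝ) (f : (Fin d → ℝ) → ℝ) : Profile d :=
  fun t x => ∫ y, Q t x y * f y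

/-- The norm `sup_{0 < t ≤ 1} t ^ (-α / ℓ) ‖Q_t Λ‖_{L^∞(w)}`. -/
def besovNorm {d : ℕ} (ℓ α : ℝ) (w : (Fin d → ℝ) → ℝ) (Λ : Profile d) : ℝ≥0∞ :=
  ⨆ t : Set.Ioc (0 : ℝ) 1, ENNReal.ofReal ((t : ℝ) ^ (-α / ℓ)) * weightedSup w (Λ t)

/-- The completion of `C(w)` under the norm `f ↦ sup_{0 < t ≤ 1} t ^ (-α / ℓ) ‖Q_t f‖_{L^∞(w)}`,
realised as the closure of the isometric image of `C(w)` under `f ↦ (Q_t f)_t` in the space of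
families with the norm `besovNorm`; it is complete, see `besovCompletion_complete`. The
continuous extension of `Q_t` to the completion is the evaluation at `t`, and the embeddings
between these spaces for different weights and exponents are inclusions. -/
def besovCompletion {d : ℕ} (ℓ : ℝ) (Q : ℝ → (Fin d → ℝ) → (Fin d → ℝ) → ℝ) (α : ℝ)
    (w : (Fin d → ℝ) → ℝ) : Set (Profile d) :=
  {Λ | ∃ f : ℕ → (Fin d → ℝ) → ℝ, (∀ n, f n ∈ weightedContinuous w) ∧
    Tendsto (fun n => besovNorm ℓ α w (profile Q (f n) - Λ)) atTop (𝓝 0)}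

/-- The Besov space of order `α`: the elements with finite norm of order `α` which belong to the
completions of every order `α - ε`, `ε > 0`. -/
def besovSpace {d : ℕ} (ℓ : ℝ) (Q : ℝ → (Fin d → ℝ) → (Fin d → ℝ) → ℝ) (α : ℝ)
    (w : (Fin d → ℝ) → ℝ) : Set (Profile d) :=
  {Λ | besovNorm ℓ α w Λ < ∞ ∧ ∀ ε : ℝ, 0 < ε → Λ ∈ besovCompletion ℓ Q (α - ε) w}

theorem le_besovNorm {d : ℕ} (ℓ α : ℝ) (w : (Fin d → ℝ) → ℝ) (Λ : Profile d)
    (t : Set.Ioc (0 : ℝ) 1) (x : Fin d → ℝ) :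
    ENNReal.ofReal ((t : ℝ) ^ (-α / ℓ)) * ENNReal.ofReal (w x * |Λ t x|) ≤ besovNorm ℓ α w Λ :=
  le_trans (mul_le_mul_right (le_iSup (fun y => ENNReal.ofReal (w y * |Λ t y|)) x) _)
    (le_iSup (fun r : Set.Ioc (0 : ℝ) 1 =>
      ENNReal.ofReal ((r : ℝ) ^ (-α / ℓ)) * weightedSup w (Λ r)) t)

theorem besovNorm_le {d : ℕ} {ℓ α : ℝ} {w : (Fin d → ℝ) → ℝ} {Λ : Profile d} {K : ℝ≥0∞}
    (h : ∀ (t : Set.Ioc (0 : ℝ) 1) (x : Fin d → ℝ),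
      ENNReal.ofReal ((t : ℝ) ^ (-α / ℓ)) * ENNReal.ofReal (w x * |Λ t x|) ≤ K) :
    besovNorm ℓ α w Λ ≤ K := by
  refine iSup_le fun t => ?_
  unfold weightedSup
  rw [ENNReal.mul_iSup]
  exact iSup_le fun x => h t x

theorem besovNorm_add_le {d : ℕ} (ℓ α : ℝ) {w : (Fin d → ℝ) → ℝ} (hw : ∀ x, 0 ≤ w x)
    (Λ Θ : Profile d) : besovNorm ℓ α w (Λ + Θ) ≤ besovNorm ℓ α w Λ + besovNorm ℓ α w Θ := by
  refine besovNorm_le fun t x => ?_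
  refine le_trans ?_ (add_le_add (le_besovNorm ℓ α w Λ t x) (le_besovNorm ℓ α w Θ t x))
  rw [← mul_add, ← ENNReal.ofReal_add (mul_nonneg (hw x) (abs_nonneg _))
    (mul_nonneg (hw x) (abs_nonneg _)), ← mul_add]
  exact mul_le_mul_right (ENNReal.ofReal_le_ofReal
    (mul_le_mul_of_nonneg_left (abs_add_le _ _) (hw x))) _

/-- The space `besovCompletion` is complete. -/
theorem besovCompletion_complete {d : ℕ} {ℓ : ℝ} {Q : ℝ → (Fin d → ℝ) → (Fin d → ℝ) → ℝ} {α : ℝ}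
    {w : (Fin d → ℝ) → ℝ} (hw : ∀ x, 0 < w x) (F : ℕ → Profile d)
    (hF : ∀ n, F n ∈ besovCompletion ℓ Q α w)
    (hC : ∀ ε : ℝ≥0∞, 0 < ε → ∃ N, ∀ m ≥ N, ∀ n ≥ N, besovNorm ℓ α w (F m - F n) ≤ ε) :
    ∃ Λ ∈ besovCompletion ℓ Q α w,
      Tendsto (fun n => besovNorm ℓ α w (F n - Λ)) atTop (𝓝 0) := by
  have hlim : ∀ (t : Set.Ioc (0 : ℝ) 1) (x : Fin d → ℝ),
      ∃ a : ℝ, Tendsto (fun n => F n t x) atTop (𝓝 a) := by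
    intro t x
    apply cauchySeq_tendsto_of_complete
    rw [Metric.cauchySeq_iff]
    intro ε hε
    have htp : (0 : ℝ) < (t : ℝ) ^ (-α / ℓ) := Real.rpow_pos_of_pos t.2.1 _
    obtain ⟨N, hN⟩ := hC (ENNReal.ofReal ((t : ℝ) ^ (-α / ℓ) * (w x * (ε / 2))))
      (ENNReal.ofReal_pos.2 (mul_pos htp (mul_pos (hw x) (half_pos hε))))
    refine ⟨N, fun m hm n hn => ?_⟩
    have h := (le_besovNorm ℓ α w (F m - F n) t x).trans (hN m hm n hn)
    rw [← ENNReal.ofReal_mul htp.le, ENNReal.ofReal_le_ofReal_iff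
      (mul_pos htp (mul_pos (hw x) (half_pos hε))).le] at h
    have h2 := le_of_mul_le_mul_left (le_of_mul_le_mul_left h htp) (hw x)
    rw [Real.dist_eq]
    exact lt_of_le_of_lt h2 (half_lt_self hε)
  choose Λ hΛ using hlim
  have hconv : Tendsto (fun n => besovNorm ℓ α w (F n - Λ)) atTop (𝓝 0) := by
    rw [ENNReal.tendsto_atTop_zero]
    intro ε hε
    obtain ⟨N, hN⟩ := hC ε hε
    refine ⟨N, fun m hm => besovNorm_le fun t x => ?_⟩
    have hT : Tendsto (fun n => ENNReal.ofReal ((t : ℝ) ^ (-α / ℓ)) *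
        ENNReal.ofReal (w x * |(F m - F n) t x|)) atTop
        (𝓝 (ENNReal.ofReal ((t : ℝ) ^ (-α / ℓ)) * ENNReal.ofReal (w x * |(F m - Λ) t x|))) := by
      refine ENNReal.Tendsto.const_mul ?_ (Or.inr ENNReal.ofReal_ne_top)
      exact ENNReal.tendsto_ofReal (((tendsto_const_nhds.sub (hΛ t x)).abs).const_mul _)
    refine le_of_tendsto hT ?_
    filter_upwards [eventually_ge_atTop N] with n hn
    exact (le_besovNorm ℓ α w (F m - F n) t x).trans (hN m hm n hn)
  refine ⟨Λ, ?_, hconv⟩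
  have hex : ∀ n : ℕ, ∃ f ∈ weightedContinuous w,
      besovNorm ℓ α w (profile Q f - F n) ≤ ((n : ℝ≥0∞) + 1)⁻¹ := by
    intro n
    obtain ⟨f, hf, hfn⟩ := hF n
    rw [ENNReal.tendsto_atTop_zero] at hfn
    obtain ⟨N, hN⟩ := hfn ((n : ℝ≥0∞) + 1)⁻¹ (by simp)
    exact ⟨f N, hf N, hN N le_rfl⟩
  choose f hf hfn using hex
  refine ⟨f, hf, ?_⟩
  have hz : Tendsto (fun n : ℕ => ((n : ℝ≥0∞) + 1)⁻¹) atTop (𝓝 0) := by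
    have h := (tendsto_add_atTop_iff_nat 1).2 ENNReal.tendsto_inv_nat_nhds_zero
    simpa using h
  have hsum := hz.add hconv
  rw [add_zero] at hsum
  refine tendsto_of_tendsto_of_tendsto_of_le_of_le tendsto_const_nhds hsum
    (fun n => zero_le) (fun n => ?_)
  calc besovNorm ℓ α w (profile Q (f n) - Λ)
      = besovNorm ℓ α w ((profile Q (f n) - F n) + (F n - Λ)) := by rw [sub_add_sub_cancel]
    _ ≤ _ := (besovNorm_add_le ℓ α (fun x => (hw x).le) _ _).trans (add_le_add_left (hfn n) _)

/-! ## Regularity structures and models -/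

/-- A regularity structure `(A, T, G)`. The model space is the algebraic direct sum `⨁ α, T α`;
continuity of linear operators on it is boundedness of all their blocks. -/
structure RegularityStructure where
  A : Set ℝ
  locallyFinite : ∀ a b : ℝ, (A ∩ Set.Icc a b).Finite
  /-- the regularity, that is the smallest element of `A` -/
  reg : ℝ
  isLeast_reg : IsLeast A reg
  T : A → Type*
  [normedAddCommGroup : ∀ α, NormedAddCommGroup (T α)]
  [normedSpace : ∀ α, NormedSpace ℝ (T α)]
  [completeSpace : ∀ α, CompleteSpace (T α)]
  structureGroup : Subgroup ((⨁ α, T α) ≃ₗ[ℝ] (⨁ α, T α))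
  bounded : ∀ g ∈ structureGroup, ∀ α β : A, ∃ K : ℝ, ∀ τ : T α,
    ‖(g (DirectSum.of T α τ)) β‖ ≤ K * ‖τ‖
  triangular : ∀ g ∈ structureGroup, ∀ (α : A) (τ : T α) (β : A), (α : ℝ) ≤ β →
    (g (DirectSum.of T α τ) - DirectSum.of T α τ) β = 0

attribute [instance] RegularityStructure.normedAddCommGroup RegularityStructure.normedSpace
  RegularityStructure.completeSpace

/-- The model space `⨁ α, T α`. -/
abbrev RegularityStructure.Space (𝒯 : RegularityStructure) : Type _ := ⨁ α, 𝒯.T α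

/-- The inclusion of the homogeneous component `T α` in the model space. -/
abbrev RegularityStructure.of (𝒯 : RegularityStructure) (α : 𝒯.A) (τ : 𝒯.T α) : 𝒯.Space :=
  DirectSum.of 𝒯.T α τ

/-- `‖Π‖_{γ,w}`, where `P x τ` is the family `t, z ↦ Q_t(z, Π_x τ)`. -/
def piNorm {d : ℕ} (ℓ : ℝ) (𝒯 : RegularityStructure) (w : (Fin d → ℝ) → ℝ) (γ : ℝ)
    (P : (Fin d → ℝ) → 𝒯.Space → Profile d) : ℝ≥0∞ :=
  ⨆ (α : 𝒯.A) (_ : (α : ℝ) < γ) (t : Set.Ioc (0 : ℝ) 1) (x : Fin d → ℝ)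
    (τ : 𝒯.T α) (_ : τ ≠ 0),
    ENNReal.ofReal ((t : ℝ) ^ (-(α : ℝ) / ℓ) * w x * (|P x (𝒯.of α τ) t x| / ‖τ‖))

/-- `‖Γ‖_{γ,w}`. -/
def gammaNorm {d : ℕ} (s : Fin d → ℝ) (𝒯 : RegularityStructure) (w ws : (Fin d → ℝ) → ℝ) (γ : ℝ)
    (Γ : (Fin d → ℝ) → (Fin d → ℝ) → 𝒯.Space →ₗ[ℝ] 𝒯.Space) : ℝ≥0∞ :=
  ⨆ (α : 𝒯.A) (β : 𝒯.A) (_ : (β : ℝ) < α) (_ : (α : ℝ) < γ)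
    (x : Fin d → ℝ) (y : Fin d → ℝ) (_ : x ≠ y) (τ : 𝒯.T α) (_ : τ ≠ 0),
    ENNReal.ofReal (w x * ‖(Γ y x (𝒯.of α τ)) β‖ /
      (ws (y - x) * scaledSize s (y - x) ^ ((α : ℝ) - β) * ‖τ‖))

/-- A smooth model `(Π, Γ)`, with continuous linear operators `Π_x` from the model space
to `C(w)`. -/
structure SmoothModel {d : ℕ} (s : Fin d → ℝ) (ℓ : ℝ)
    (Q : ℝ → (Fin d → ℝ) → (Fin d → ℝ) → ℝ) (𝒯 : RegularityStructure)
    (w ws : (Fin d → ℝ) → ℝ) where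
  Pi : (Fin d → ℝ) → 𝒯.Space →ₗ[ℝ] ((Fin d → ℝ) → ℝ)
  Gamma : (Fin d → ℝ) → (Fin d → ℝ) → 𝒯.Space ≃ₗ[ℝ] 𝒯.Space
  pi_mem : ∀ x τ, Pi x τ ∈ weightedContinuous w
  pi_bounded : ∀ x (α : 𝒯.A), ∃ K : ℝ≥0, ∀ τ : 𝒯.T α,
    weightedSup w (Pi x (𝒯.of α τ)) ≤ K * ENNReal.ofReal ‖τ‖
  gamma_mem : ∀ x y, Gamma x y ∈ 𝒯.structureGroup
  pi_gamma : ∀ x y τ, Pi x (Gamma x y τ) = Pi y τ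
  gamma_self : ∀ x τ, Gamma x x τ = τ
  gamma_comp : ∀ x y z τ, Gamma x y (Gamma y z τ) = Gamma x z τ
  piNorm_lt_top : ∀ γ, piNorm ℓ 𝒯 w γ (fun x τ => profile Q (Pi x τ)) < ∞
  gammaNorm_lt_top : ∀ γ, gammaNorm s 𝒯 w ws γ (fun x y => (Gamma x y).toLinearMap) < ∞

/-- A model: an element of the completion of the set of smooth models under the pseudo-metrics
`‖Π¹ - Π²‖_{γ,w} + ‖Γ¹ - Γ²‖_{γ,w}` for all `γ`. Along a Cauchy sequence of smooth models the
operators `Γ_{xy}` and the functionals `Q_t(z, Π_x ·)` converge (the latter because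
`Π_x = Π_z Γ_{zx}`), and the element of the completion is represented by these limits: `Pi x τ`
is the family `t, z ↦ Q_t(z, Π_x τ)`. -/
structure RSModel {d : ℕ} (s : Fin d → ℝ) (ℓ : ℝ)
    (Q : ℝ → (Fin d → ℝ) → (Fin d → ℝ) → ℝ) (𝒯 : RegularityStructure)
    (w ws : (Fin d → ℝ) → ℝ) where
  Pi : (Fin d → ℝ) → 𝒯.Space → Profile d
  Gamma : (Fin d → ℝ) → (Fin d → ℝ) → 𝒯.Space →ₗ[ℝ] 𝒯.Space
  exists_approx : ∃ M : ℕ → SmoothModel s ℓ Q 𝒯 w ws,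
    (∀ γ, Tendsto (fun n => piNorm ℓ 𝒯 w γ (fun x τ => profile Q ((M n).Pi x τ) - Pi x τ))
      atTop (𝓝 0)) ∧
    (∀ γ, Tendsto (fun n => gammaNorm s 𝒯 w ws γ
      (fun x y => ((M n).Gamma x y).toLinearMap - Gamma x y)) atTop (𝓝 0)) ∧
    (∀ x τ t z, Tendsto (fun n => profile Q ((M n).Pi x τ) t z) atTop (𝓝 (Pi x τ t z))) ∧
    (∀ x y τ β, Tendsto (fun n => ((M n).Gamma x y τ) β) atTop (𝓝 ((Gamma x y τ) β)))

/-! ## Singular modelled distributions and reconstructions -/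

/-- The domain `(ℝ \ {0}) × ℝ^{d-1}`. -/
abbrev Punctured (d : ℕ) [NeZero d] : Type := {x : Fin d → ℝ // x 0 ≠ 0}

/-- The norm `sup v(x) ‖f(x)‖_α / φ(x) ^ ((η - α) ∧ 0)`, over `α < γ` and `x`. -/
def sizeNorm {d : ℕ} [NeZero d] (s : Fin d → ℝ) (𝒯 : RegularityStructure)
    (v : (Fin d → ℝ) → ℝ) (γ η : ℝ) (f : Punctured d → 𝒯.Space) : ℝ≥0∞ :=
  ⨆ (α : 𝒯.A) (_ : (α : ℝ) < γ) (x : Punctured d),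
    ENNReal.ofReal (v x * ‖(f x) α‖ / temporalWeight s x ^ (min (η - α) 0))

/-- The local increment norm of a two-point function `D y x`: the supremum of
`v(x) ‖D y x‖_α / (φ(x,y) ^ (η - γ) v^*(x - y) ‖y - x‖_𝔰 ^ (γ - α))` over `α < γ` and
`x ≠ y` with `‖y - x‖_𝔰 ≤ φ(x,y)`, where `φ(x,y) = φ(x) ∧ φ(y)`. -/
def incrementNorm {d : ℕ} [NeZero d] (s : Fin d → ℝ) (𝒯 : RegularityStructure)
    (v vs : (Fin d → ℝ) → ℝ) (γ η : ℝ) (D : Punctured d → Punctured d → 𝒯.Space) : ℝ≥0∞ :=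
  ⨆ (α : 𝒯.A) (_ : (α : ℝ) < γ) (x : Punctured d) (y : Punctured d) (_ : x ≠ y)
    (_ : scaledSize s ((y : Fin d → ℝ) - x) ≤ min (temporalWeight s x) (temporalWeight s y)),
    ENNReal.ofReal (v x * ‖(D y x) α‖ /
      (min (temporalWeight s x) (temporalWeight s y) ^ (η - γ) * vs ((x : Fin d → ℝ) - y) *
        scaledSize s ((y : Fin d → ℝ) - x) ^ (γ - α)))

/-- `Δ^Γ_{yx} f = f(y) - Γ_{yx} f(x)`. -/
def increment {d : ℕ} [NeZero d] {𝒯 : RegularityStructure}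
    (Γ : (Fin d → ℝ) → (Fin d → ℝ) → 𝒯.Space →ₗ[ℝ] 𝒯.Space) (f : Punctured d → 𝒯.Space)
    (y x : Punctured d) : 𝒯.Space :=
  f y - Γ y x (f x)

/-- The norm `|||f|||_{γ,η,v}` of a singular modelled distribution. -/
def mdNorm {d : ℕ} [NeZero d] (s : Fin d → ℝ) (𝒯 : RegularityStructure)
    (v vs : (Fin d → ℝ) → ℝ) (γ η : ℝ)
    (Γ : (Fin d → ℝ) → (Fin d → ℝ) → 𝒯.Space →ₗ[ℝ] 𝒯.Space)
    (f : Punctured d → 𝒯.Space) : ℝ≥0∞ :=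
  sizeNorm s 𝒯 v γ η f + incrementNorm s 𝒯 v vs γ η (increment Γ f)

/-- The distance `|||f₁; f₂|||_{γ,η,v}`. -/
def mdDist {d : ℕ} [NeZero d] (s : Fin d → ℝ) (𝒯 : RegularityStructure)
    (v vs : (Fin d → ℝ) → ℝ) (γ η : ℝ)
    (Γ₁ Γ₂ : (Fin d → ℝ) → (Fin d → ℝ) → 𝒯.Space →ₗ[ℝ] 𝒯.Space)
    (f₁ f₂ : Punctured d → 𝒯.Space) : ℝ≥0∞ :=
  sizeNorm s 𝒯 v γ η (fun x => f₁ x - f₂ x) +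
    incrementNorm s 𝒯 v vs γ η (fun y x => increment Γ₁ f₁ y x - increment Γ₂ f₂ y x)

/-- The space `D_v^{γ,η}(Γ)` of singular modelled distributions with values in `T_{<γ}`. -/
def singularMD {d : ℕ} [NeZero d] (s : Fin d → ℝ) (𝒯 : RegularityStructure)
    (v vs : (Fin d → ℝ) → ℝ) (γ η : ℝ)
    (Γ : (Fin d → ℝ) → (Fin d → ℝ) → 𝒯.Space →ₗ[ℝ] 𝒯.Space) :
    Set (Punctured d → 𝒯.Space) :=
  {f | (∀ (x : Punctured d) (α : 𝒯.A), γ ≤ α → (f x) α = 0) ∧ mdNorm s 𝒯 v vs γ η Γ f < ∞}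

/-- The local error `Q_t(x, Λ - Π_x f(x))` of a candidate reconstruction `Λ`. -/
def localError {d : ℕ} [NeZero d] {𝒯 : RegularityStructure}
    (P : (Fin d → ℝ) → 𝒯.Space → Profile d) (f : Punctured d → 𝒯.Space) (Λ : Profile d)
    (t : Set.Ioc (0 : ℝ) 1) (x : Punctured d) : ℝ :=
  Λ t x - P x (f x) t x

/-- `sup t ^ (-γ / ℓ) φ(x) ^ (γ - η) W(x) |e(t, x)|` over `0 < t ≤ 1` and `x` off the
hyperplane. With `e` the local error of `Λ` this is `⟦Λ⟧_{γ,η,W}`, with `e` a difference of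
two local errors it is `⟦Λ₁; Λ₂⟧_{γ,η,W}`. -/
def errorNorm {d : ℕ} [NeZero d] (s : Fin d → ℝ) (ℓ : ℝ) (W : (Fin d → ℝ) → ℝ) (γ η : ℝ)
    (e : Set.Ioc (0 : ℝ) 1 → Punctured d → ℝ) : ℝ≥0∞ :=
  ⨆ (t : Set.Ioc (0 : ℝ) 1) (x : Punctured d),
    ENNReal.ofReal ((t : ℝ) ^ (-γ / ℓ) * temporalWeight s x ^ (γ - η) * W x * |e t x|)

/-- `Λ` is a reconstruction of `f` of order `ζ`, with weight `W` and parameters `γ, η`. -/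
def IsReconstruction {d : ℕ} [NeZero d] (s : Fin d → ℝ) (ℓ : ℝ)
    (Q : ℝ → (Fin d → ℝ) → (Fin d → ℝ) → ℝ) {𝒯 : RegularityStructure}
    (P : (Fin d → ℝ) → 𝒯.Space → Profile d) (ζ γ η : ℝ) (W : (Fin d → ℝ) → ℝ)
    (f : Punctured d → 𝒯.Space) (Λ : Profile d) : Prop :=
  Λ ∈ besovSpace ℓ Q ζ W ∧ errorNorm s ℓ W γ η (localError P f Λ) < ∞

end

/-! The reconstruction is read off the diagonal F_t(y) = Q_t(y, Π_y f(y)): Q_t(x, 𝓡f) is the limit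
of ∫ Q_{t-σ}(x,y) F_σ(y) dy along σ = 2^{-n}. By the semigroup property two consecutive
approximations differ by Q_{t-σ} applied to the defect F_σ - Q_{σ/2} F_{σ/2}. The semigroup property
of Π_y f(y) at its own base point turns this defect into ∫ Q_{σ/2}(y,z) Q_{σ/2}(z, Π_y f(y) - Π_z
f(z)) dz, and Π_y f(y) - Π_z f(z) = -Π_z(f(z) - Γ_{zy} f(y)). Homogeneity α contributes σ^{α/ℓ}
‖y-z‖^{γ-α}, hence σ^{γ/ℓ} after integration, times a singular factor φ(y)^{-(γ-θ_α)} with θ_α = η ∧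
α.

Since γ - θ_α < 𝔰₁, this factor is integrable across the hyperplane; integrated against Q_{t-σ}(x,·)
it becomes t^{-(γ-θ_α)/ℓ}, or φ(x)^{-(γ-θ_α)} off the hyperplane. As γ > 0 the telescoping sum is
geometric. The first form bounds the Besov norm, the second the local error. This is
`CoherentGerm.exists_germBound`, `GermBound.exists_step_le` and
`GermBound.exists_reconstruction_le`. The weight w²v pays for Π, for Γ and for f, one factor each.

All integrals rest on one comparison: the decay of G against the control functions dominates Q_t by
a product of one-dimensional Cauchy kernels (`scaledKernel_mul_le`), so that only the first
coordinate sees the singularity.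

Uniqueness: the difference D of two candidates satisfies D_t = Q_{t-r} D_r and is O(r^{γ/ℓ}) up to
an integrable singularity, so r → 0 gives D = 0 (`eq_zero_of_semigroup_of_le`). Lipschitz
dependence: the construction is linear in the germ, and the difference of two germs is again
coherent, with a coefficient proportional to the distances (`RSModel.coherentGerm_sub`).

For the closed spaces, the reconstruction is approximated by its own regularisations Q_τ 𝓡f, which
requires t^{-ζ/ℓ} Q_t 𝓡f to vanish uniformly as t → 0 in the weighted norm. Below order ζ a spare
power of t gives this. At order ζ the reconstruction is zero when α₀ > 0. When α₀ < 0 and α₀ < η,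
only the lowest homogeneity is critical; there Π_x τ does not depend on x and is a limit of
functions in C(w), which makes it little-o of its nominal size (`RSModel.exists_lowest_le`). -/

noncomputable section

/-! ## Integrals of the Cauchy kernel against singular weights -/

/-- The unnormalised one-dimensional Cauchy kernel of width `r`. -/
def cauchyKernel (r u : ℝ) : ℝ := r / (r ^ 2 + u ^ 2)

theorem cauchyKernel_nonneg {r : ℝ} (hr : 0 < r) (u : ℝ) : 0 ≤ cauchyKernel r u := by
  unfold cauchyKernel; positivity

theorem cauchyKernel_continuous {r : ℝ} (hr : 0 < r) : Continuous (cauchyKernel r) := by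
  unfold cauchyKernel
  exact continuous_const.div (by fun_prop) (fun u => by positivity)

theorem cauchyKernel_eq {r : ℝ} (hr : 0 < r) (u : ℝ) :
    cauchyKernel r u = r⁻¹ * (1 + (u / r) ^ 2)⁻¹ := by
  unfold cauchyKernel
  field_simp

theorem integrable_cauchyKernel {r : ℝ} (hr : 0 < r) (x : ℝ) :
    Integrable fun y => cauchyKernel r (x - y) := by
  have h : Integrable fun u : ℝ => r⁻¹ * (1 + (u / r) ^ 2)⁻¹ :=
    (integrable_inv_one_add_sq.comp_div hr.ne').const_mul _
  have h2 : Integrable (cauchyKernel r) := by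
    refine h.congr (Eventually.of_forall fun u => ?_)
    exact (cauchyKernel_eq hr u).symm
  exact h2.comp_sub_left x

theorem integral_cauchyKernel {r : ℝ} (hr : 0 < r) (x : ℝ) :
    ∫ y, cauchyKernel r (x - y) = Real.pi := by
  rw [integral_sub_left_eq_self (cauchyKernel r) volume x]
  simp_rw [cauchyKernel_eq hr]
  rw [integral_const_mul, Measure.integral_comp_div (fun u : ℝ => (1 + u ^ 2)⁻¹) r,
    integral_univ_inv_one_add_sq, abs_of_pos hr, smul_eq_mul]
  field_simp

theorem integrable_abs_rpow_indicator {b ρ : ℝ} (hb : b < 1) (hρ : 0 < ρ) :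
    Integrable (fun y : ℝ => (Set.Iic ρ).indicator (fun u => u ^ (-b)) |y|) ∧
    ∫ y : ℝ, (Set.Iic ρ).indicator (fun u => u ^ (-b)) |y| = 2 * (ρ ^ (1 - b) / (1 - b)) := by
  have h1b : 0 < 1 - b := by linarith
  have h : ∫ y : ℝ, (Set.Iic ρ).indicator (fun u => u ^ (-b)) |y| =
      2 * (ρ ^ (1 - b) / (1 - b)) := by
    rw [integral_comp_abs, setIntegral_indicator measurableSet_Iic, Set.Ioi_inter_Iic,
      ← intervalIntegral.integral_of_le hρ.le, integral_rpow (Or.inl (by linarith)),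
      show -b + 1 = 1 - b by ring, Real.zero_rpow h1b.ne', sub_zero]
  refine ⟨?_, h⟩
  -- A non-integrable function has Bochner integral zero, whereas the value just computed is
  -- positive.
  by_contra hn
  rw [integral_undef hn] at h
  have : 0 < ρ ^ (1 - b) := Real.rpow_pos_of_pos hρ _
  have : 0 < 2 * (ρ ^ (1 - b) / (1 - b)) := by positivity
  linarith

/-- Split at |y| = ρ. Inside, the kernel is at most ρ⁻¹ and |y|^{-b} is integrable because b < 1;
outside, |y|^{-b} ≤ ρ^{-b} and the kernel has mass π. The choice ρ = r always satisfies the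
hypothesis, and ρ = |x|/2 does so when x is off the singularity. -/
theorem integral_cauchyKernel_mul_rpow {r b ρ x : ℝ} (hr : 0 < r) (hb0 : 0 ≤ b) (hb : b < 1)
    (hρ : 0 < ρ) (h : ∀ y, |y| ≤ ρ → cauchyKernel r (x - y) ≤ ρ⁻¹) :
    Integrable (fun y => cauchyKernel r (x - y) * |y| ^ (-b)) ∧
    ∫ y, cauchyKernel r (x - y) * |y| ^ (-b) ≤ (2 / (1 - b) + Real.pi) * ρ ^ (-b) := by
  have h1b : 0 < 1 - b := by linarith
  obtain ⟨hi, hI⟩ := integrable_abs_rpow_indicator hb hρ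
  have hd : Integrable fun y : ℝ => ρ⁻¹ * (Set.Iic ρ).indicator (fun u => u ^ (-b)) |y| +
      ρ ^ (-b) * cauchyKernel r (x - y) :=
    (hi.const_mul _).add ((integrable_cauchyKernel hr x).const_mul _)
  have hle : ∀ y : ℝ, cauchyKernel r (x - y) * |y| ^ (-b) ≤
      ρ⁻¹ * (Set.Iic ρ).indicator (fun u => u ^ (-b)) |y| +
      ρ ^ (-b) * cauchyKernel r (x - y) := by
    intro y
    have hk := cauchyKernel_nonneg hr (x - y)
    have hp : 0 ≤ |y| ^ (-b) := Real.rpow_nonneg (abs_nonneg y) _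
    have hq : 0 ≤ ρ ^ (-b) := Real.rpow_nonneg hρ.le _
    by_cases hy : |y| ≤ ρ
    · rw [Set.indicator_of_mem (by exact hy)]
      nlinarith [mul_le_mul_of_nonneg_right (h y hy) hp, mul_nonneg hq hk]
    · rw [Set.indicator_of_notMem (by exact hy), mul_zero, zero_add, mul_comm]
      push Not at hy
      exact mul_le_mul_of_nonneg_right
        (Real.rpow_le_rpow_of_nonpos hρ hy.le (by linarith)) hk
  have hint : Integrable (fun y => cauchyKernel r (x - y) * |y| ^ (-b)) := by
    refine hd.mono' ?_ (Eventually.of_forall fun y => ?_)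
    · refine (((cauchyKernel_continuous hr).comp (by fun_prop)).measurable.mul
        (measurable_norm.pow_const (-b))).aestronglyMeasurable
    · rw [Real.norm_of_nonneg (mul_nonneg (cauchyKernel_nonneg hr _)
        (Real.rpow_nonneg (abs_nonneg y) _))]
      exact hle y
  refine ⟨hint, (integral_mono hint hd hle).trans (le_of_eq ?_)⟩
  rw [integral_add (hi.const_mul _) ((integrable_cauchyKernel hr x).const_mul _),
    integral_const_mul, integral_const_mul, hI, integral_cauchyKernel hr,
    show 1 - b = -b + 1 by ring, Real.rpow_add hρ, Real.rpow_one]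
  field_simp

theorem integral_cauchyKernel_mul_rpow_le {r b : ℝ} (hr : 0 < r) (hb0 : 0 ≤ b) (hb : b < 1)
    (x : ℝ) :
    Integrable (fun y => cauchyKernel r (x - y) * |y| ^ (-b)) ∧
    ∫ y, cauchyKernel r (x - y) * |y| ^ (-b) ≤ (2 / (1 - b) + Real.pi) * r ^ (-b) := by
  refine integral_cauchyKernel_mul_rpow hr hb0 hb hr fun y _ => ?_
  unfold cauchyKernel
  rw [div_le_iff₀ (by positivity), inv_mul_eq_div, le_div_iff₀ hr]
  nlinarith [sq_nonneg (x - y)]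

theorem integral_cauchyKernel_mul_rpow_le' {r b x : ℝ} (hr : 0 < r) (hb0 : 0 ≤ b) (hb : b < 1)
    (hx : x ≠ 0) :
    ∫ y, cauchyKernel r (x - y) * |y| ^ (-b) ≤ 2 * (2 / (1 - b) + Real.pi) * |x| ^ (-b) := by
  have h1b : 0 < 1 - b := by linarith
  have hx' : 0 < |x| := abs_pos.2 hx
  refine (integral_cauchyKernel_mul_rpow (ρ := |x| / 2) hr hb0 hb (by positivity)
    fun y hy => ?_).2.trans ?_
  · unfold cauchyKernel
    have h1 : |x| / 2 ≤ |x - y| := by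
      have := abs_sub_abs_le_abs_sub x y
      linarith
    rw [div_le_iff₀ (by positivity), inv_mul_eq_div, le_div_iff₀ (by positivity), ← sq_abs (x - y)]
    nlinarith [sq_nonneg (r - |x - y|), mul_le_mul_of_nonneg_left h1 hr.le, sq_nonneg (x - y)]
  · rw [Real.div_rpow hx'.le (by norm_num), Real.rpow_neg (by norm_num : (0:ℝ) ≤ 2), div_inv_eq_mul]
    have h2 : (2 : ℝ) ^ b ≤ 2 := by
      calc (2 : ℝ) ^ b ≤ 2 ^ (1 : ℝ) := Real.rpow_le_rpow_of_exponent_le (by norm_num) hb.le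
        _ = 2 := Real.rpow_one 2
    have h3 : 0 ≤ |x| ^ (-b) := Real.rpow_nonneg hx'.le _
    have h4 : 0 ≤ 2 / (1 - b) + Real.pi := by positivity
    nlinarith [mul_le_mul_of_nonneg_left h2 (mul_nonneg h4 h3)]

theorem min_rpow_neg_le {σ a : ℝ} (y : ℝ) :
    min (|y| ^ (1 / σ)) 1 ^ (-a) ≤ 1 + |y| ^ (-(a / σ)) := by
  have hp : 0 ≤ |y| ^ (-(a / σ)) := Real.rpow_nonneg (abs_nonneg y) _
  rcases le_total (|y| ^ (1 / σ)) 1 with h | h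
  · rw [min_eq_left h, ← Real.rpow_mul (abs_nonneg y), show 1 / σ * -a = -(a / σ) by ring]
    linarith
  · rw [min_eq_right h, Real.one_rpow]
    linarith

theorem le_min_rpow_neg {σ a y : ℝ} (ha : 0 ≤ a) (hy : y ≠ 0) :
    1 ≤ min (|y| ^ (1 / σ)) 1 ^ (-a) ∧ |y| ^ (-(a / σ)) ≤ min (|y| ^ (1 / σ)) 1 ^ (-a) := by
  have hy' : 0 < |y| := abs_pos.2 hy
  have hpos : 0 < min (|y| ^ (1 / σ)) 1 := lt_min (Real.rpow_pos_of_pos hy' _) one_pos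
  refine ⟨Real.one_le_rpow_of_pos_of_le_one_of_nonpos hpos (min_le_right _ _) (by linarith), ?_⟩
  have : |y| ^ (-(a / σ)) = (|y| ^ (1 / σ)) ^ (-a) := by
    rw [← Real.rpow_mul hy'.le]; congr 1; ring
  rw [this]
  exact Real.rpow_le_rpow_of_nonpos hpos (min_le_left _ _) (by linarith)

/-- The one-dimensional integral estimate behind all bounds near the hyperplane. -/
theorem exists_integral_cauchyKernel_mul_min_le {σ a r₀ : ℝ} (hσ : 0 < σ) (ha : 0 ≤ a)
    (haσ : a < σ) (hr₀ : 0 < r₀) :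
    ∃ C : ℝ, 0 < C ∧ ∀ r, 0 < r → r ≤ r₀ → ∀ x : ℝ,
      Integrable (fun y => cauchyKernel r (x - y) * min (|y| ^ (1 / σ)) 1 ^ (-a)) ∧
      ∫ y, cauchyKernel r (x - y) * min (|y| ^ (1 / σ)) 1 ^ (-a) ≤ C * r ^ (-(a / σ)) ∧
      (x ≠ 0 → ∫ y, cauchyKernel r (x - y) * min (|y| ^ (1 / σ)) 1 ^ (-a) ≤
        C * min (|x| ^ (1 / σ)) 1 ^ (-a)) := by
  set b := a / σ with hb
  have hb0 : 0 ≤ b := div_nonneg ha hσ.le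
  have hb1 : b < 1 := (div_lt_one hσ).2 haσ
  have h1b : 0 < 1 - b := by linarith
  have hD : 0 < 2 / (1 - b) + Real.pi := by positivity
  refine ⟨Real.pi * r₀ ^ b + Real.pi + 2 * (2 / (1 - b) + Real.pi), by positivity, ?_⟩
  intro r hr hrr x
  obtain ⟨hi, hI⟩ := integral_cauchyKernel_mul_rpow_le hr hb0 hb1 x
  have hk := integrable_cauchyKernel hr x
  have hd : Integrable fun y => cauchyKernel r (x - y) + cauchyKernel r (x - y) * |y| ^ (-b) :=
    hk.add hi
  have hle : ∀ y, cauchyKernel r (x - y) * min (|y| ^ (1 / σ)) 1 ^ (-a) ≤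
      cauchyKernel r (x - y) + cauchyKernel r (x - y) * |y| ^ (-b) := by
    intro y
    rw [← mul_one_add]
    exact mul_le_mul_of_nonneg_left (min_rpow_neg_le y) (cauchyKernel_nonneg hr _)
  have hmin0 : ∀ y : ℝ, 0 ≤ min (|y| ^ (1 / σ)) 1 ^ (-a) := fun y =>
    Real.rpow_nonneg (le_min (Real.rpow_nonneg (abs_nonneg y) _) zero_le_one) _
  have hint : Integrable (fun y => cauchyKernel r (x - y) * min (|y| ^ (1 / σ)) 1 ^ (-a)) := by
    refine hd.mono' ?_ (Eventually.of_forall fun y => ?_)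
    · refine (((cauchyKernel_continuous hr).comp (by fun_prop)).measurable.mul
        (((measurable_norm.pow_const (1 / σ)).min measurable_const).pow_const
          (-a))).aestronglyMeasurable
    · rw [Real.norm_of_nonneg (mul_nonneg (cauchyKernel_nonneg hr _) (hmin0 y))]
      exact hle y
  have hbd := integral_mono hint hd hle
  rw [integral_add hk hi, integral_cauchyKernel hr] at hbd
  refine ⟨hint, ?_, fun hx => ?_⟩
  · refine hbd.trans ?_
    -- The mass π of the kernel, which comes from the region where the minimum is 1, has to be
    -- absorbed into r^{-b}; this is where the upper bound on r is needed.
    have h1 : 1 ≤ r₀ ^ b * r ^ (-b) := by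
      rw [Real.rpow_neg hr.le, ← div_eq_mul_inv, one_le_div (Real.rpow_pos_of_pos hr _)]
      exact Real.rpow_le_rpow hr.le hrr hb0
    have h2 : 0 ≤ r ^ (-b) := Real.rpow_nonneg hr.le _
    have h3 := Real.pi_pos
    nlinarith [mul_le_mul_of_nonneg_left h1 h3.le, mul_nonneg h3.le h2, mul_nonneg hD.le h2]
  · refine hbd.trans ?_
    obtain ⟨h1, h2⟩ := le_min_rpow_neg (σ := σ) ha hx
    have h3 := integral_cauchyKernel_mul_rpow_le' hr hb0 hb1 hx
    have h4 := Real.pi_pos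
    have h5 : 0 ≤ Real.pi * r₀ ^ b := by positivity
    nlinarith [mul_le_mul_of_nonneg_left h1 h4.le, mul_le_mul_of_nonneg_left h2 hD.le,
      mul_nonneg h5 (hmin0 x)]

/-! ## The anisotropic kernel -/

/-- The product of Cauchy kernels adapted to the scaling at time `t`. -/
def scaledCauchy {d : ℕ} (s : Fin d → ℝ) (ℓ t : ℝ) (z : Fin d → ℝ) : ℝ :=
  ∏ i, cauchyKernel (t ^ (s i / ℓ)) (z i)

section Kernel

variable {d : ℕ} {s : Fin d → ℝ} {ℓ : ℝ}

theorem scaledCauchy_nonneg {t : ℝ} (ht : 0 < t) (z : Fin d → ℝ) : 0 ≤ scaledCauchy s ℓ t z :=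
  Finset.prod_nonneg fun _ _ => cauchyKernel_nonneg (Real.rpow_pos_of_pos ht _) _

theorem temporalWeight_nonneg [NeZero d] (x : Fin d → ℝ) : 0 ≤ temporalWeight s x :=
  le_min (Real.rpow_nonneg (abs_nonneg _) _) zero_le_one

theorem temporalWeight_le_one [NeZero d] (x : Fin d → ℝ) : temporalWeight s x ≤ 1 :=
  min_le_right _ _

theorem temporalWeight_pos [NeZero d] {x : Fin d → ℝ} (hx : x 0 ≠ 0) : 0 < temporalWeight s x :=
  lt_min (Real.rpow_pos_of_pos (abs_pos.2 hx) _) one_pos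

theorem temporalWeight_continuous [NeZero d] (hs : ∀ i, 1 ≤ s i) :
    Continuous (temporalWeight s) := by
  unfold temporalWeight
  have h : (0 : ℝ) ≤ 1 / s 0 := by have := hs 0; positivity
  exact ((continuous_apply 0).abs.rpow_const fun x => Or.inr h).min continuous_const

/-- The integrand is a product over coordinates. Every coordinate but the one with index 0
contributes π, and in that one the width t^{𝔰₁/ℓ} turns the exponent a/𝔰₁ into a/ℓ. -/
theorem exists_integral_scaledCauchy_mul_temporalWeight_le [NeZero d] (hs : ∀ i, 1 ≤ s i)
    (hℓ : 0 < ℓ) {a : ℝ} (ha : 0 ≤ a) (has : a < s 0) :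
    ∃ C : ℝ, 0 < C ∧ ∀ t, 0 < t → t ≤ 2 → ∀ x : Fin d → ℝ,
      Integrable (fun y => scaledCauchy s ℓ t (x - y) * temporalWeight s y ^ (-a)) ∧
      ∫ y, scaledCauchy s ℓ t (x - y) * temporalWeight s y ^ (-a) ≤ C * t ^ (-(a / ℓ)) ∧
      (x 0 ≠ 0 → ∫ y, scaledCauchy s ℓ t (x - y) * temporalWeight s y ^ (-a) ≤
        C * temporalWeight s x ^ (-a)) := by
  have hs0 : 0 < s 0 := lt_of_lt_of_le one_pos (hs 0)
  obtain ⟨C, hC, h⟩ := exists_integral_cauchyKernel_mul_min_le hs0 ha has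
    (Real.rpow_pos_of_pos (zero_lt_two' ℝ) (s 0 / ℓ))
  refine ⟨C * Real.pi ^ (d - 1), by positivity, fun t ht ht2 x => ?_⟩
  have hr : ∀ i, 0 < t ^ (s i / ℓ) := fun i => Real.rpow_pos_of_pos ht _
  have hr2 : t ^ (s 0 / ℓ) ≤ 2 ^ (s 0 / ℓ) := Real.rpow_le_rpow ht.le ht2 (by positivity)
  obtain ⟨h1, h2, h3⟩ := h _ (hr 0) hr2 (x 0)
  let f : Fin d → ℝ → ℝ := fun i y => cauchyKernel (t ^ (s i / ℓ)) (x i - y) *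
    (if i = 0 then min (|y| ^ (1 / s 0)) 1 ^ (-a) else 1)
  have hf : ∀ y : Fin d → ℝ,
      scaledCauchy s ℓ t (x - y) * temporalWeight s y ^ (-a) = ∏ i, f i (y i) := by
    intro y
    simp only [f, scaledCauchy, Finset.prod_mul_distrib, Finset.prod_ite_eq', Finset.mem_univ,
      if_true, temporalWeight, Pi.sub_apply]
  have hfi : ∀ i, Integrable (f i) := by
    intro i
    by_cases hi : i = 0
    · subst hi; simpa [f] using h1
    · simpa [f, hi] using integrable_cauchyKernel (hr i) (x i)
  have hval : ∏ i, ∫ y, f i y =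
      (∫ y, cauchyKernel (t ^ (s 0 / ℓ)) (x 0 - y) * min (|y| ^ (1 / s 0)) 1 ^ (-a)) *
        Real.pi ^ (d - 1) := by
    rw [← Finset.mul_prod_erase Finset.univ _ (Finset.mem_univ (0 : Fin d))]
    congr 1
    · rw [Finset.prod_congr rfl (g := fun _ => Real.pi), Finset.prod_const,
        Finset.card_erase_of_mem (Finset.mem_univ _), Finset.card_univ, Fintype.card_fin]
      intro i hi
      have hi' := Finset.ne_of_mem_erase hi
      simp only [f, hi', if_false, mul_one]
      exact integral_cauchyKernel (hr i) (x i)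
  have hπ : 0 ≤ Real.pi ^ (d - 1) := by positivity
  refine ⟨?_, ?_, fun hx => ?_⟩
  · simp_rw [hf]
    exact Integrable.fintype_prod hfi
  · simp_rw [hf]
    rw [integral_fintype_prod_volume_eq_prod, hval, mul_right_comm]
    refine mul_le_mul_of_nonneg_right (h2.trans (le_of_eq ?_)) hπ
    rw [← Real.rpow_mul ht.le]
    congr 2
    field_simp
  · simp_rw [hf]
    rw [integral_fintype_prod_volume_eq_prod, hval, mul_right_comm]
    exact mul_le_mul_of_nonneg_right (h3 hx) hπ

end Kernel

end

/-! ### The anisotropic size and the domination of the kernel by Cauchy kernels. -/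

noncomputable section

section ScaledSize

variable {d : ℕ} {s : Fin d → ℝ} {ℓ : ℝ}

theorem scaledSize_nonneg (x : Fin d → ℝ) : 0 ≤ scaledSize s x :=
  Finset.sum_nonneg fun _ _ => Real.rpow_nonneg (abs_nonneg _) _

theorem scaledSize_continuous (hs : ∀ i, 1 ≤ s i) : Continuous (scaledSize s) := by
  refine continuous_finsetSum _ fun i _ => (continuous_apply i).abs.rpow_const fun x => Or.inr ?_
  have := hs i
  positivity

theorem scaledSize_neg (x : Fin d → ℝ) : scaledSize s (-x) = scaledSize s x := by
  simp [scaledSize]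

theorem scaledSize_sub_comm (x y : Fin d → ℝ) : scaledSize s (x - y) = scaledSize s (y - x) := by
  rw [← scaledSize_neg, neg_sub]

theorem scaledSize_zero (hs : ∀ i, 1 ≤ s i) : scaledSize s (0 : Fin d → ℝ) = 0 := by
  refine Finset.sum_eq_zero fun i _ => ?_
  have : (1 / s i) ≠ 0 := by have := hs i; positivity
  simp only [Pi.zero_apply, abs_zero, Real.zero_rpow this]

theorem scaledSize_pos {x : Fin d → ℝ} (hx : x ≠ 0) : 0 < scaledSize s x := by
  obtain ⟨i, hi⟩ := Function.ne_iff.1 hx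
  exact Finset.sum_pos' (fun _ _ => Real.rpow_nonneg (abs_nonneg _) _)
    ⟨i, Finset.mem_univ i, Real.rpow_pos_of_pos (abs_pos.2 hi) _⟩

theorem scaledSize_scaleBy (hs : ∀ i, 1 ≤ s i) {t : ℝ} (ht : 0 < t) (u : Fin d → ℝ) :
    scaledSize s (scaleBy s ℓ t u) = t ^ (1 / ℓ) * scaledSize s u := by
  unfold scaledSize scaleBy
  rw [Finset.mul_sum]
  refine Finset.sum_congr rfl fun i _ => ?_
  have hi : 0 < s i := lt_of_lt_of_le one_pos (hs i)
  rw [abs_mul, abs_of_pos (Real.rpow_pos_of_pos ht _),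
    Real.mul_rpow (Real.rpow_nonneg ht.le _) (abs_nonneg _), ← Real.rpow_mul ht.le]
  congr 2
  field_simp

theorem one_add_sq_le_scaledSize (hs : ∀ i, 1 ≤ s i) (u : Fin d → ℝ) (i : Fin d) :
    1 + u i ^ 2 ≤ (1 + scaledSize s u) ^ (2 * s i) := by
  have hi : 0 < s i := lt_of_lt_of_le one_pos (hs i)
  have h0 := scaledSize_nonneg (s := s) u
  have h1 : |u i| ^ (1 / s i) ≤ scaledSize s u :=
    Finset.single_le_sum (f := fun i => |u i| ^ (1 / s i))
      (fun _ _ => Real.rpow_nonneg (abs_nonneg _) _) (Finset.mem_univ i)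
  have h2 : |u i| ≤ scaledSize s u ^ s i := by
    have := Real.rpow_le_rpow (Real.rpow_nonneg (abs_nonneg _) _) h1 hi.le
    rwa [← Real.rpow_mul (abs_nonneg _), one_div_mul_cancel hi.ne', Real.rpow_one] at this
  have h3 : 1 + |u i| ≤ (1 + scaledSize s u) ^ s i := by
    have := Real.add_rpow_le_rpow_add zero_le_one h0 (hs i)
    rw [Real.one_rpow] at this
    linarith
  rw [mul_comm, Real.rpow_mul (by linarith), Real.rpow_two]
  have h4 := abs_nonneg (u i)
  rw [← sq_abs]
  nlinarith

/-- In the rescaled variable z the Cauchy product is t^{-|𝔰|/ℓ} ∏(1 + z_i²)⁻¹, so it suffices that G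
u^* ‖z‖^m ∏(1 + z_i²) is bounded. The polynomial factor is at most a constant times 1 + ‖z‖^N, and
the decay assumption is used with n = 0 and n = N. Times up to 2 are allowed because sums of two
times in (0, 1] occur later. -/
theorem scaledKernel_mul_le (hs : ∀ i, 1 ≤ s i) {G : (Fin d → ℝ) → ℝ}
    (hG0 : ∀ x, 0 ≤ G x) {u us : (Fin d → ℝ) → ℝ} (hu : IsGControlled s ℓ G u us) {m : ℝ}
    (hm : 0 ≤ m) :
    ∃ K : ℝ, 0 < K ∧ ∀ t, 0 < t → t ≤ 2 → ∀ x,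
      scaledKernel s ℓ G t x * (us x * scaledSize s x ^ m) ≤
        K * t ^ (m / ℓ) * scaledCauchy s ℓ t x := by
  obtain ⟨N, hN⟩ := exists_nat_ge (m + ∑ i, 2 * s i)
  obtain ⟨K₀, hK₀⟩ := hu.decay 0 2 two_pos
  obtain ⟨K₁, hK₁⟩ := hu.decay N 2 two_pos
  have hpoly : ∀ z : Fin d → ℝ, (∏ i, (1 + z i ^ 2)) * scaledSize s z ^ m ≤
      2 ^ N * (scaledSize s z ^ 0 + scaledSize s z ^ N) := by
    intro z
    have h0 := scaledSize_nonneg (s := s) z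
    have hp : 0 < 1 + scaledSize s z := by linarith
    calc (∏ i, (1 + z i ^ 2)) * scaledSize s z ^ m
        ≤ (∏ i, (1 + scaledSize s z) ^ (2 * s i)) * (1 + scaledSize s z) ^ m := by
          refine mul_le_mul (Finset.prod_le_prod (fun i _ => by positivity)
            fun i _ => one_add_sq_le_scaledSize hs z i)
            (Real.rpow_le_rpow h0 (by linarith) hm) (Real.rpow_nonneg h0 _)
            (Finset.prod_nonneg fun i _ => Real.rpow_nonneg hp.le _)
      _ = (1 + scaledSize s z) ^ (m + ∑ i, 2 * s i) := by
          rw [← Real.rpow_sum_of_pos hp, ← Real.rpow_add hp, add_comm m]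
      _ ≤ (1 + scaledSize s z) ^ (N : ℝ) :=
          Real.rpow_le_rpow_of_exponent_le (by linarith) hN
      _ = (1 + scaledSize s z) ^ N := Real.rpow_natCast _ _
      _ ≤ 2 ^ (N - 1) * (1 ^ N + scaledSize s z ^ N) := add_pow_le zero_le_one h0 N
      _ ≤ 2 ^ N * (scaledSize s z ^ 0 + scaledSize s z ^ N) := by
          rw [one_pow, pow_zero]
          exact mul_le_mul_of_nonneg_right
            (pow_le_pow_right₀ one_le_two (Nat.sub_le N 1)) (by positivity)
  refine ⟨max (2 ^ N * (K₀ + K₁)) 1, lt_of_lt_of_le one_pos (le_max_right _ _), ?_⟩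
  intro t ht ht2 x
  set z : Fin d → ℝ := fun i => t ^ (-(s i) / ℓ) * x i with hz
  have hx : scaleBy s ℓ t z = x := by
    funext i
    simp only [scaleBy, hz]
    rw [← mul_assoc, ← Real.rpow_add ht]
    simp [neg_div]
  have hP : 0 < ∏ i, (1 + z i ^ 2) := Finset.prod_pos fun i _ => by positivity
  have hcp : scaledCauchy s ℓ t x = t ^ (-(∑ i, s i) / ℓ) * (∏ i, (1 + z i ^ 2))⁻¹ := by
    rw [scaledCauchy, ← Finset.prod_inv_distrib, neg_div, Finset.sum_div, ← Finset.sum_neg_distrib,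
      Real.rpow_sum_of_pos ht, ← Finset.prod_mul_distrib]
    refine Finset.prod_congr rfl fun i _ => ?_
    rw [cauchyKernel_eq (Real.rpow_pos_of_pos ht _), Real.rpow_neg ht.le, hz]
    simp only
    rw [neg_div, Real.rpow_neg ht.le, div_eq_inv_mul (x i)]
  have h0 := scaledSize_nonneg (s := s) z
  have hus : 0 ≤ us x := zero_le_one.trans (hu.one_le_star x)
  have h1 := hK₀ t ht ht2 z
  have h2 := hK₁ t ht ht2 z
  rw [hx] at h1 h2
  have hmain : (∏ i, (1 + z i ^ 2)) * (scaledSize s z ^ m * (us x * G z)) ≤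
      max (2 ^ N * (K₀ + K₁)) 1 := by
    refine le_trans ?_ (le_max_left _ _)
    rw [← mul_assoc]
    refine (mul_le_mul_of_nonneg_right (hpoly z) (mul_nonneg hus (hG0 z))).trans ?_
    rw [mul_assoc]
    exact mul_le_mul_of_nonneg_left (by linarith) (by positivity)
  have hsz : scaledSize s x ^ m = t ^ (m / ℓ) * scaledSize s z ^ m := by
    conv_lhs => rw [← hx]
    rw [scaledSize_scaleBy hs ht, Real.mul_rpow (Real.rpow_nonneg ht.le _) h0,
      ← Real.rpow_mul ht.le]
    congr 2
    ring
  have hA : 0 ≤ t ^ (-(∑ i, s i) / ℓ) := Real.rpow_nonneg ht.le _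
  have hB : 0 ≤ t ^ (m / ℓ) := Real.rpow_nonneg ht.le _
  calc scaledKernel s ℓ G t x * (us x * scaledSize s x ^ m)
      = (t ^ (-(∑ i, s i) / ℓ) * t ^ (m / ℓ)) * (scaledSize s z ^ m * (us x * G z)) := by
        rw [hsz, scaledKernel]; ring
    _ ≤ (t ^ (-(∑ i, s i) / ℓ) * t ^ (m / ℓ)) *
        (max (2 ^ N * (K₀ + K₁)) 1 * (∏ i, (1 + z i ^ 2))⁻¹) := by
        refine mul_le_mul_of_nonneg_left ?_ (mul_nonneg hA hB)
        rw [← div_eq_mul_inv, le_div_iff₀ hP, mul_comm]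
        exact hmain
    _ = _ := by rw [hcp]; ring

theorem cauchyKernel_le_of_le {r r' c : ℝ} (hr : 0 < r) (h : r ≤ r') (hc : r' ≤ c * r) (u : ℝ) :
    cauchyKernel r' u ≤ c * cauchyKernel r u := by
  unfold cauchyKernel
  have hr' : 0 < r' := hr.trans_le h
  rw [← mul_div_assoc, div_le_div_iff₀ (by positivity) (by positivity)]
  have h1 : r ^ 2 ≤ r' ^ 2 := by gcongr
  exact mul_le_mul hc (by linarith) (by positivity) (by linarith)

theorem scaledCauchy_le_of_le (hs : ∀ i, 1 ≤ s i) (hℓ : 0 < ℓ) {t t' : ℝ} (ht : 0 < t)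
    (h : t ≤ t') (h2 : t' ≤ 2 * t) (z : Fin d → ℝ) :
    scaledCauchy s ℓ t' z ≤ (∏ i, (2 : ℝ) ^ (s i / ℓ)) * scaledCauchy s ℓ t z := by
  unfold scaledCauchy
  rw [← Finset.prod_mul_distrib]
  refine Finset.prod_le_prod (fun i _ => cauchyKernel_nonneg
    (Real.rpow_pos_of_pos (ht.trans_le h) _) _) fun i _ => ?_
  have hi : 0 ≤ s i / ℓ := div_nonneg (zero_le_one.trans (hs i)) hℓ.le
  refine cauchyKernel_le_of_le (Real.rpow_pos_of_pos ht _) (Real.rpow_le_rpow ht.le h hi) ?_ _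
  rw [← Real.mul_rpow zero_le_two ht.le]
  exact Real.rpow_le_rpow (ht.trans_le h).le h2 hi

/-- A shift by at most the width changes the kernel by a bounded factor; this provides the
dominating function for continuity in the base point. -/
theorem cauchyKernel_add_le {r u h : ℝ} (hr : 0 < r) (hh : |h| ≤ r) :
    cauchyKernel r (u + h) ≤ 3 * cauchyKernel r u := by
  unfold cauchyKernel
  rw [← mul_div_assoc, div_le_div_iff₀ (by positivity) (by positivity), mul_comm 3 r, mul_assoc]
  refine mul_le_mul_of_nonneg_left ?_ hr.le
  have : h ^ 2 ≤ r ^ 2 := by rw [← sq_abs h]; gcongr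
  nlinarith [sq_nonneg (u + 2 * h), sq_nonneg (u + h)]

end ScaledSize

/-! ### The kernel integrated against functions with a singularity at the hyperplane. -/

section Semigroup

variable {d : ℕ} {s : Fin d → ℝ} {ℓ : ℝ} {G : (Fin d → ℝ) → ℝ}
  {Q : ℝ → (Fin d → ℝ) → (Fin d → ℝ) → ℝ} {u us : (Fin d → ℝ) → ℝ}

theorem ae_apply_zero_ne_zero [NeZero d] : ∀ᵐ y : Fin d → ℝ, y 0 ≠ 0 := by
  rw [volume_pi]
  exact Measure.ae_eval_ne _ _ _

theorem IsGTypeSemigroup.continuous_right (hQ : IsGTypeSemigroup s ℓ G Q) {t : ℝ} (ht : 0 < t)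
    (x : Fin d → ℝ) : Continuous (Q t x) :=
  (hQ.continuous t ht).comp (Continuous.prodMk_right x)

theorem IsGTypeSemigroup.continuous_left (hQ : IsGTypeSemigroup s ℓ G Q) {t : ℝ} (ht : 0 < t)
    (y : Fin d → ℝ) : Continuous fun x => Q t x y :=
  (hQ.continuous t ht).comp (Continuous.prodMk_left y)

theorem IsGTypeSemigroup.abs_mul_le (hs : ∀ i, 1 ≤ s i) (hG0 : ∀ x, 0 ≤ G x)
    (hQ : IsGTypeSemigroup s ℓ G Q) (hu : IsGControlled s ℓ G u us) {m : ℝ} (hm : 0 ≤ m) :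
    ∃ K : ℝ, 0 < K ∧ ∀ t, 0 < t → t ≤ 2 → ∀ x y,
      |Q t x y| * (us (x - y) * scaledSize s (x - y) ^ m) ≤
        K * t ^ (m / ℓ) * scaledCauchy s ℓ t (x - y) := by
  obtain ⟨K, hK, h⟩ := scaledKernel_mul_le hs hG0 hu hm
  obtain ⟨C, hC, hb⟩ := hQ.upper_bound
  refine ⟨C * K, mul_pos hC hK, fun t ht ht2 x y => ?_⟩
  have h0 : 0 ≤ us (x - y) * scaledSize s (x - y) ^ m :=
    mul_nonneg (zero_le_one.trans (hu.one_le_star _)) (Real.rpow_nonneg (scaledSize_nonneg _) _)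
  refine (mul_le_mul_of_nonneg_right (hb t ht x y) h0).trans ?_
  have := mul_le_mul_of_nonneg_left (h t ht ht2 (x - y)) hC.le
  linarith

/-- Integration of a function with finitely many singular contributions against the kernel. -/
theorem IsGTypeSemigroup.integral_le [NeZero d] (hs : ∀ i, 1 ≤ s i) (hℓ : 0 < ℓ)
    (hG0 : ∀ x, 0 ≤ G x) (hQ : IsGTypeSemigroup s ℓ G Q) (hu : IsGControlled s ℓ G u us)
    {ι : Type*} [Fintype ι] (m a : ι → ℝ) (hm : ∀ i, 0 ≤ m i) (ha : ∀ i, 0 ≤ a i)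
    (has : ∀ i, a i < s 0) :
    ∃ C : ℝ, 0 < C ∧ ∀ t, 0 < t → t ≤ 2 → ∀ x, ∀ g : (Fin d → ℝ) → ℝ, Measurable g →
      ∀ κ : ι → ℝ, (∀ i, 0 ≤ κ i) →
      (∀ y, y 0 ≠ 0 → |g y| ≤ us (x - y) *
        ∑ i, κ i * (scaledSize s (x - y) ^ m i * temporalWeight s y ^ (-a i))) →
      Integrable (fun y => Q t x y * g y) ∧
      ∫ y, |Q t x y * g y| ≤ C * ∑ i, κ i * t ^ ((m i - a i) / ℓ) ∧
      (x 0 ≠ 0 → ∫ y, |Q t x y * g y| ≤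
        C * ∑ i, κ i * (t ^ (m i / ℓ) * temporalWeight s x ^ (-a i))) := by
  choose K hK hKb using fun i => IsGTypeSemigroup.abs_mul_le hs hG0 hQ hu (hm i)
  choose D hD hDb using fun i =>
    exists_integral_scaledCauchy_mul_temporalWeight_le hs hℓ (ha i) (has i)
  have hCi : ∀ i, K i * D i ≤ 1 + ∑ j, K j * D j := fun i =>
    (Finset.single_le_sum (f := fun j => K j * D j)
      (fun j _ => (mul_pos (hK j) (hD j)).le) (Finset.mem_univ i)).trans (by linarith)
  have hC0 : 0 ≤ ∑ j, K j * D j := Finset.sum_nonneg fun j _ => (mul_pos (hK j) (hD j)).le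
  -- The summand 1 keeps the constant positive when the index type is empty.
  refine ⟨1 + ∑ i, K i * D i, by linarith, ?_⟩
  intro t ht ht2 x g hg κ hκ hgb
  let F : (Fin d → ℝ) → ℝ := fun y => ∑ i, (κ i * K i * t ^ (m i / ℓ)) *
    (scaledCauchy s ℓ t (x - y) * temporalWeight s y ^ (-a i))
  have hF : Integrable F :=
    integrable_finsetSum _ fun i _ => ((hDb i t ht ht2 x).1).const_mul _
  have hle : ∀ᵐ y, ‖Q t x y * g y‖ ≤ F y := by
    filter_upwards [ae_apply_zero_ne_zero] with y hy
    rw [norm_mul, Real.norm_eq_abs, Real.norm_eq_abs]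
    refine (mul_le_mul_of_nonneg_left (hgb y hy) (abs_nonneg _)).trans ?_
    rw [← mul_assoc, Finset.mul_sum]
    refine Finset.sum_le_sum fun i _ => ?_
    have h1 := hKb i t ht ht2 x y
    have h2 : 0 ≤ κ i * temporalWeight s y ^ (-a i) :=
      mul_nonneg (hκ i) (Real.rpow_nonneg (temporalWeight_nonneg y) _)
    calc _ = (|Q t x y| * (us (x - y) * scaledSize s (x - y) ^ m i)) *
          (κ i * temporalWeight s y ^ (-a i)) := by ring
      _ ≤ _ := mul_le_mul_of_nonneg_right h1 h2
      _ = _ := by ring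
  have hint : Integrable (fun y => Q t x y * g y) :=
    hF.mono' (((hQ.continuous_right ht x).measurable.mul hg).aestronglyMeasurable) hle
  have hIF : ∫ y, F y = ∑ i, (κ i * K i * t ^ (m i / ℓ)) *
      ∫ y, scaledCauchy s ℓ t (x - y) * temporalWeight s y ^ (-a i) := by
    rw [integral_finsetSum _ fun i _ => ((hDb i t ht ht2 x).1).const_mul _]
    exact Finset.sum_congr rfl fun i _ => integral_const_mul _ _
  have hIle : ∫ y, |Q t x y * g y| ≤ ∫ y, F y := integral_mono_ae hint.norm hF hle
  rw [hIF] at hIle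
  have hco : ∀ i, 0 ≤ κ i * K i * t ^ (m i / ℓ) := fun i =>
    mul_nonneg (mul_nonneg (hκ i) (hK i).le) (Real.rpow_nonneg ht.le _)
  have hfin : ∀ X : ι → ℝ, (∀ i, 0 ≤ X i) →
      (∀ i, ∫ y, scaledCauchy s ℓ t (x - y) * temporalWeight s y ^ (-a i) ≤ D i * X i) →
      ∫ y, |Q t x y * g y| ≤ (1 + ∑ i, K i * D i) * ∑ i, κ i * (t ^ (m i / ℓ) * X i) := by
    intro X hX hXb
    refine hIle.trans ?_
    rw [Finset.mul_sum]
    refine Finset.sum_le_sum fun i _ => ?_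
    calc _ ≤ (κ i * K i * t ^ (m i / ℓ)) * (D i * X i) :=
          mul_le_mul_of_nonneg_left (hXb i) (hco i)
      _ = (K i * D i) * (κ i * (t ^ (m i / ℓ) * X i)) := by ring
      _ ≤ _ := mul_le_mul_of_nonneg_right (hCi i)
          (mul_nonneg (hκ i) (mul_nonneg (Real.rpow_nonneg ht.le _) (hX i)))
  refine ⟨hint, ?_, fun hx => ?_⟩
  · refine (hfin (fun i => t ^ (-(a i / ℓ))) (fun i => Real.rpow_nonneg ht.le _)
      fun i => (hDb i t ht ht2 x).2.1).trans (le_of_eq ?_)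
    congr 1
    refine Finset.sum_congr rfl fun i _ => ?_
    rw [← Real.rpow_add ht]
    congr 2
    ring
  · exact hfin (fun i => temporalWeight s x ^ (-a i))
      (fun i => Real.rpow_nonneg (temporalWeight_nonneg x) _)
      fun i => (hDb i t ht ht2 x).2.2 hx

/-- The form in which moderateness is used: the weight at the integration point is moved to the base
point, and the kernel absorbs the control function. -/
theorem IsGControlled.inv_le (hu : IsGControlled s ℓ G u us) (x y : Fin d → ℝ) :
    (u y)⁻¹ ≤ us (x - y) * (u x)⁻¹ := by
  have h := hu.moderate (x - y) y
  rw [sub_add_cancel] at h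
  rw [← div_eq_mul_inv, le_div_iff₀ (hu.pos x), inv_mul_le_iff₀ (hu.pos y), mul_comm]
  exact h

/-- The semigroup acting on a function dominated by the inverse of a controlled weight, with
singularities at the hyperplane. -/
theorem IsGTypeSemigroup.integral_weighted_le [NeZero d] (hs : ∀ i, 1 ≤ s i) (hℓ : 0 < ℓ)
    (hG0 : ∀ x, 0 ≤ G x) (hQ : IsGTypeSemigroup s ℓ G Q) (hu : IsGControlled s ℓ G u us)
    {ι : Type*} [Fintype ι] (a : ι → ℝ) (ha : ∀ i, 0 ≤ a i) (has : ∀ i, a i < s 0) :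
    ∃ C : ℝ, 0 < C ∧ ∀ t, 0 < t → t ≤ 2 → ∀ x, ∀ g : (Fin d → ℝ) → ℝ, Measurable g →
      ∀ κ : ι → ℝ, (∀ i, 0 ≤ κ i) →
      (∀ y, y 0 ≠ 0 → |g y| ≤ (u y)⁻¹ * ∑ i, κ i * temporalWeight s y ^ (-a i)) →
      Integrable (fun y => Q t x y * g y) ∧
      ∫ y, |Q t x y * g y| ≤ C * ((u x)⁻¹ * ∑ i, κ i * t ^ (-a i / ℓ)) ∧
      (x 0 ≠ 0 → ∫ y, |Q t x y * g y| ≤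
        C * ((u x)⁻¹ * ∑ i, κ i * temporalWeight s x ^ (-a i))) := by
  obtain ⟨C, hC, h⟩ := IsGTypeSemigroup.integral_le hs hℓ hG0 hQ hu (fun _ : ι => 0) a
    (fun _ => le_rfl) ha has
  refine ⟨C, hC, fun t ht ht2 x g hg κ hκ hgb => ?_⟩
  have hux : 0 ≤ (u x)⁻¹ := inv_nonneg.2 (hu.pos x).le
  obtain ⟨h1, h2, h3⟩ := h t ht ht2 x g hg (fun i => (u x)⁻¹ * κ i)
    (fun i => mul_nonneg hux (hκ i)) (fun y hy => by
      refine (hgb y hy).trans ?_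
      have h0 : 0 ≤ ∑ i, κ i * temporalWeight s y ^ (-a i) := Finset.sum_nonneg fun i _ =>
        mul_nonneg (hκ i) (Real.rpow_nonneg (temporalWeight_nonneg y) _)
      refine (mul_le_mul_of_nonneg_right (hu.inv_le x y) h0).trans (le_of_eq ?_)
      simp only [Real.rpow_zero, one_mul, mul_assoc, Finset.mul_sum])
  simp only [mul_assoc, ← Finset.mul_sum, zero_sub, zero_div, Real.rpow_zero, one_mul] at h2 h3
  exact ⟨h1, h2, h3⟩

end Semigroup

end

/-! ### Composition, continuity and time regularity of the operators Q_t. -/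

noncomputable section

/-- The operator with kernel `Q t`, for an arbitrary real time. -/
def kernelOp {d : ℕ} (Q : ℝ → (Fin d → ℝ) → (Fin d → ℝ) → ℝ) (t : ℝ) (g : (Fin d → ℝ) → ℝ)
    (x : Fin d → ℝ) : ℝ :=
  ∫ y, Q t x y * g y

/-- Measurable functions bounded by the inverse of `u`, up to an integrable singularity at the
hyperplane. -/
def HyperplaneDominated {d : ℕ} [NeZero d] (s : Fin d → ℝ) (u g : (Fin d → ℝ) → ℝ) : Prop :=
  Measurable g ∧ ∃ κ a : ℝ, 0 ≤ κ ∧ 0 ≤ a ∧ a < s 0 ∧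
    ∀ y, y 0 ≠ 0 → |g y| ≤ (u y)⁻¹ * (κ * temporalWeight s y ^ (-a))

section Semigroup

variable {d : ℕ} {s : Fin d → ℝ} {ℓ : ℝ} {G : (Fin d → ℝ) → ℝ}
  {Q : ℝ → (Fin d → ℝ) → (Fin d → ℝ) → ℝ} {u us : (Fin d → ℝ) → ℝ}

theorem HyperplaneDominated.of_le [NeZero d] (hs : ∀ i, 1 ≤ s i) {g : (Fin d → ℝ) → ℝ}
    (hg : Measurable g) {κ : ℝ} (hκ : 0 ≤ κ) (h : ∀ y, |g y| ≤ κ * (u y)⁻¹) :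
    HyperplaneDominated s u g :=
  ⟨hg, κ, 0, hκ, le_rfl, lt_of_lt_of_le one_pos (hs 0), fun y _ => by
    simpa [mul_comm] using h y⟩

theorem HyperplaneDominated.of_sum_le [NeZero d] (hs : ∀ i, 1 ≤ s i) {ι : Type*} [Fintype ι]
    (hu : ∀ x, 0 < u x) {g : (Fin d → ℝ) → ℝ} (hg : Measurable g) {κ a : ι → ℝ}
    (hκ : ∀ i, 0 ≤ κ i) (has : ∀ i, a i < s 0)
    (h : ∀ y, y 0 ≠ 0 → |g y| ≤ (u y)⁻¹ * ∑ i, κ i * temporalWeight s y ^ (-a i)) :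
    HyperplaneDominated s u g := by
  have hs0 : 0 < s 0 := lt_of_lt_of_le one_pos (hs 0)
  obtain ⟨b, hb0, hbs, hb⟩ : ∃ b, 0 ≤ b ∧ b < s 0 ∧ ∀ i, a i ≤ b := by
    classical
    -- Since φ ≤ 1, the largest exponent dominates all the others. Inserting 0 makes the maximum
    -- nonnegative and covers an empty index type.
    let S : Finset ℝ := insert 0 (Finset.univ.image a)
    have hS : S.Nonempty := ⟨0, Finset.mem_insert_self _ _⟩
    refine ⟨S.max' hS, S.le_max' _ (Finset.mem_insert_self _ _), ?_, fun i =>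
      S.le_max' _ (Finset.mem_insert_of_mem (Finset.mem_image_of_mem _ (Finset.mem_univ i)))⟩
    rw [Finset.max'_lt_iff]
    intro y hy
    rcases Finset.mem_insert.1 hy with rfl | hy
    · exact hs0
    · obtain ⟨i, -, rfl⟩ := Finset.mem_image.1 hy
      exact has i
  refine ⟨hg, ∑ i, κ i, b, Finset.sum_nonneg fun i _ => hκ i, hb0, hbs, fun y hy => ?_⟩
  refine (h y hy).trans (mul_le_mul_of_nonneg_left ?_ (inv_nonneg.2 (hu y).le))
  rw [Finset.sum_mul]
  refine Finset.sum_le_sum fun i _ => mul_le_mul_of_nonneg_left ?_ (hκ i)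
  exact Real.rpow_le_rpow_of_exponent_ge (temporalWeight_pos hy) (temporalWeight_le_one y)
    (neg_le_neg (hb i))

variable [NeZero d] (hs : ∀ i, 1 ≤ s i) (hℓ : 0 < ℓ) (hG0 : ∀ x, 0 ≤ G x)
  (hQ : IsGTypeSemigroup s ℓ G Q) (hu : IsGControlled s ℓ G u us)
include hs hℓ hG0 hQ hu

/-- Any positive time smooths the singularity out: what remains is a multiple of u⁻¹ alone, so the
class is stable under the semigroup. -/
theorem kernelOp_dominated {g : (Fin d → ℝ) → ℝ} (hg : HyperplaneDominated s u g) {t : ℝ}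
    (ht : 0 < t) (ht2 : t ≤ 2) :
    ∃ K : ℝ, 0 ≤ K ∧ ∀ x, Integrable (fun y => Q t x y * g y) ∧
      ∫ y, |Q t x y * g y| ≤ K * (u x)⁻¹ := by
  obtain ⟨hgm, κ, a, hκ, ha, has, hb⟩ := hg
  obtain ⟨C, hC, h⟩ := IsGTypeSemigroup.integral_weighted_le hs hℓ hG0 hQ hu
    (fun _ : Unit => a) (fun _ => ha) (fun _ => has)
  refine ⟨C * (κ * t ^ (-a / ℓ)), mul_nonneg hC.le (mul_nonneg hκ (Real.rpow_nonneg ht.le _)),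
    fun x => ?_⟩
  obtain ⟨h1, h2, -⟩ := h t ht ht2 x g hgm (fun _ => κ) (fun _ => hκ)
    (fun y hy => by simpa using hb y hy)
  refine ⟨h1, h2.trans (le_of_eq ?_)⟩
  simp only [Finset.univ_unique, Finset.sum_const, Finset.card_singleton, one_smul]
  ring

omit [NeZero d] hs hℓ hG0 hu in
theorem kernelOp_measurable {g : (Fin d → ℝ) → ℝ} (hg : Measurable g) {t : ℝ} (ht : 0 < t) :
    Measurable (kernelOp Q t g) := by
  have h : Measurable (Function.uncurry fun x y : Fin d → ℝ => Q t x y * g y) :=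
    (hQ.continuous t ht).measurable.mul (hg.comp measurable_snd)
  exact (h.stronglyMeasurable.integral_prod_right).measurable

theorem kernelOp_hyperplaneDominated {g : (Fin d → ℝ) → ℝ} (hg : HyperplaneDominated s u g)
    {t : ℝ} (ht : 0 < t) (ht2 : t ≤ 2) : HyperplaneDominated s u (kernelOp Q t g) := by
  obtain ⟨K, hK, h⟩ := kernelOp_dominated hs hℓ hG0 hQ hu hg ht ht2
  exact HyperplaneDominated.of_le hs (kernelOp_measurable hQ hg.1 ht) hK
    fun x => abs_integral_le_integral_abs.trans (h x).2

theorem kernelOp_kernelOp {g : (Fin d → ℝ) → ℝ} (hg : HyperplaneDominated s u g) {r t : ℝ}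
    (hr : 0 < r) (hr2 : r ≤ 2) (ht : 0 < t) (ht2 : t ≤ 2) (x : Fin d → ℝ) :
    kernelOp Q r (kernelOp Q t g) x = kernelOp Q (r + t) g x := by
  obtain ⟨K, hK, h⟩ := kernelOp_dominated hs hℓ hG0 hQ hu hg ht ht2
  have hmeas : Measurable (Function.uncurry fun z y : Fin d → ℝ => Q r x z * (Q t z y * g y)) :=
    ((hQ.continuous_right hr x).measurable.comp measurable_fst).mul
      ((hQ.continuous t ht).measurable.mul (hg.1.comp measurable_snd))
  -- Fubini needs absolute integrability of the double integrand. It follows from the domination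
  -- lemma applied twice, the second time to this function.
  have habs : HyperplaneDominated s u fun z => ∫ y, |Q t z y * g y| := by
    refine HyperplaneDominated.of_le hs ?_ hK fun z => ?_
    · have h : Measurable (Function.uncurry fun x y : Fin d → ℝ => |Q t x y * g y|) :=
        ((hQ.continuous t ht).measurable.mul (hg.1.comp measurable_snd)).norm
      exact (h.stronglyMeasurable.integral_prod_right).measurable
    · rw [abs_of_nonneg (integral_nonneg fun y => abs_nonneg _)]
      exact (h z).2
  obtain ⟨K', hK', h'⟩ := kernelOp_dominated hs hℓ hG0 hQ hu habs hr hr2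
  have hint : Integrable (Function.uncurry fun z y : Fin d → ℝ => Q r x z * (Q t z y * g y))
      (volume.prod volume) := by
    rw [integrable_prod_iff hmeas.aestronglyMeasurable]
    refine ⟨Eventually.of_forall fun z => by
      simp only [Function.uncurry_apply_pair]
      exact ((h z).1).const_mul _, ?_⟩
    refine ((h' x).1).norm.congr (Eventually.of_forall fun z => ?_)
    change |Q r x z * (∫ y, |Q t z y * g y|)| = ∫ y, |Q r x z * (Q t z y * g y)|
    simp_rw [abs_mul (Q r x z)]
    rw [integral_const_mul, abs_of_nonneg (integral_nonneg fun y => abs_nonneg (Q t z y * g y))]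
  unfold kernelOp
  simp_rw [← integral_const_mul]
  rw [integral_integral_swap hint]
  refine integral_congr_ae (Eventually.of_forall fun y => ?_)
  have hsg := hQ.semigroup t (r + t) ht (by linarith) x y
  rw [add_sub_cancel_right] at hsg
  simp only [← mul_assoc]
  rw [integral_mul_const, hsg]

theorem kernelOp_continuous {g : (Fin d → ℝ) → ℝ} (hg : HyperplaneDominated s u g) {t : ℝ}
    (ht : 0 < t) (ht2 : t ≤ 2) : Continuous (kernelOp Q t g) := by
  obtain ⟨hgm, κ, a, hκ, ha, has, hb⟩ := hg
  obtain ⟨K, hK, hKb⟩ := IsGTypeSemigroup.abs_mul_le hs hG0 hQ hu le_rfl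
  obtain ⟨D, hD, hDb⟩ :=
    exists_integral_scaledCauchy_mul_temporalWeight_le hs hℓ ha has
  have hux0 : ∀ x, 0 < u x := hu.pos
  rw [continuous_iff_continuousAt]
  intro x₀
  refine continuousAt_of_dominated
    (bound := fun y => (K * 3 ^ d * ((u x₀)⁻¹ + 1) * κ) *
      (scaledCauchy s ℓ t (x₀ - y) * temporalWeight s y ^ (-a)))
    (Eventually.of_forall fun x =>
      ((hQ.continuous_right ht x).measurable.mul hgm).aestronglyMeasurable)
    ?_ (((hDb t ht ht2 x₀).1).const_mul _)
    (Eventually.of_forall fun y => ((hQ.continuous_left ht y).mul continuous_const).continuousAt)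
  have e1 : ∀ᶠ x in 𝓝 x₀, (u x)⁻¹ < (u x₀)⁻¹ + 1 :=
    (hu.continuous.continuousAt.inv₀ (hux0 x₀).ne').eventually_lt continuousAt_const (lt_add_one _)
  -- Within one width of x₀ the Cauchy product at x is at most 3^d times the one at x₀, which gives
  -- an integrable bound independent of x.
  have e2 : ∀ᶠ x in 𝓝 x₀, ∀ i, |x i - x₀ i| < t ^ (s i / ℓ) := by
    rw [eventually_all]
    intro i
    have : ContinuousAt (fun x : Fin d → ℝ => |x i - x₀ i|) x₀ :=
      ((continuous_apply i).sub continuous_const).abs.continuousAt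
    exact this.eventually_lt continuousAt_const (by simpa using Real.rpow_pos_of_pos ht _)
  filter_upwards [e1, e2] with x hx1 hx2
  filter_upwards [ae_apply_zero_ne_zero] with y hy
  have hcp : scaledCauchy s ℓ t (x - y) ≤ 3 ^ d * scaledCauchy s ℓ t (x₀ - y) := by
    unfold scaledCauchy
    have h3 : (3 : ℝ) ^ d = ∏ _i : Fin d, (3 : ℝ) := by simp
    rw [h3, ← Finset.prod_mul_distrib]
    refine Finset.prod_le_prod (fun i _ => cauchyKernel_nonneg (Real.rpow_pos_of_pos ht _) _)
      fun i _ => ?_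
    have := cauchyKernel_add_le (u := x₀ i - y i) (Real.rpow_pos_of_pos ht (s i / ℓ)) (hx2 i).le
    simpa [Pi.sub_apply, show x₀ i - y i + (x i - x₀ i) = x i - y i by ring] using this
  have hφ : 0 ≤ κ * temporalWeight s y ^ (-a) :=
    mul_nonneg hκ (Real.rpow_nonneg (temporalWeight_nonneg y) _)
  have hq := hKb t ht ht2 x y
  simp only [Real.rpow_zero, mul_one, zero_div] at hq
  have hux : 0 ≤ (u x)⁻¹ := inv_nonneg.2 (hux0 x).le
  rw [norm_mul, Real.norm_eq_abs, Real.norm_eq_abs]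
  calc |Q t x y| * |g y| ≤ |Q t x y| * ((us (x - y) * (u x)⁻¹) *
        (κ * temporalWeight s y ^ (-a))) :=
        mul_le_mul_of_nonneg_left ((hb y hy).trans
          (mul_le_mul_of_nonneg_right (hu.inv_le x y) hφ)) (abs_nonneg _)
    _ = (|Q t x y| * us (x - y)) * ((u x)⁻¹ * (κ * temporalWeight s y ^ (-a))) := by ring
    _ ≤ (K * (3 ^ d * scaledCauchy s ℓ t (x₀ - y))) *
        (((u x₀)⁻¹ + 1) * (κ * temporalWeight s y ^ (-a))) := by
        refine mul_le_mul (hq.trans (mul_le_mul_of_nonneg_left hcp hK.le))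
          (mul_le_mul_of_nonneg_right hx1.le hφ) (mul_nonneg hux hφ) ?_
        exact mul_nonneg hK.le (mul_nonneg (by positivity) (scaledCauchy_nonneg ht _))
    _ = _ := by ring

-- Mean value inequality in time. The condition h ≤ r keeps all intermediate times in [r, 2r], where
-- the Cauchy products are comparable to the one at r.
omit [NeZero d] in
theorem abs_kernel_sub_mul_le :
    ∃ K : ℝ, 0 < K ∧ ∀ r h, 0 < r → 0 ≤ h → h ≤ r → r + h ≤ 2 → ∀ x y,
      |Q (r + h) x y - Q r x y| * us (x - y) ≤ K * (h / r) * scaledCauchy s ℓ r (x - y) := by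
  obtain ⟨K, hK, hKb⟩ := scaledKernel_mul_le hs hG0 hu le_rfl
  obtain ⟨C, hC, hCb⟩ := hQ.deriv_bound
  have hP : 0 < ∏ i, (2 : ℝ) ^ (s i / ℓ) :=
    Finset.prod_pos fun i _ => Real.rpow_pos_of_pos two_pos _
  refine ⟨C * K * ∏ i, (2 : ℝ) ^ (s i / ℓ), by positivity, ?_⟩
  intro r h hr hh hhr hr2 x y
  have hus : 0 < us (x - y) := lt_of_lt_of_le one_pos (hu.one_le_star _)
  have hmv := (convex_Icc r (r + h)).norm_image_sub_le_of_norm_deriv_le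
    (f := fun t => Q t x y) (x := r) (y := r + h)
    (C := C * K * (∏ i, (2 : ℝ) ^ (s i / ℓ)) * r⁻¹ * scaledCauchy s ℓ r (x - y) / us (x - y))
    (fun t ht => hQ.differentiable t (hr.trans_le ht.1) x y)
    (fun t ht => by
      have htp := hr.trans_le ht.1
      have ht2 : t ≤ 2 := ht.2.trans hr2
      rw [le_div_iff₀ hus, Real.norm_eq_abs]
      have h1 := hKb t htp ht2 (x - y)
      simp only [Real.rpow_zero, mul_one, zero_div] at h1
      have h2 := scaledCauchy_le_of_le hs hℓ hr ht.1 (by linarith [ht.2]) (x - y)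
      have hi : t⁻¹ ≤ r⁻¹ := inv_anti₀ hr ht.1
      have hti : 0 ≤ t⁻¹ := inv_nonneg.2 htp.le
      have hcr := scaledCauchy_nonneg (s := s) (ℓ := ℓ) hr (x - y)
      calc _ ≤ (C * t⁻¹ * scaledKernel s ℓ G t (x - y)) * us (x - y) :=
            mul_le_mul_of_nonneg_right (hCb t htp x y) hus.le
        _ = (C * t⁻¹) * (scaledKernel s ℓ G t (x - y) * us (x - y)) := by ring
        _ ≤ (C * r⁻¹) * (K * ((∏ i, (2 : ℝ) ^ (s i / ℓ)) * scaledCauchy s ℓ r (x - y))) := by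
            refine mul_le_mul (mul_le_mul_of_nonneg_left hi hC.le)
              (h1.trans (mul_le_mul_of_nonneg_left h2 hK.le)) ?_ (by positivity)
            exact mul_nonneg (mul_nonneg (Real.rpow_nonneg htp.le _) (hG0 _)) hus.le
        _ = _ := by ring)
    ⟨le_rfl, by linarith⟩ ⟨by linarith, le_rfl⟩
  rw [Real.norm_eq_abs, Real.norm_eq_abs, add_sub_cancel_left, abs_of_nonneg hh] at hmv
  refine (mul_le_mul_of_nonneg_right hmv hus.le).trans (le_of_eq ?_)
  field_simp

theorem abs_kernelOp_add_sub_le :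
    ∃ C : ℝ, 0 < C ∧ ∀ r h, 0 < r → 0 ≤ h → h ≤ r → r + h ≤ 2 → ∀ g : (Fin d → ℝ) → ℝ,
      Measurable g → ∀ κ : ℝ, 0 ≤ κ → (∀ y, |g y| ≤ κ * (u y)⁻¹) → ∀ x,
      |kernelOp Q (r + h) g x - kernelOp Q r g x| ≤ C * (h / r) * κ * (u x)⁻¹ := by
  obtain ⟨K, hK, hKb⟩ := abs_kernel_sub_mul_le hs hℓ hG0 hQ hu
  have hs0 : 0 < s 0 := lt_of_lt_of_le one_pos (hs 0)
  obtain ⟨D, hD, hDb⟩ :=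
    exists_integral_scaledCauchy_mul_temporalWeight_le hs hℓ le_rfl hs0
  simp only [neg_zero, Real.rpow_zero, mul_one, zero_div] at hDb
  refine ⟨K * D, by positivity, fun r h hr hh hhr hr2 g hg κ hκ hgb x => ?_⟩
  have hdom := HyperplaneDominated.of_le hs hg hκ hgb
  obtain ⟨_, _, h1⟩ := kernelOp_dominated hs hℓ hG0 hQ hu hdom (by linarith : 0 < r + h) hr2
  obtain ⟨_, _, h2⟩ := kernelOp_dominated hs hℓ hG0 hQ hu hdom hr (by linarith)
  unfold kernelOp
  rw [← integral_sub (h1 x).1 (h2 x).1, ← Real.norm_eq_abs]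
  obtain ⟨hi, hI, -⟩ := hDb r hr (by linarith) x
  have hux : 0 ≤ (u x)⁻¹ := inv_nonneg.2 (hu.pos x).le
  have hhr0 : 0 ≤ h / r := div_nonneg hh hr.le
  refine (norm_integral_le_of_norm_le (hi.const_mul (K * (h / r) * κ * (u x)⁻¹))
    (Eventually.of_forall fun y => ?_)).trans ?_
  · rw [← sub_mul, norm_mul, Real.norm_eq_abs, Real.norm_eq_abs]
    calc _ ≤ |Q (r + h) x y - Q r x y| * (κ * (us (x - y) * (u x)⁻¹)) :=
          mul_le_mul_of_nonneg_left ((hgb y).trans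
            (mul_le_mul_of_nonneg_left (hu.inv_le x y) hκ)) (abs_nonneg _)
      _ = (|Q (r + h) x y - Q r x y| * us (x - y)) * (κ * (u x)⁻¹) := by ring
      _ ≤ (K * (h / r) * scaledCauchy s ℓ r (x - y)) * (κ * (u x)⁻¹) :=
          mul_le_mul_of_nonneg_right (hKb r h hr hh hhr hr2 x y) (mul_nonneg hκ hux)
      _ = _ := by ring
  · rw [integral_const_mul]
    refine (mul_le_mul_of_nonneg_left hI (by positivity)).trans (le_of_eq ?_)
    ring

end Semigroup

end

noncomputable section

/-! ## Reconstruction of abstract germs -/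

/-- Comparable times may be exchanged in any power, whatever its sign. -/
theorem rpow_le_four_rpow_abs {r t : ℝ} (ht : 0 < t) (h1 : t / 4 ≤ r) (h2 : r ≤ t) (e : ℝ) :
    r ^ e ≤ 4 ^ |e| * t ^ e := by
  have hr : 0 < r := lt_of_lt_of_le (by positivity) h1
  have hte : 0 ≤ t ^ e := Real.rpow_nonneg ht.le _
  rcases le_total 0 e with he | he
  · refine (Real.rpow_le_rpow hr.le h2 he).trans (le_mul_of_one_le_left hte ?_)
    exact Real.one_le_rpow (by norm_num) (abs_nonneg e)
  · refine (Real.rpow_le_rpow_of_nonpos (by positivity) h1 he).trans (le_of_eq ?_)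
    rw [Real.div_rpow ht.le (by norm_num), abs_of_nonpos he, Real.rpow_neg (by norm_num)]
    field_simp

/-- The increments are controlled only from index m on, because the dyadic approximations at time t
are meaningful only once 2^{-n} is well below t. -/
theorem exists_tendsto_of_geometric {a : ℕ → ℝ} {q E : ℝ} {m : ℕ} (hq : q < 1)
    (h : ∀ n, m ≤ n → |a (n + 1) - a n| ≤ E * q ^ n) :
    ∃ l, Tendsto a atTop (𝓝 l) ∧ ∀ n, m ≤ n → |l - a n| ≤ E * q ^ n / (1 - q) := by
  have hd : ∀ n, dist (a (n + m)) (a (n + 1 + m)) ≤ E * q ^ m * q ^ n := by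
    intro n
    rw [dist_comm, Real.dist_eq, show n + 1 + m = n + m + 1 by ring]
    refine (h (n + m) (Nat.le_add_left _ _)).trans (le_of_eq ?_)
    rw [pow_add]; ring
  obtain ⟨l, hl⟩ := cauchySeq_tendsto_of_complete
    (cauchySeq_of_le_geometric q (E * q ^ m) hq hd)
  refine ⟨l, (tendsto_add_atTop_iff_nat m).1 hl, fun n hn => ?_⟩
  have := dist_le_of_le_geometric_of_tendsto q (E * q ^ m) hq hd hl (n - m)
  rw [Nat.sub_add_cancel hn, dist_comm, Real.dist_eq, mul_assoc, ← pow_add,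
    Nat.add_sub_cancel' hn] at this
  exact this

/-- The window [t/4, t/2] contains a dyadic time and is the one in which `GermBound.step` is
assumed. -/
theorem exists_inv_two_pow_mem {t : ℝ} (ht : 0 < t) (ht2 : t ≤ 2) :
    ∃ m : ℕ, t / 4 ≤ (2⁻¹ : ℝ) ^ m ∧ (2⁻¹ : ℝ) ^ m ≤ t / 2 := by
  obtain ⟨n, h1, h2⟩ := exists_nat_pow_near_of_lt_one (x := t / 2) (y := (2⁻¹ : ℝ))
    (by positivity) (by linarith) (by norm_num) (by norm_num)
  refine ⟨n + 1, ?_, h1.le⟩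
  rw [pow_succ]
  linarith

/-- The diagonal `F t y = Q_t(y, Λ_y)` of a germ `Λ` whose reconstruction has order `γ`, with
coefficients `p i` for the contribution of homogeneity `α i`. -/
structure GermBound {d : ℕ} [NeZero d] (s : Fin d → ℝ) (ℓ : ℝ)
    (Q : ℝ → (Fin d → ℝ) → (Fin d → ℝ) → ℝ) (W : (Fin d → ℝ) → ℝ) (γ : ℝ) {ι : Type*} [Fintype ι]
    (α θ : ι → ℝ) (F : ℝ → (Fin d → ℝ) → ℝ) (p : ι → ℝ → ℝ) : Prop where
  measurable : ∀ t, 0 < t → t ≤ 1 → Measurable (F t)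
  nonneg : ∀ i t, 0 ≤ p i t
  mono : ∀ i, Monotone (p i)
  size : ∀ t, 0 < t → t ≤ 1 → ∀ y, y 0 ≠ 0 → |F t y| ≤
    (W y)⁻¹ * ∑ i, p i t * t ^ (α i / ℓ) * temporalWeight s y ^ (-(α i - θ i))
  step : ∀ t, 0 < t → t ≤ 1 → ∀ r, t / 4 ≤ r → r ≤ t / 2 → ∀ y, y 0 ≠ 0 →
    |F t y - kernelOp Q (t - r) (F r) y| ≤
      (W y)⁻¹ * ∑ i, p i t * t ^ (γ / ℓ) * temporalWeight s y ^ (-(γ - θ i))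

/-- The dyadic approximations of the reconstruction. -/
def reconstructionSeq {d : ℕ} (Q : ℝ → (Fin d → ℝ) → (Fin d → ℝ) → ℝ)
    (F : ℝ → (Fin d → ℝ) → ℝ) (t : ℝ) (x : Fin d → ℝ) (n : ℕ) : ℝ :=
  kernelOp Q (t - 2⁻¹ ^ n) (F (2⁻¹ ^ n)) x

/-- The reconstruction `Q_t(x, 𝓡F)`. -/
def reconstruction {d : ℕ} (Q : ℝ → (Fin d → ℝ) → (Fin d → ℝ) → ℝ)
    (F : ℝ → (Fin d → ℝ) → ℝ) (t : ℝ) (x : Fin d → ℝ) : ℝ :=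
  limUnder atTop (reconstructionSeq Q F t x)

section Core

variable {d : ℕ} [NeZero d] {s : Fin d → ℝ} {ℓ : ℝ} {G : (Fin d → ℝ) → ℝ}
  {Q : ℝ → (Fin d → ℝ) → (Fin d → ℝ) → ℝ} {W Ws : (Fin d → ℝ) → ℝ}
  {γ : ℝ} {ι : Type*} [Fintype ι] {α θ : ι → ℝ}

theorem inv_two_pow_le_one (n : ℕ) : (2⁻¹ : ℝ) ^ n ≤ 1 := pow_le_one₀ (by norm_num) (by norm_num)

theorem inv_two_pow_pos (n : ℕ) : (0 : ℝ) < 2⁻¹ ^ n := by positivity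

variable (hs : ∀ i, 1 ≤ s i) (hℓ : 0 < ℓ) (hG0 : ∀ x, 0 ≤ G x)
  (hQ : IsGTypeSemigroup s ℓ G Q) (hW : IsGControlled s ℓ G W Ws)
  (hαγ : ∀ i, α i < γ) (hθα : ∀ i, θ i ≤ α i) (hθs : ∀ i, γ - s 0 < θ i)
include hs hαγ hθα hθs

omit hθα in
include hW in
theorem GermBound.dominated {F : ℝ → (Fin d → ℝ) → ℝ} {p : ι → ℝ → ℝ}
    (hF : GermBound s ℓ Q W γ α θ F p) {t : ℝ} (ht : 0 < t) (ht1 : t ≤ 1) :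
    HyperplaneDominated s W (F t) :=
  HyperplaneDominated.of_sum_le hs hW.pos (hF.measurable t ht ht1)
    (fun i => mul_nonneg (hF.nonneg i t) (Real.rpow_nonneg ht.le _))
    (fun i => by linarith [hαγ i, hθs i]) (hF.size t ht ht1)

include hℓ hG0 hQ hW

/-- The central estimate. The difference is Q_{t-σ} applied to the one-step defect at scale σ =
2^{-n}, which is of order σ^{γ/ℓ} with a singularity of exponent γ - θ_i < 𝔰₁. Integrating the
singularity out yields either a power of t or, off the hyperplane, the same power of φ(x). The
constant depends neither on the germ nor on its coefficients. -/
theorem GermBound.exists_step_le :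
    ∃ C : ℝ, 0 < C ∧ ∀ (F : ℝ → (Fin d → ℝ) → ℝ) (p : ι → ℝ → ℝ),
      GermBound s ℓ Q W γ α θ F p → ∀ t, 0 < t → t ≤ 2 → ∀ x, ∀ n : ℕ, (2⁻¹ : ℝ) ^ n ≤ t / 2 →
      |reconstructionSeq Q F t x (n + 1) - reconstructionSeq Q F t x n| ≤
        (C * ((W x)⁻¹ * ∑ i, p i t * t ^ (-(γ - θ i) / ℓ))) * ((2⁻¹ : ℝ) ^ (γ / ℓ)) ^ n ∧
      (x 0 ≠ 0 → |reconstructionSeq Q F t x (n + 1) - reconstructionSeq Q F t x n| ≤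
        (C * ((W x)⁻¹ * ∑ i, p i t * temporalWeight s x ^ (-(γ - θ i)))) *
          ((2⁻¹ : ℝ) ^ (γ / ℓ)) ^ n) := by
  have ha : ∀ i, 0 ≤ γ - θ i := fun i => by linarith [hαγ i, hθα i]
  have has : ∀ i, γ - θ i < s 0 := fun i => by linarith [hθs i]
  obtain ⟨C, hC, h⟩ := IsGTypeSemigroup.integral_weighted_le hs hℓ hG0 hQ hW
    (fun i => γ - θ i) ha has
  obtain ⟨M, hM⟩ := Finite.exists_le fun i => (4 : ℝ) ^ |-(γ - θ i) / ℓ|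
  refine ⟨C * max M 1, by positivity, fun F p hF t ht ht2 x n hn => ?_⟩
  set σ : ℝ := 2⁻¹ ^ n with hσ
  have hσ0 : 0 < σ := inv_two_pow_pos n
  have hσ1 : σ ≤ 1 := inv_two_pow_le_one n
  have hσ' : (2⁻¹ : ℝ) ^ (n + 1) = σ / 2 := by rw [pow_succ, hσ]; ring
  have hd1 := hF.dominated hs hW hαγ hθs hσ0 hσ1
  have hd2 := hF.dominated hs hW hαγ hθs (half_pos hσ0) (by linarith)
  have hd3 := kernelOp_hyperplaneDominated hs hℓ hG0 hQ hW hd2 (half_pos hσ0) (by linarith)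
  have hq : σ ^ (γ / ℓ) = ((2⁻¹ : ℝ) ^ (γ / ℓ)) ^ n := by
    rw [hσ, ← Real.rpow_natCast, ← Real.rpow_natCast, ← Real.rpow_mul (by norm_num),
      ← Real.rpow_mul (by norm_num), mul_comm]
  have htσ : 0 < t - σ := by linarith
  obtain ⟨_, _, i1⟩ := kernelOp_dominated hs hℓ hG0 hQ hW hd1 htσ (by linarith)
  obtain ⟨_, _, i2⟩ := kernelOp_dominated hs hℓ hG0 hQ hW hd3 htσ (by linarith)
  -- Factor Q_{t-σ/2} = Q_{t-σ} Q_{σ/2} in the finer approximation.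
  have heq : reconstructionSeq Q F t x n - reconstructionSeq Q F t x (n + 1) =
      ∫ y, Q (t - σ) x y * (F σ y - kernelOp Q (σ / 2) (F (σ / 2)) y) := by
    have e1 : reconstructionSeq Q F t x (n + 1) =
        kernelOp Q (t - σ) (kernelOp Q (σ / 2) (F (σ / 2))) x := by
      rw [kernelOp_kernelOp hs hℓ hG0 hQ hW hd2 htσ (by linarith) (half_pos hσ0) (by linarith),
        reconstructionSeq, hσ']
      congr 1
      ring
    rw [e1]
    simp only [mul_sub]
    rw [integral_sub (i1 x).1 (i2 x).1]
    rfl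
  have hκ : ∀ i, 0 ≤ p i t * σ ^ (γ / ℓ) := fun i =>
    mul_nonneg (hF.nonneg i t) (Real.rpow_nonneg hσ0.le _)
  have hWx : 0 ≤ (W x)⁻¹ := inv_nonneg.2 (hW.pos x).le
  obtain ⟨-, h2, h3⟩ := h (t - σ) htσ (by linarith) x
    (fun y => F σ y - kernelOp Q (σ / 2) (F (σ / 2)) y) (hd1.1.sub hd3.1)
    (fun i => p i t * σ ^ (γ / ℓ)) hκ (fun y hy => by
      have := hF.step σ hσ0 hσ1 (σ / 2) (by linarith) le_rfl y hy
      rw [sub_half] at this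
      refine this.trans (mul_le_mul_of_nonneg_left ?_ (inv_nonneg.2 (hW.pos y).le))
      refine Finset.sum_le_sum fun i _ => mul_le_mul_of_nonneg_right ?_
        (Real.rpow_nonneg (temporalWeight_nonneg y) _)
      -- Monotonicity replaces the coefficient at the small time σ by the one at t.
      exact mul_le_mul_of_nonneg_right (hF.mono i (by linarith)) (Real.rpow_nonneg hσ0.le _))
  -- X collects the factors produced by the integration at time t - σ, Y the factors wanted at time
  -- t. The two times are comparable because σ ≤ t/2; for the powers of φ(x) nothing changes.
  have hfin : ∀ X Y : ι → ℝ, (∀ i, 0 ≤ Y i) → (∀ i, X i ≤ max M 1 * Y i) →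
      ∫ y, |Q (t - σ) x y * (F σ y - kernelOp Q (σ / 2) (F (σ / 2)) y)| ≤
        C * ((W x)⁻¹ * ∑ i, p i t * σ ^ (γ / ℓ) * X i) →
      |reconstructionSeq Q F t x (n + 1) - reconstructionSeq Q F t x n| ≤
        (C * max M 1 * ((W x)⁻¹ * ∑ i, p i t * Y i)) * ((2⁻¹ : ℝ) ^ (γ / ℓ)) ^ n := by
    intro X Y hY hXY hb
    rw [abs_sub_comm, heq, ← hq]
    refine (abs_integral_le_integral_abs.trans hb).trans ?_
    calc C * ((W x)⁻¹ * ∑ i, p i t * σ ^ (γ / ℓ) * X i)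
        ≤ C * ((W x)⁻¹ * ∑ i, p i t * σ ^ (γ / ℓ) * (max M 1 * Y i)) := by
          refine mul_le_mul_of_nonneg_left (mul_le_mul_of_nonneg_left
            (Finset.sum_le_sum fun i _ => mul_le_mul_of_nonneg_left (hXY i) (hκ i)) hWx) hC.le
      _ = _ := by
          simp only [Finset.mul_sum, Finset.sum_mul]
          exact Finset.sum_congr rfl fun i _ => by ring
  refine ⟨hfin _ _ (fun i => Real.rpow_nonneg ht.le _) (fun i => ?_) h2,
    fun hx => hfin _ _ (fun i => Real.rpow_nonneg (temporalWeight_nonneg x) _) (fun i => ?_) (h3 hx)⟩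
  · refine (rpow_le_four_rpow_abs ht (by linarith) (by linarith) _).trans
      (mul_le_mul_of_nonneg_right ((hM i).trans (le_max_left _ _)) (Real.rpow_nonneg ht.le _))
  · exact le_mul_of_one_le_left (Real.rpow_nonneg (temporalWeight_nonneg x) _) (le_max_right _ _)

variable (hγ : 0 < γ)
include hγ

/-- The increments sum geometrically with ratio 2^{-γ/ℓ} < 1, which is where γ > 0 enters. The tail
from n on costs (2^{-n})^{γ/ℓ} ≤ t^{γ/ℓ}, and t^{γ/ℓ} t^{-(γ-θ_i)/ℓ} = t^{θ_i/ℓ}. -/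
theorem GermBound.exists_tendsto_le :
    ∃ C : ℝ, 0 < C ∧ ∀ (F : ℝ → (Fin d → ℝ) → ℝ) (p : ι → ℝ → ℝ),
      GermBound s ℓ Q W γ α θ F p → ∀ t, 0 < t → t ≤ 2 → ∀ x,
      Tendsto (reconstructionSeq Q F t x) atTop (𝓝 (reconstruction Q F t x)) ∧
      ∀ n : ℕ, (2⁻¹ : ℝ) ^ n ≤ t / 2 →
      |reconstruction Q F t x - reconstructionSeq Q F t x n| ≤
        C * ((W x)⁻¹ * ∑ i, p i t * t ^ (θ i / ℓ)) ∧
      (x 0 ≠ 0 → |reconstruction Q F t x - reconstructionSeq Q F t x n| ≤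
        C * ((W x)⁻¹ * ∑ i, p i t * t ^ (γ / ℓ) * temporalWeight s x ^ (-(γ - θ i)))) := by
  obtain ⟨C, hC, h⟩ := GermBound.exists_step_le hs hℓ hG0 hQ hW hαγ hθα hθs
  set q : ℝ := (2⁻¹ : ℝ) ^ (γ / ℓ) with hqdef
  have hq0 : 0 < q := Real.rpow_pos_of_pos (by norm_num) _
  have hq1 : q < 1 := Real.rpow_lt_one (by norm_num) (by norm_num) (by positivity)
  have h1q : 0 < 1 - q := by linarith
  refine ⟨C / (1 - q), by positivity, fun F p hF t ht ht2 x => ?_⟩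
  have hdec : ∀ {m n : ℕ}, m ≤ n → (2⁻¹ : ℝ) ^ m ≤ t / 2 → (2⁻¹ : ℝ) ^ n ≤ t / 2 :=
    fun hmn hm => (pow_le_pow_of_le_one (by norm_num) (by norm_num) hmn).trans hm
  obtain ⟨m, -, hm⟩ := exists_inv_two_pow_mem ht ht2
  obtain ⟨l, hl, -⟩ := exists_tendsto_of_geometric hq1
    (fun n hn => (h F p hF t ht ht2 x n (hdec hn hm)).1)
  have hlim : Tendsto (reconstructionSeq Q F t x) atTop (𝓝 (reconstruction Q F t x)) :=
    tendsto_nhds_limUnder ⟨l, hl⟩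
  refine ⟨hlim, fun n hn => ?_⟩
  have hqn : q ^ n ≤ t ^ (γ / ℓ) := by
    have : q ^ n = ((2⁻¹ : ℝ) ^ n) ^ (γ / ℓ) := by
      rw [hqdef, ← Real.rpow_natCast, ← Real.rpow_natCast, ← Real.rpow_mul (by norm_num),
        ← Real.rpow_mul (by norm_num), mul_comm]
    rw [this]
    exact Real.rpow_le_rpow (by positivity) (by linarith) (by positivity)
  have hWx : 0 ≤ (W x)⁻¹ := inv_nonneg.2 (hW.pos x).le
  have hfin : ∀ Y : ι → ℝ, (∀ i, 0 ≤ Y i) →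
      (∀ k, n ≤ k → |reconstructionSeq Q F t x (k + 1) - reconstructionSeq Q F t x k| ≤
        (C * ((W x)⁻¹ * ∑ i, p i t * Y i)) * q ^ k) →
      |reconstruction Q F t x - reconstructionSeq Q F t x n| ≤
        C / (1 - q) * ((W x)⁻¹ * ∑ i, p i t * (t ^ (γ / ℓ) * Y i)) := by
    intro Y hY hb
    obtain ⟨l', hl', hle⟩ := exists_tendsto_of_geometric hq1 hb
    obtain rfl := tendsto_nhds_unique hl' hlim
    refine (hle n le_rfl).trans ?_
    have h0 : 0 ≤ C * ((W x)⁻¹ * ∑ i, p i t * Y i) := mul_nonneg hC.le (mul_nonneg hWx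
      (Finset.sum_nonneg fun i _ => mul_nonneg (hF.nonneg i t) (hY i)))
    refine (div_le_div_of_nonneg_right (mul_le_mul_of_nonneg_left hqn h0) h1q.le).trans
      (le_of_eq ?_)
    rw [div_mul_eq_mul_div]
    congr 1
    simp only [Finset.mul_sum, Finset.sum_mul]
    exact Finset.sum_congr rfl fun i _ => by ring
  refine ⟨?_, fun hx => ?_⟩
  · refine (hfin _ (fun i => Real.rpow_nonneg ht.le _)
      fun k hk => (h F p hF t ht ht2 x k (hdec hk hn)).1).trans (le_of_eq ?_)
    congr 2
    refine Finset.sum_congr rfl fun i _ => ?_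
    rw [← Real.rpow_add ht]
    congr 2
    ring
  · refine (hfin _ (fun i => Real.rpow_nonneg (temporalWeight_nonneg x) _)
      fun k hk => (h F p hF t ht ht2 x k (hdec hk hn)).2 hx).trans (le_of_eq ?_)
    simp only [mul_assoc]

omit hγ in
/-- Bound of the dyadic approximations before the limit. -/
theorem GermBound.exists_seq_le :
    ∃ C : ℝ, 0 < C ∧ ∀ (F : ℝ → (Fin d → ℝ) → ℝ) (p : ι → ℝ → ℝ),
      GermBound s ℓ Q W γ α θ F p → ∀ t, 0 < t → t ≤ 2 → ∀ x, ∀ n : ℕ, (2⁻¹ : ℝ) ^ n ≤ t / 2 →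
      |reconstructionSeq Q F t x n| ≤
        C * ((W x)⁻¹ * ∑ i, p i t * (2⁻¹ ^ n) ^ (α i / ℓ) * t ^ (-(α i - θ i) / ℓ)) := by
  obtain ⟨C, hC, h⟩ := IsGTypeSemigroup.integral_weighted_le hs hℓ hG0 hQ hW
    (fun i => α i - θ i) (fun i => sub_nonneg.2 (hθα i)) (fun i => by linarith [hαγ i, hθs i])
  obtain ⟨M, hM⟩ := Finite.exists_le fun i => (4 : ℝ) ^ |-(α i - θ i) / ℓ|
  refine ⟨C * max M 1, by positivity, fun F p hF t ht ht2 x n hn => ?_⟩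
  set σ : ℝ := 2⁻¹ ^ n with hσ
  have hσ0 : 0 < σ := inv_two_pow_pos n
  have hσ1 : σ ≤ 1 := inv_two_pow_le_one n
  have hκ : ∀ i, 0 ≤ p i t * σ ^ (α i / ℓ) := fun i =>
    mul_nonneg (hF.nonneg i t) (Real.rpow_nonneg hσ0.le _)
  have hWx : 0 ≤ (W x)⁻¹ := inv_nonneg.2 (hW.pos x).le
  obtain ⟨-, h2, -⟩ := h (t - σ) (by linarith) (by linarith) x (F σ)
    (hF.measurable σ hσ0 hσ1) (fun i => p i t * σ ^ (α i / ℓ)) hκ (fun y hy => by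
      refine (hF.size σ hσ0 hσ1 y hy).trans
        (mul_le_mul_of_nonneg_left ?_ (inv_nonneg.2 (hW.pos y).le))
      refine Finset.sum_le_sum fun i _ => mul_le_mul_of_nonneg_right ?_
        (Real.rpow_nonneg (temporalWeight_nonneg y) _)
      exact mul_le_mul_of_nonneg_right (hF.mono i (by linarith)) (Real.rpow_nonneg hσ0.le _))
  refine (abs_integral_le_integral_abs.trans h2).trans ?_
  calc _ ≤ C * ((W x)⁻¹ * ∑ i, p i t * σ ^ (α i / ℓ) *
        (max M 1 * t ^ (-(α i - θ i) / ℓ))) := by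
        refine mul_le_mul_of_nonneg_left (mul_le_mul_of_nonneg_left
          (Finset.sum_le_sum fun i _ => mul_le_mul_of_nonneg_left ?_ (hκ i)) hWx) hC.le
        exact (rpow_le_four_rpow_abs ht (by linarith) (by linarith) _).trans
          (mul_le_mul_of_nonneg_right ((hM i).trans (le_max_left _ _)) (Real.rpow_nonneg ht.le _))
    _ = _ := by
        simp only [Finset.mul_sum]
        exact Finset.sum_congr rfl fun i _ => by ring

/-- The size and the local error of the reconstruction. -/
theorem GermBound.exists_reconstruction_le :
    ∃ C : ℝ, 0 < C ∧ ∀ (F : ℝ → (Fin d → ℝ) → ℝ) (p : ι → ℝ → ℝ),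
      GermBound s ℓ Q W γ α θ F p → ∀ t, 0 < t →
      (t ≤ 2 → ∀ x, |reconstruction Q F t x| ≤ C * ((W x)⁻¹ * ∑ i, p i t * t ^ (θ i / ℓ))) ∧
      (t ≤ 1 → ∀ x, x 0 ≠ 0 → |reconstruction Q F t x - F t x| ≤
        C * ((W x)⁻¹ * ∑ i, p i t * t ^ (γ / ℓ) * temporalWeight s x ^ (-(γ - θ i)))) := by
  obtain ⟨C₁, hC₁, h₁⟩ := GermBound.exists_tendsto_le hs hℓ hG0 hQ hW hαγ hθα hθs hγ
  obtain ⟨C₂, hC₂, h₂⟩ := GermBound.exists_seq_le hs hℓ hG0 hQ hW hαγ hθα hθs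
  obtain ⟨M, hM⟩ := Finite.exists_le fun i => (4 : ℝ) ^ |α i / ℓ|
  refine ⟨C₁ + C₂ * max M 1 + 1, by positivity, fun F p hF t ht =>
    ⟨fun ht2 x => ?_, fun ht1 x hx => ?_⟩⟩
  -- Compare with the approximation at scale 2^{-m} comparable to t: its size is bounded directly
  -- and the remaining tail is already controlled.
  · obtain ⟨m, hm4, hm2⟩ := exists_inv_two_pow_mem ht ht2
    have hWx : 0 ≤ (W x)⁻¹ := inv_nonneg.2 (hW.pos x).le
    have a1 := ((h₁ F p hF t ht ht2 x).2 m hm2).1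
    have a2 := h₂ F p hF t ht ht2 x m hm2
    have hS : 0 ≤ (W x)⁻¹ * ∑ i, p i t * t ^ (θ i / ℓ) := mul_nonneg hWx
      (Finset.sum_nonneg fun i _ => mul_nonneg (hF.nonneg i t) (Real.rpow_nonneg ht.le _))
    have a3 : (W x)⁻¹ * ∑ i, p i t * (2⁻¹ ^ m) ^ (α i / ℓ) * t ^ (-(α i - θ i) / ℓ) ≤
        max M 1 * ((W x)⁻¹ * ∑ i, p i t * t ^ (θ i / ℓ)) := by
      rw [mul_left_comm]
      refine mul_le_mul_of_nonneg_left ?_ hWx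
      rw [Finset.mul_sum]
      refine Finset.sum_le_sum fun i _ => ?_
      have hte : t ^ (θ i / ℓ) = t ^ (α i / ℓ) * t ^ (-(α i - θ i) / ℓ) := by
        rw [← Real.rpow_add ht]; congr 1; ring
      rw [hte]
      have hp := rpow_le_four_rpow_abs ht hm4 (by linarith) (α i / ℓ)
      have hp2 := hp.trans (mul_le_mul_of_nonneg_right ((hM i).trans (le_max_left M 1))
        (Real.rpow_nonneg ht.le _))
      have h0 : 0 ≤ p i t * t ^ (-(α i - θ i) / ℓ) :=
        mul_nonneg (hF.nonneg i t) (Real.rpow_nonneg ht.le _)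
      have := mul_le_mul_of_nonneg_left hp2 h0
      linarith
    have a4 := abs_sub_abs_le_abs_sub (reconstruction Q F t x) (reconstructionSeq Q F t x m)
    have a5 := mul_le_mul_of_nonneg_left a3 hC₂.le
    linarith
  · obtain ⟨m, hm4, hm2⟩ := exists_inv_two_pow_mem ht (by linarith)
    have hWx : 0 ≤ (W x)⁻¹ := inv_nonneg.2 (hW.pos x).le
    have a1 := ((h₁ F p hF t ht (by linarith) x).2 m hm2).2 hx
    have a2 := hF.step t ht ht1 _ hm4 hm2 x hx
    have hS : 0 ≤ (W x)⁻¹ * ∑ i, p i t * t ^ (γ / ℓ) * temporalWeight s x ^ (-(γ - θ i)) :=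
      mul_nonneg hWx (Finset.sum_nonneg fun i _ => mul_nonneg
        (mul_nonneg (hF.nonneg i t) (Real.rpow_nonneg ht.le _))
        (Real.rpow_nonneg (temporalWeight_nonneg x) _))
    have a3 : |reconstruction Q F t x - F t x| ≤
        |reconstruction Q F t x - reconstructionSeq Q F t x m| +
        |F t x - reconstructionSeq Q F t x m| := by
      rw [abs_sub_comm (F t x)]
      exact abs_sub_le _ _ _
    -- The approximation of index m is by definition the average occurring in `GermBound.step` with
    -- r = 2^{-m}.
    have a4 : |F t x - reconstructionSeq Q F t x m| ≤ _ := a2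
    have : 0 ≤ C₂ * max M 1 := by positivity
    nlinarith [mul_nonneg this hS]

theorem GermBound.tendsto_reconstruction {F : ℝ → (Fin d → ℝ) → ℝ} {p : ι → ℝ → ℝ}
    (hF : GermBound s ℓ Q W γ α θ F p) {t : ℝ} (ht : 0 < t) (ht2 : t ≤ 2) (x : Fin d → ℝ) :
    Tendsto (reconstructionSeq Q F t x) atTop (𝓝 (reconstruction Q F t x)) := by
  obtain ⟨C, -, h⟩ := GermBound.exists_tendsto_le hs hℓ hG0 hQ hW hαγ hθα hθs hγ
  exact (h F p hF t ht ht2 x).1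

omit hγ hs hℓ hG0 hW hαγ hθα hθs in
theorem GermBound.seq_measurable {F : ℝ → (Fin d → ℝ) → ℝ} {p : ι → ℝ → ℝ}
    (hF : GermBound s ℓ Q W γ α θ F p) {t : ℝ} {n : ℕ} (hn : (2⁻¹ : ℝ) ^ n < t) :
    Measurable fun x => reconstructionSeq Q F t x n :=
  kernelOp_measurable hQ (hF.measurable _ (inv_two_pow_pos n) (inv_two_pow_le_one n))
    (sub_pos.2 hn)

theorem GermBound.reconstruction_measurable {F : ℝ → (Fin d → ℝ) → ℝ} {p : ι → ℝ → ℝ}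
    (hF : GermBound s ℓ Q W γ α θ F p) {t : ℝ} (ht : 0 < t) (ht2 : t ≤ 2) :
    Measurable (reconstruction Q F t) := by
  obtain ⟨m, -, hm⟩ := exists_inv_two_pow_mem ht ht2
  refine measurable_of_tendsto_metrizable (f := fun n x => reconstructionSeq Q F t x (n + m))
    (fun n => hF.seq_measurable hQ ?_) ?_
  · have : (2⁻¹ : ℝ) ^ (n + m) ≤ 2⁻¹ ^ m :=
      pow_le_pow_of_le_one (by norm_num) (by norm_num) (Nat.le_add_left _ _)
    linarith
  · rw [tendsto_pi_nhds]
    intro x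
    exact (tendsto_add_atTop_iff_nat m).2
      (hF.tendsto_reconstruction hs hℓ hG0 hQ hW hαγ hθα hθs hγ ht ht2 x)

/-- Applying Q_r to an approximation at time t gives the approximation at time r + t. The limit
passes through the integral because the approximations are bounded by a fixed multiple of W⁻¹. -/
theorem GermBound.kernelOp_reconstruction {F : ℝ → (Fin d → ℝ) → ℝ} {p : ι → ℝ → ℝ}
    (hF : GermBound s ℓ Q W γ α θ F p) {r t : ℝ} (hr : 0 < r) (ht : 0 < t) (hrt : r + t ≤ 2)
    (x : Fin d → ℝ) :
    kernelOp Q r (reconstruction Q F t) x = reconstruction Q F (r + t) x := by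
  obtain ⟨C, hC, h⟩ := GermBound.exists_tendsto_le hs hℓ hG0 hQ hW hαγ hθα hθs hγ
  obtain ⟨C', hC', h'⟩ := GermBound.exists_reconstruction_le hs hℓ hG0 hQ hW hαγ hθα hθs hγ
  have ht2 : t ≤ 2 := by linarith
  obtain ⟨m, -, hm⟩ := exists_inv_two_pow_mem ht ht2
  have hdec : ∀ n, m ≤ n → (2⁻¹ : ℝ) ^ n ≤ t / 2 := fun n hn =>
    (pow_le_pow_of_le_one (by norm_num) (by norm_num) hn).trans hm
  set K : ℝ := (C + C') * ∑ i, p i t * t ^ (θ i / ℓ) with hK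
  have hK0 : 0 ≤ K := mul_nonneg (by positivity)
    (Finset.sum_nonneg fun i _ => mul_nonneg (hF.nonneg i t) (Real.rpow_nonneg ht.le _))
  have hbound : ∀ n, m ≤ n → ∀ y, |reconstructionSeq Q F t y n| ≤ K * (W y)⁻¹ := by
    intro n hn y
    have a1 := ((h F p hF t ht ht2 y).2 n (hdec n hn)).1
    have a2 := (h' F p hF t ht).1 ht2 y
    have a3 := abs_sub_abs_le_abs_sub (reconstructionSeq Q F t y n) (reconstruction Q F t y)
    rw [abs_sub_comm] at a3
    rw [hK]
    linarith
  have hWd : HyperplaneDominated s W fun y => K * (W y)⁻¹ :=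
    HyperplaneDominated.of_le hs ((hW.continuous.measurable.inv).const_mul _) hK0 fun y => by
      rw [abs_of_nonneg (mul_nonneg hK0 (inv_nonneg.2 (hW.pos y).le))]
  obtain ⟨_, _, hi⟩ := kernelOp_dominated hs hℓ hG0 hQ hW hWd hr (by linarith)
  have hlim : Tendsto (fun n => kernelOp Q r (fun y => reconstructionSeq Q F t y n) x) atTop
      (𝓝 (kernelOp Q r (reconstruction Q F t) x)) := by
    refine tendsto_integral_filter_of_dominated_convergence
      (fun y => |Q r x y * (K * (W y)⁻¹)|) ?_ ?_ (hi x).1.norm ?_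
    · filter_upwards [eventually_ge_atTop m] with n hn
      exact ((hQ.continuous_right hr x).measurable.mul
        (hF.seq_measurable hQ (by linarith [hdec n hn]))).aestronglyMeasurable
    · filter_upwards [eventually_ge_atTop m] with n hn
      refine Eventually.of_forall fun y => ?_
      rw [norm_mul, abs_mul, Real.norm_eq_abs, Real.norm_eq_abs]
      exact mul_le_mul_of_nonneg_left ((hbound n hn y).trans (le_abs_self _)) (abs_nonneg _)
    · exact Eventually.of_forall fun y => (hF.tendsto_reconstruction hs hℓ hG0 hQ hW hαγ hθα hθs
        hγ ht ht2 y).const_mul _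
  refine tendsto_nhds_unique hlim ((hF.tendsto_reconstruction hs hℓ hG0 hQ hW hαγ hθα hθs hγ
    (add_pos hr ht) hrt x).congr' ?_)
  filter_upwards [eventually_ge_atTop m] with n hn
  have hn' := hdec n hn
  have := kernelOp_kernelOp hs hℓ hG0 hQ hW
    (hF.dominated hs hW hαγ hθs (inv_two_pow_pos n) (inv_two_pow_le_one n)) hr (by linarith)
    (t := t - 2⁻¹ ^ n) (by linarith) (by linarith [inv_two_pow_pos n]) x
  unfold reconstructionSeq
  rw [add_sub_assoc]
  exact this.symm

end Core

end

/-! ### Coherent germs and the bounds on their diagonals. -/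

noncomputable section

/-- A coherent germ `A y t z = Q_t(z, Λ_y)`, `y` off the hyperplane. The semigroup property is
needed at the base point only. -/
structure CoherentGerm {d : ℕ} [NeZero d] (s : Fin d → ℝ) (ℓ : ℝ)
    (Q : ℝ → (Fin d → ℝ) → (Fin d → ℝ) → ℝ) (W Ws : (Fin d → ℝ) → ℝ) (γ : ℝ) {ι : Type*}
    [Fintype ι] (α θ : ι → ℝ) (A : (Fin d → ℝ) → ℝ → (Fin d → ℝ) → ℝ) (p : ι → ℝ → ℝ) :
    Prop where
  nonneg : ∀ i t, 0 ≤ p i t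
  mono : ∀ i, Monotone (p i)
  zero : ∀ y t, y 0 = 0 → A y t y = 0
  continuous : ∀ y, y 0 ≠ 0 → ∀ t, 0 < t → t ≤ 1 → Continuous (A y t)
  semigroup : ∀ y, y 0 ≠ 0 → ∀ r t, 0 < r → r < t → t ≤ 1 →
    kernelOp Q (t - r) (A y r) y = A y t y
  size : ∀ t, 0 < t → t ≤ 1 → ∀ y, y 0 ≠ 0 → |A y t y| ≤
    (W y)⁻¹ * ∑ i, p i t * t ^ (α i / ℓ) * temporalWeight s y ^ (-(α i - θ i))
  coherence : ∀ t, 0 < t → t ≤ 1 → ∀ y z, y 0 ≠ 0 → z 0 ≠ 0 → |A y t z - A z t z| ≤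
    (W y)⁻¹ * Ws (y - z) * ∑ i, p i t * t ^ (α i / ℓ) * (scaledSize s (y - z) ^ (γ - α i) *
      min (temporalWeight s y) (temporalWeight s z) ^ (-(γ - θ i)))

section Germ

variable {d : ℕ} [NeZero d] {s : Fin d → ℝ} {ℓ : ℝ} {G : (Fin d → ℝ) → ℝ}
  {Q : ℝ → (Fin d → ℝ) → (Fin d → ℝ) → ℝ} {W Ws : (Fin d → ℝ) → ℝ}
  {γ : ℝ} {ι : Type*} [Fintype ι] {α θ : ι → ℝ}

/-- The diagonal is continuous off the hyperplane: the germ is continuous in its argument for a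
fixed base point, and changing the base point costs the coherence bound, which vanishes at z = y
because γ - α_i > 0. On the hyperplane the germ is zero. -/
theorem CoherentGerm.measurable (hs : ∀ i, 1 ≤ s i) (hW : IsGControlled s ℓ G W Ws)
    (hαγ : ∀ i, α i < γ) {A : (Fin d → ℝ) → ℝ → (Fin d → ℝ) → ℝ} {p : ι → ℝ → ℝ}
    (hA : CoherentGerm s ℓ Q W Ws γ α θ A p) {t : ℝ} (ht : 0 < t) (ht1 : t ≤ 1) :
    Measurable fun y => A y t y := by
  classical
  have hopen : IsOpen {y : Fin d → ℝ | y 0 ≠ 0} := isOpen_ne_fun (continuous_apply 0)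
    continuous_const
  have hcont : ContinuousOn (fun y => A y t y) {y : Fin d → ℝ | y 0 ≠ 0} := by
    intro y hy
    refine ContinuousAt.continuousWithinAt ?_
    have h1 : Tendsto (fun z => A y t z) (𝓝 y) (𝓝 (A y t y)) := (hA.continuous y hy t ht ht1).tendsto y
    have h2 : Tendsto (fun z => A y t z - A z t z) (𝓝 y) (𝓝 0) := by
      let B : (Fin d → ℝ) → ℝ := fun z => (W y)⁻¹ * Ws (y - z) * ∑ i, p i t * t ^ (α i / ℓ) *
        (scaledSize s (y - z) ^ (γ - α i) *
          min (temporalWeight s y) (temporalWeight s z) ^ (-(γ - θ i)))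
      have hB : Tendsto B (𝓝 y) (𝓝 (B y)) := by
        have hsub : Continuous fun z : Fin d → ℝ => y - z := continuous_const.sub continuous_id
        refine ContinuousAt.tendsto (ContinuousAt.mul
          (continuous_const.mul (hW.star_continuous.comp hsub)).continuousAt ?_)
        refine tendsto_finsetSum _ fun i _ => Tendsto.const_mul _ (Tendsto.mul ?_ ?_)
        · exact (((scaledSize_continuous hs).comp hsub).continuousAt).rpow_const
            (Or.inr (by linarith [hαγ i]))
        · refine ContinuousAt.rpow_const ((continuous_const.min
            (temporalWeight_continuous hs)).continuousAt) (Or.inl ?_)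
          rw [min_self]
          exact (temporalWeight_pos hy).ne'
      have hB0 : B y = 0 := by
        have : ∀ i, scaledSize s (y - y) ^ (γ - α i) = 0 := fun i => by
          rw [sub_self, scaledSize_zero hs, Real.zero_rpow (by linarith [hαγ i])]
        simp only [B, this, zero_mul, mul_zero, Finset.sum_const_zero]
      rw [hB0] at hB
      refine squeeze_zero_norm' ?_ hB
      filter_upwards [hopen.mem_nhds hy] with z hz
      exact hA.coherence t ht ht1 y z hy hz
    have h3 := h1.sub h2
    simpa [ContinuousAt] using h3
  have hpw : (fun y => A y t y) =
      Set.piecewise {y : Fin d → ℝ | y 0 ≠ 0} (fun y => A y t y) (fun _ => 0) := by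
    funext y
    by_cases hy : y 0 = 0
    · rw [Set.piecewise_eq_of_notMem _ _ _ (by simpa using hy), hA.zero y t hy]
    · rw [Set.piecewise_eq_of_mem _ _ _ hy]
  rw [hpw]
  exact hcont.measurable_piecewise continuousOn_const hopen.measurableSet

variable (hs : ∀ i, 1 ≤ s i) (hℓ : 0 < ℓ) (hG0 : ∀ x, 0 ≤ G x)
  (hQ : IsGTypeSemigroup s ℓ G Q) (hW : IsGControlled s ℓ G W Ws)
include hs hℓ hG0 hQ hW

theorem kernelOp_sub {f g : (Fin d → ℝ) → ℝ} (hf : HyperplaneDominated s W f)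
    (hg : HyperplaneDominated s W g) {t : ℝ} (ht : 0 < t) (ht2 : t ≤ 2) (x : Fin d → ℝ) :
    kernelOp Q t (fun y => f y - g y) x = kernelOp Q t f x - kernelOp Q t g x := by
  obtain ⟨_, _, h1⟩ := kernelOp_dominated hs hℓ hG0 hQ hW hf ht ht2
  obtain ⟨_, _, h2⟩ := kernelOp_dominated hs hℓ hG0 hQ hW hg ht ht2
  unfold kernelOp
  rw [← integral_sub (h1 x).1 (h2 x).1]
  simp only [mul_sub]

/-- By the semigroup property at the base point y the defect is ∫ Q_{t-r}(y,z)(A_y - A_z)(r,z) dz.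
Coherence and integration of ‖y-z‖^{γ-α_i} give r^{α_i/ℓ} (t-r)^{(γ-α_i)/ℓ}, which is of order
t^{γ/ℓ} because r and t - r are comparable to t. -/
theorem CoherentGerm.exists_germBound (hαγ : ∀ i, α i < γ) (hθα : ∀ i, θ i ≤ α i)
    (hθs : ∀ i, γ - s 0 < θ i) :
    ∃ C : ℝ, 0 < C ∧ ∀ (A : (Fin d → ℝ) → ℝ → (Fin d → ℝ) → ℝ) (p : ι → ℝ → ℝ),
      CoherentGerm s ℓ Q W Ws γ α θ A p →
      GermBound s ℓ Q W γ α θ (fun t y => A y t y) (fun i t => C * p i t) := by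
  have hs0 : 0 < s 0 := lt_of_lt_of_le one_pos (hs 0)
  obtain ⟨C, hC, h⟩ := IsGTypeSemigroup.integral_le hs hℓ hG0 hQ hW
    -- The power of φ(y) ∧ φ(z) is at most the sum of the powers of φ(z) and of φ(y). With `true`
    -- the singularity is in the integration variable z, with `false` it sits in the coefficient as
    -- a power of φ(y). Both lead to the same bound, whence the factor 2 below.
    (fun j : ι × Bool => γ - α j.1) (fun j => if j.2 then γ - θ j.1 else 0)
    (fun j => by linarith [hαγ j.1])
    (fun j => by split_ifs <;> linarith [hαγ j.1, hθα j.1])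
    (fun j => by split_ifs <;> linarith [hθs j.1])
  obtain ⟨M, hM⟩ := Finite.exists_le fun i : ι =>
    (4 : ℝ) ^ |α i / ℓ| * 4 ^ |(γ - α i) / ℓ|
  refine ⟨max (2 * C * M) 1, by positivity, fun A p hA => ?_⟩
  have hmeas := fun {t : ℝ} (ht : 0 < t) (ht1 : t ≤ 1) => hA.measurable hs hW hαγ ht ht1
  have hC1 : 1 ≤ max (2 * C * M) 1 := le_max_right _ _
  refine ⟨fun t ht ht1 => hmeas ht ht1, fun i t => mul_nonneg (by positivity) (hA.nonneg i t),
    fun i => (hA.mono i).const_mul (by positivity), fun t ht ht1 y hy => ?_,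
    fun t ht ht1 r hr4 hr2 y hy => ?_⟩
  · refine (hA.size t ht ht1 y hy).trans (mul_le_mul_of_nonneg_left ?_
      (inv_nonneg.2 (hW.pos y).le))
    refine Finset.sum_le_sum fun i _ => mul_le_mul_of_nonneg_right
      (mul_le_mul_of_nonneg_right ?_ (Real.rpow_nonneg ht.le _))
      (Real.rpow_nonneg (temporalWeight_nonneg y) _)
    exact le_mul_of_one_le_left (hA.nonneg i t) hC1
  · have hr : 0 < r := lt_of_lt_of_le (by positivity) hr4
    have hr1 : r ≤ 1 := by linarith
    have htr : 0 < t - r := by linarith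
    have hWy : 0 ≤ (W y)⁻¹ := inv_nonneg.2 (hW.pos y).le
    have hφ : ∀ z : Fin d → ℝ, ∀ e : ℝ, 0 ≤ temporalWeight s z ^ e := fun z e =>
      Real.rpow_nonneg (temporalWeight_nonneg z) e
    obtain ⟨hi, -, h3⟩ := h (t - r) htr (by linarith) y (fun z => A y r z - A z r z)
      ((hA.continuous y hy r hr hr1).measurable.sub (hmeas hr hr1))
      (fun j => (W y)⁻¹ * (p j.1 r * r ^ (α j.1 / ℓ)) *
        (if j.2 then 1 else temporalWeight s y ^ (-(γ - θ j.1))))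
      (fun j => mul_nonneg (mul_nonneg hWy (mul_nonneg (hA.nonneg _ _)
        (Real.rpow_nonneg hr.le _))) (by split_ifs; exacts [zero_le_one, hφ _ _]))
      (fun z hz => by
        refine (hA.coherence r hr hr1 y z hy hz).trans ?_
        rw [mul_comm (W y)⁻¹, mul_assoc]
        refine mul_le_mul_of_nonneg_left ?_ (zero_le_one.trans (hW.one_le_star _))
        rw [Fintype.sum_prod_type, Finset.mul_sum]
        refine Finset.sum_le_sum fun i _ => ?_
        simp only [Fintype.sum_bool, if_true, Bool.false_eq_true, if_false, neg_zero,
          Real.rpow_zero, mul_one]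
        have hmin : min (temporalWeight s y) (temporalWeight s z) ^ (-(γ - θ i)) ≤
            temporalWeight s z ^ (-(γ - θ i)) + temporalWeight s y ^ (-(γ - θ i)) := by
          rcases min_choice (temporalWeight s y) (temporalWeight s z) with h | h <;> rw [h]
          · linarith [hφ z (-(γ - θ i))]
          · linarith [hφ y (-(γ - θ i))]
        have h0 : 0 ≤ (W y)⁻¹ * (p i r * r ^ (α i / ℓ)) * scaledSize s (y - z) ^ (γ - α i) :=
          mul_nonneg (mul_nonneg hWy (mul_nonneg (hA.nonneg _ _) (Real.rpow_nonneg hr.le _)))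
            (Real.rpow_nonneg (scaledSize_nonneg _) _)
        have := mul_le_mul_of_nonneg_left hmin h0
        linarith)
    have hF : HyperplaneDominated s W fun z => A z r z :=
      HyperplaneDominated.of_sum_le hs hW.pos (hmeas hr hr1)
        (fun i => mul_nonneg (hA.nonneg i r) (Real.rpow_nonneg hr.le _))
        (fun i => by linarith [hαγ i, hθs i]) (hA.size r hr hr1)
    obtain ⟨_, _, hFi⟩ := kernelOp_dominated hs hℓ hG0 hQ hW hF htr (by linarith)
    have heq : A y t y - kernelOp Q (t - r) (fun z => A z r z) y =
        ∫ z, Q (t - r) y z * (A y r z - A z r z) := by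
      -- No size bound on A_y away from y is available; integrability follows from that of the
      -- difference and of the diagonal.
      have hi2 : Integrable fun z => Q (t - r) y z * A y r z := by
        refine (hi.add (hFi y).1).congr (Eventually.of_forall fun z => ?_)
        simp only [Pi.add_apply]
        ring
      rw [← hA.semigroup y hy r t hr (by linarith) ht1]
      unfold kernelOp
      rw [← integral_sub hi2 (hFi y).1]
      simp only [mul_sub]
    rw [heq]
    refine (abs_integral_le_integral_abs.trans (h3 hy)).trans ?_
    rw [Fintype.sum_prod_type, Finset.mul_sum, Finset.mul_sum]
    refine Finset.sum_le_sum fun i _ => ?_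
    simp only [Fintype.sum_bool, if_true, Bool.false_eq_true, if_false, neg_zero,
          Real.rpow_zero, mul_one]
    have e1 := rpow_le_four_rpow_abs ht hr4 (by linarith) (α i / ℓ)
    have e2 := rpow_le_four_rpow_abs ht (r := t - r) (by linarith) (by linarith) ((γ - α i) / ℓ)
    have e3 : t ^ (γ / ℓ) = t ^ (α i / ℓ) * t ^ ((γ - α i) / ℓ) := by
      rw [← Real.rpow_add ht]; congr 1; ring
    have e4 : r ^ (α i / ℓ) * (t - r) ^ ((γ - α i) / ℓ) ≤ M * t ^ (γ / ℓ) := by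
      refine (mul_le_mul e1 e2 (Real.rpow_nonneg htr.le _)
        (mul_nonneg (by positivity) (Real.rpow_nonneg ht.le _))).trans ?_
      rw [mul_mul_mul_comm, ← e3]
      exact mul_le_mul_of_nonneg_right (hM i) (Real.rpow_nonneg ht.le _)
    have hpr : p i r ≤ p i t := hA.mono i (by linarith)
    have e5 : p i r * (r ^ (α i / ℓ) * (t - r) ^ ((γ - α i) / ℓ)) ≤ p i t * (M * t ^ (γ / ℓ)) :=
      mul_le_mul hpr e4 (mul_nonneg (Real.rpow_nonneg hr.le _) (Real.rpow_nonneg htr.le _))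
        (hA.nonneg i t)
    have e6 : 0 ≤ 2 * C * (W y)⁻¹ * temporalWeight s y ^ (-(γ - θ i)) :=
      mul_nonneg (mul_nonneg (by positivity) hWy) (hφ _ _)
    have e7 : 2 * C * M * (p i t * t ^ (γ / ℓ)) ≤
        max (2 * C * M) 1 * (p i t * t ^ (γ / ℓ)) :=
      mul_le_mul_of_nonneg_right (le_max_left _ _)
        (mul_nonneg (hA.nonneg _ _) (Real.rpow_nonneg ht.le _))
    have e8 := mul_le_mul_of_nonneg_left e5 e6
    have e9 := mul_le_mul_of_nonneg_left e7 (mul_nonneg hWy (hφ y (-(γ - θ i))))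
    linarith

/-! ## Uniqueness and membership in the Besov spaces -/

/-- Write D_t = Q_{t-r} D_r and let r → 0: after the singularity is integrated out, the right-hand
side is O(r^{γ/ℓ}) with a constant depending on t and x only. -/
theorem eq_zero_of_semigroup_of_le (hγ : 0 < γ) {a κ : ℝ} (ha : 0 ≤ a) (has : a < s 0)
    (hκ : 0 ≤ κ) {D : ℝ → (Fin d → ℝ) → ℝ} (hmeas : ∀ t, 0 < t → t ≤ 1 → Measurable (D t))
    (hsg : ∀ r t, 0 < r → r < t → t ≤ 1 → ∀ x, kernelOp Q (t - r) (D r) x = D t x)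
    (hb : ∀ t, 0 < t → t ≤ 1 → ∀ x, x 0 ≠ 0 →
      |D t x| ≤ (W x)⁻¹ * (κ * t ^ (γ / ℓ) * temporalWeight s x ^ (-a)))
    {t : ℝ} (ht : 0 < t) (ht1 : t ≤ 1) (x : Fin d → ℝ) : D t x = 0 := by
  obtain ⟨C, hC, h⟩ := IsGTypeSemigroup.integral_weighted_le hs hℓ hG0 hQ hW
    (fun _ : Unit => a) (fun _ => ha) (fun _ => has)
  have hWx : 0 ≤ (W x)⁻¹ := inv_nonneg.2 (hW.pos x).le
  have hle : ∀ r, 0 < r → r ≤ t / 2 →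
      |D t x| ≤ C * (W x)⁻¹ * κ * (4 ^ |-a / ℓ| * t ^ (-a / ℓ)) * r ^ (γ / ℓ) := by
    intro r hr hrt
    rw [← hsg r t hr (by linarith) ht1]
    obtain ⟨-, h2, -⟩ := h (t - r) (by linarith) (by linarith) x (D r) (hmeas r hr (by linarith))
      (fun _ => κ * r ^ (γ / ℓ)) (fun _ => mul_nonneg hκ (Real.rpow_nonneg hr.le _))
      (fun y hy => by simpa using hb r hr (by linarith) y hy)
    refine (abs_integral_le_integral_abs.trans h2).trans ?_
    simp only [Finset.univ_unique, Finset.sum_const, Finset.card_singleton, one_smul]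
    have e := rpow_le_four_rpow_abs ht (r := t - r) (by linarith) (by linarith) (-a / ℓ)
    have h0 : 0 ≤ C * (W x)⁻¹ * κ * r ^ (γ / ℓ) :=
      mul_nonneg (mul_nonneg (mul_nonneg hC.le hWx) hκ) (Real.rpow_nonneg hr.le _)
    have := mul_le_mul_of_nonneg_left e h0
    linarith
  have hlim : Tendsto (fun n : ℕ => C * (W x)⁻¹ * κ * (4 ^ |-a / ℓ| * t ^ (-a / ℓ)) *
      ((2⁻¹ : ℝ) ^ n) ^ (γ / ℓ)) atTop (𝓝 0) := by
    have h1 : Tendsto (fun n : ℕ => (2⁻¹ : ℝ) ^ n) atTop (𝓝 0) :=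
      tendsto_pow_atTop_nhds_zero_of_lt_one (by norm_num) (by norm_num)
    have h2 := h1.rpow_const (p := γ / ℓ) (Or.inr (by positivity))
    rw [Real.zero_rpow (by positivity)] at h2
    simpa using h2.const_mul (C * (W x)⁻¹ * κ * (4 ^ |-a / ℓ| * t ^ (-a / ℓ)))
  obtain ⟨m, -, hm⟩ := exists_inv_two_pow_mem ht (by linarith)
  have h0 : |D t x| ≤ 0 := by
    refine ge_of_tendsto hlim ?_
    filter_upwards [eventually_ge_atTop m] with n hn
    exact hle _ (by positivity)
      ((pow_le_pow_of_le_one (by norm_num) (by norm_num) hn).trans hm)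
  exact abs_eq_zero.1 (le_antisymm h0 (abs_nonneg _))

omit [NeZero d] hs hℓ hG0 hQ in
theorem abs_le_of_besovNorm_le {β : ℝ} {Λ : Profile d} {K : ℝ} (hK : 0 ≤ K)
    (h : besovNorm ℓ β W Λ ≤ ENNReal.ofReal K) (t : Set.Ioc (0 : ℝ) 1) (x : Fin d → ℝ) :
    |Λ t x| ≤ K * (t : ℝ) ^ (β / ℓ) * (W x)⁻¹ := by
  have h1 := (le_besovNorm ℓ β W Λ t x).trans h
  have htp : 0 < (t : ℝ) ^ (-β / ℓ) := Real.rpow_pos_of_pos t.2.1 _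
  rw [← ENNReal.ofReal_mul htp.le, ENNReal.ofReal_le_ofReal_iff hK] at h1
  have hWx := hW.pos x
  rw [← div_eq_mul_inv, le_div_iff₀ hWx]
  have h2 : (t : ℝ) ^ (β / ℓ) * (t : ℝ) ^ (-β / ℓ) = 1 := by
    rw [← Real.rpow_add t.2.1]; simp [neg_div]
  have h3 : 0 ≤ (t : ℝ) ^ (β / ℓ) := Real.rpow_nonneg t.2.1.le _
  calc |Λ t x| * W x = (t : ℝ) ^ (β / ℓ) * ((t : ℝ) ^ (-β / ℓ) * (W x * |Λ t x|)) := by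
        rw [← mul_assoc, h2]; ring
    _ ≤ (t : ℝ) ^ (β / ℓ) * K := mul_le_mul_of_nonneg_left h1 h3
    _ = _ := mul_comm _ _

omit [NeZero d] hs hℓ hG0 hQ in
theorem abs_le_of_weightedSup_le {f : (Fin d → ℝ) → ℝ} {K : ℝ} (hK : 0 ≤ K)
    (h : weightedSup W f ≤ ENNReal.ofReal K) (x : Fin d → ℝ) : |f x| ≤ K * (W x)⁻¹ := by
  have h1 := (le_iSup (fun x => ENNReal.ofReal (W x * |f x|)) x).trans h
  rw [ENNReal.ofReal_le_ofReal_iff hK] at h1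
  rw [← div_eq_mul_inv, le_div_iff₀ (hW.pos x), mul_comm]
  exact h1

omit hℓ hG0 hQ in
theorem dominated_of_mem_weightedContinuous {f : (Fin d → ℝ) → ℝ}
    (hf : f ∈ weightedContinuous W) : HyperplaneDominated s W f :=
  HyperplaneDominated.of_le hs hf.1.measurable ENNReal.toReal_nonneg
    (abs_le_of_weightedSup_le hW ENNReal.toReal_nonneg
      (ENNReal.ofReal_toReal hf.2.ne).ge)

/-- At each fixed time, convergence in the Besov norm is uniform relative to W⁻¹, and Q_{t-r}
preserves such convergence; hence the identities valid for functions in C(W) pass to the limit. -/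
theorem semigroup_of_mem_besovCompletion {β : ℝ} {Λ : Profile d}
    (hΛ : Λ ∈ besovCompletion ℓ Q β W) :
    (∀ t, HyperplaneDominated s W (Λ t)) ∧
    ∀ r t : Set.Ioc (0 : ℝ) 1, (r : ℝ) < t → ∀ x,
      kernelOp Q ((t : ℝ) - r) (Λ r) x = Λ t x := by
  obtain ⟨f, hf, hlim⟩ := hΛ
  have hfd := fun n => dominated_of_mem_weightedContinuous hs hW (hf n)
  have hpd : ∀ n (t : Set.Ioc (0 : ℝ) 1), HyperplaneDominated s W (profile Q (f n) t) :=
    fun n t => kernelOp_hyperplaneDominated hs hℓ hG0 hQ hW (hfd n) t.2.1 (t.2.2.trans one_le_two)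
  have hev : ∀ ε : ℝ, 0 < ε → ∀ᶠ n in atTop, ∀ t x,
      |profile Q (f n) t x - Λ t x| ≤ ε * (t : ℝ) ^ (β / ℓ) * (W x)⁻¹ := by
    intro ε hε
    filter_upwards [(ENNReal.tendsto_nhds_zero.1 hlim) (ENNReal.ofReal ε)
      (ENNReal.ofReal_pos.2 hε)] with n hn t x
    exact abs_le_of_besovNorm_le hW hε.le hn t x
  have hpt : ∀ t x, Tendsto (fun n => profile Q (f n) t x) atTop (𝓝 (Λ t x)) := by
    intro t x
    rw [tendsto_iff_dist_tendsto_zero]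
    have hc : 0 < (t : ℝ) ^ (β / ℓ) * (W x)⁻¹ :=
      mul_pos (Real.rpow_pos_of_pos t.2.1 _) (inv_pos.2 (hW.pos x))
    rw [Metric.tendsto_atTop]
    intro ε hε
    obtain ⟨N, hN⟩ := eventually_atTop.1
      (hev (ε / 2 / ((t : ℝ) ^ (β / ℓ) * (W x)⁻¹)) (by positivity))
    refine ⟨N, fun n hn => ?_⟩
    have := hN n hn t x
    rw [mul_assoc, div_mul_cancel₀ _ hc.ne'] at this
    rw [Real.dist_eq, Real.dist_eq, sub_zero, abs_abs]
    linarith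
  have hmeas : ∀ t, Measurable (Λ t) := fun t =>
    measurable_of_tendsto_metrizable (fun n => (hpd n t).1) (tendsto_pi_nhds.2 (hpt t))
  have hdom : ∀ t, HyperplaneDominated s W (Λ t) := by
    intro t
    obtain ⟨n, hn⟩ := (hev 1 one_pos).exists
    obtain ⟨K, hK, h⟩ := kernelOp_dominated hs hℓ hG0 hQ hW (hfd n) t.2.1
      (t.2.2.trans one_le_two)
    refine HyperplaneDominated.of_le hs (hmeas t) (κ := 1 * (t : ℝ) ^ (β / ℓ) + K)
      (add_nonneg (mul_nonneg zero_le_one (Real.rpow_nonneg t.2.1.le _)) hK) fun x => ?_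
    have h1 := hn t x
    have h2 : |profile Q (f n) t x| ≤ K * (W x)⁻¹ :=
      abs_integral_le_integral_abs.trans (h x).2
    have h3 := abs_sub_abs_le_abs_sub (Λ t x) (profile Q (f n) t x)
    rw [abs_sub_comm] at h3
    linarith
  refine ⟨hdom, fun r t hrt x => ?_⟩
  have htr : 0 < (t : ℝ) - r := sub_pos.2 hrt
  have htr2 : (t : ℝ) - r ≤ 2 := by linarith [t.2.2, r.2.1]
  have hsg : ∀ n, kernelOp Q ((t : ℝ) - r) (profile Q (f n) r) x = profile Q (f n) t x := by
    intro n
    have := kernelOp_kernelOp hs hℓ hG0 hQ hW (hfd n) htr htr2 r.2.1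
      (r.2.2.trans one_le_two) x
    rw [sub_add_cancel] at this
    exact this
  obtain ⟨C, hC, h⟩ := IsGTypeSemigroup.integral_weighted_le hs hℓ hG0 hQ hW
    (fun _ : Unit => 0) (fun _ => le_rfl) (fun _ => lt_of_lt_of_le one_pos (hs 0))
  have hWx := inv_pos.2 (hW.pos x)
  have hrp : 0 < (r : ℝ) ^ (β / ℓ) := Real.rpow_pos_of_pos r.2.1 _
  refine tendsto_nhds_unique (f := fun n => profile Q (f n) t x) ?_ (hpt t x)
  rw [Metric.tendsto_atTop]
  intro ε hε
  have hc : 0 < C * (W x)⁻¹ * (r : ℝ) ^ (β / ℓ) := by positivity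
  obtain ⟨N, hN⟩ := eventually_atTop.1
    (hev (ε / 2 / (C * (W x)⁻¹ * (r : ℝ) ^ (β / ℓ))) (by positivity))
  refine ⟨N, fun n hn => ?_⟩
  have hnn := hN n hn r
  rw [Real.dist_eq, ← hsg n, ← kernelOp_sub hs hℓ hG0 hQ hW (hpd n r) (hdom r) htr htr2]
  obtain ⟨-, h2, -⟩ := h _ htr htr2 x (fun y => profile Q (f n) r y - Λ r y)
    ((hpd n r).1.sub (hmeas r))
    (fun _ => ε / 2 / (C * (W x)⁻¹ * (r : ℝ) ^ (β / ℓ)) * (r : ℝ) ^ (β / ℓ))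
    (fun _ => by positivity) (fun y _ => by simpa [mul_comm] using hnn y)
  refine lt_of_le_of_lt (abs_integral_le_integral_abs.trans h2) ?_
  simp only [Finset.univ_unique, Finset.sum_const, Finset.card_singleton, one_smul, neg_zero,
    zero_div, Real.rpow_zero, mul_one]
  have : C * ((W x)⁻¹ * (ε / 2 / (C * (W x)⁻¹ * (r : ℝ) ^ (β / ℓ)) * (r : ℝ) ^ (β / ℓ))) =
      ε / 2 := by
    have := (hW.pos x).ne'
    field_simp
  rw [this]
  linarith

/-- The approximants are the regularisations L_τ, whose value at time t is L_{t+τ}. At small t both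
L_{t+τ} and L_t are small by assumption; at larger t the time regularity of the semigroup makes
their difference O(τ). -/
theorem mem_besovCompletion_of_semigroup {β : ℝ} (hβ : β ≤ 0) {L : ℝ → (Fin d → ℝ) → ℝ}
    (hmeas : ∀ t, 0 < t → t ≤ 1 → Measurable (L t))
    (hsg : ∀ r t, 0 < r → 0 < t → r + t ≤ 2 → ∀ x, kernelOp Q r (L t) x = L (r + t) x)
    {K e : ℝ} (hK : 0 ≤ K) (hb : ∀ t, 0 < t → t ≤ 1 → ∀ x, |L t x| ≤ K * t ^ e * (W x)⁻¹)
    (hsmall : ∀ ε : ℝ, 0 < ε → ∃ δ : ℝ, 0 < δ ∧ ∀ t, 0 < t → t ≤ δ → t ≤ 1 → ∀ x,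
      t ^ (-β / ℓ) * |L t x| ≤ ε * (W x)⁻¹) :
    (fun (t : Set.Ioc (0 : ℝ) 1) x => L t x) ∈ besovCompletion ℓ Q β W := by
  obtain ⟨C, hC, hreg⟩ := abs_kernelOp_add_sub_le hs hℓ hG0 hQ hW
  have hdom : ∀ t, 0 < t → t ≤ 1 → HyperplaneDominated s W (L t) := fun t ht ht1 =>
    HyperplaneDominated.of_le hs (hmeas t ht ht1) (mul_nonneg hK (Real.rpow_nonneg ht.le _))
      (hb t ht ht1)
  have hτ : Tendsto (fun n : ℕ => 1 / ((n : ℝ) + 1)) atTop (𝓝 0) :=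
    tendsto_one_div_add_atTop_nhds_zero_nat
  have hτ0 : ∀ n : ℕ, 0 < 1 / ((n : ℝ) + 1) := fun n => by positivity
  have hτ1 : ∀ n : ℕ, 1 / ((n : ℝ) + 1) ≤ 1 := fun n => by
    rw [div_le_one (by positivity)]; linarith [Nat.cast_nonneg (α := ℝ) n]
  refine ⟨fun n => L (1 / ((n : ℝ) + 1)), fun n => ⟨?_, ?_⟩, ?_⟩
  · have h0 := hτ0 n
    have h1 := hτ1 n
    -- Splitting off half of the time exhibits L_τ as the image of a dominated function, hence as a
    -- continuous one.
    have : L (1 / ((n : ℝ) + 1)) =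
        kernelOp Q (1 / ((n : ℝ) + 1) / 2) (L (1 / ((n : ℝ) + 1) / 2)) := by
      funext x
      rw [hsg _ _ (half_pos h0) (half_pos h0) (by linarith) x, add_halves]
    simp only
    rw [this]
    exact kernelOp_continuous hs hℓ hG0 hQ hW (hdom _ (half_pos h0) (by linarith)) (half_pos h0)
      (by linarith)
  · refine lt_of_le_of_lt (iSup_le fun x => ENNReal.ofReal_le_ofReal ?_)
      (ENNReal.ofReal_lt_top (r := K * (1 / ((n : ℝ) + 1)) ^ e))
    have := hb _ (hτ0 n) (hτ1 n) x
    rwa [← div_eq_mul_inv, le_div_iff₀ (hW.pos x), mul_comm] at this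
  · rw [ENNReal.tendsto_nhds_zero]
    intro ε' hε'
    obtain ⟨ε, hε0, hε⟩ := ENNReal.lt_iff_exists_nnreal_btwn.1 hε'
    have hε0 : (0 : ℝ) < ε := by exact_mod_cast hε0
    obtain ⟨δ, hδ, hδs⟩ := hsmall (ε / 2) (by positivity)
    set δ' := min δ 1 with hδ'
    have hδ'0 : 0 < δ' := lt_min hδ one_pos
    have hδ'1 : δ' ≤ 1 := min_le_right _ _
    -- The bound δ'/4 ensures t + τ ≤ δ when t ≤ δ'/2, and τ ≤ t/2 when t ≥ δ'/2. The second bound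
    -- makes the regularity estimate at most ε; the 1 in its denominator avoids division by zero.
    have hev : ∀ᶠ n : ℕ in atTop, 1 / ((n : ℝ) + 1) < min (δ' / 4)
        (ε / (C * (4 / δ') * (K * (δ' / 4) ^ (-|e|)) + 1)) := by
      refine hτ.eventually_lt_const (lt_min (by positivity) ?_)
      have : 0 ≤ C * (4 / δ') * (K * (δ' / 4) ^ (-|e|)) := by positivity
      positivity
    filter_upwards [hev] with n hn
    set τ := 1 / ((n : ℝ) + 1) with hτdef
    have hτp : 0 < τ := hτ0 n
    have hτle : τ ≤ 1 := hτ1 n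
    have hn1 : τ < δ' / 4 := hn.trans_le (min_le_left _ _)
    have hn2 := (lt_div_iff₀ (by positivity)).1 (hn.trans_le (min_le_right _ _))
    refine le_trans (besovNorm_le fun t x => ?_) hε.le
    have ht := t.2.1
    have ht1 := t.2.2
    set t' : ℝ := (t : ℝ) with ht'
    have htp : 0 ≤ t' ^ (-β / ℓ) := Real.rpow_nonneg ht.le _
    have hWx := hW.pos x
    have hexp : 0 ≤ -β / ℓ := div_nonneg (by linarith) hℓ.le
    have hval : (profile Q (L τ) - fun (t : Set.Ioc (0 : ℝ) 1) x => L t x) t x =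
        L (t' + τ) x - L t' x := by
      have := hsg t' τ ht hτp (by linarith) x
      rw [← this]
      rfl
    rw [hval, ← ENNReal.ofReal_mul htp, ← ENNReal.ofReal_coe_nnreal]
    refine ENNReal.ofReal_le_ofReal ?_
    -- The two regimes are separated at t = δ'/2. In both, β ≤ 0 is used: t^{-β/ℓ} is increasing in
    -- t and at most 1.
    suffices hmain : t' ^ (-β / ℓ) * |L (t' + τ) x - L t' x| ≤ ε * (W x)⁻¹ by
      rw [← div_eq_mul_inv, le_div_iff₀ hWx] at hmain
      linarith
    rcases le_total t' (δ' / 2) with hsm | hlg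
    · have h1 := hδs t' ht (by linarith [min_le_left δ 1]) ht1 x
      have h2 := hδs (t' + τ) (by linarith) (by linarith [min_le_left δ 1]) (by linarith) x
      have h3 : t' ^ (-β / ℓ) ≤ (t' + τ) ^ (-β / ℓ) :=
        Real.rpow_le_rpow ht.le (by linarith) hexp
      have h4 := mul_le_mul_of_nonneg_right h3 (abs_nonneg (L (t' + τ) x))
      have h5 := mul_le_mul_of_nonneg_left (abs_sub (L (t' + τ) x) (L t' x)) htp
      linarith
    · have hr0 : 0 < t' / 2 := half_pos ht
      have h1 := hreg (t' / 2) τ hr0 hτp.le (by linarith) (by linarith) (L (t' / 2))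
        (hmeas _ hr0 (by linarith)) (K * (t' / 2) ^ e)
        (mul_nonneg hK (Real.rpow_nonneg hr0.le _)) (hb _ hr0 (by linarith)) x
      rw [hsg _ _ (by linarith) hr0 (by linarith), hsg _ _ hr0 hr0 (by linarith), add_halves,
        show t' / 2 + τ + t' / 2 = t' + τ by ring] at h1
      have h2 : t' ^ (-β / ℓ) ≤ 1 := Real.rpow_le_one ht.le ht1 hexp
      have h3 : (t' / 2) ^ e ≤ (δ' / 4) ^ (-|e|) :=
        (Real.rpow_le_rpow_of_exponent_ge hr0 (by linarith) (neg_abs_le e)).trans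
          (Real.rpow_le_rpow_of_nonpos (by positivity) (by linarith)
            (neg_nonpos.2 (abs_nonneg e)))
      have h4 : τ / (t' / 2) ≤ τ * (4 / δ') := by
        rw [div_eq_mul_inv]
        refine mul_le_mul_of_nonneg_left ?_ hτp.le
        rw [inv_eq_one_div, div_le_div_iff₀ hr0 hδ'0]
        linarith
      have hWi : 0 ≤ (W x)⁻¹ := inv_nonneg.2 hWx.le
      calc t' ^ (-β / ℓ) * |L (t' + τ) x - L t' x|
          ≤ 1 * |L (t' + τ) x - L t' x| := mul_le_mul_of_nonneg_right h2 (abs_nonneg _)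
        _ ≤ C * (τ / (t' / 2)) * (K * (t' / 2) ^ e) * (W x)⁻¹ := by rw [one_mul]; exact h1
        _ ≤ C * (τ * (4 / δ')) * (K * (δ' / 4) ^ (-|e|)) * (W x)⁻¹ := by
            refine mul_le_mul_of_nonneg_right (mul_le_mul (mul_le_mul_of_nonneg_left h4 hC.le)
              (mul_le_mul_of_nonneg_left h3 hK) (mul_nonneg hK (Real.rpow_nonneg hr0.le _))
              (by positivity)) hWi
        _ ≤ ε * (W x)⁻¹ := mul_le_mul_of_nonneg_right (by nlinarith) hWi

end Germ

end

noncomputable section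

/-! ## Models -/

/-- The homogeneities below `γ`. -/
abbrev RegularityStructure.Below (𝒯 : RegularityStructure) (γ : ℝ) : Type :=
  {α : 𝒯.A // (α : ℝ) < γ}

/-- The homogeneities are bounded below by the regularity, so local finiteness applies on one
bounded interval. -/
instance (𝒯 : RegularityStructure) (γ : ℝ) : Finite (𝒯.Below γ) := by
  have h := 𝒯.locallyFinite 𝒯.reg γ
  have := h.to_subtype
  refine Finite.of_injective
    (fun α : 𝒯.Below γ => (⟨α.1, α.1.2, 𝒯.isLeast_reg.2 α.1.2, α.2.le⟩ :
      ↥(𝒯.A ∩ Set.Icc 𝒯.reg γ))) ?_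
  intro a b hab
  have h1 : ((a.1 : 𝒯.A) : ℝ) = b.1 :=
    congrArg (fun z : ↥(𝒯.A ∩ Set.Icc 𝒯.reg γ) => (z : ℝ)) hab
  exact Subtype.ext (Subtype.ext h1)

instance (𝒯 : RegularityStructure) (γ : ℝ) : Fintype (𝒯.Below γ) := Fintype.ofFinite _

/-- Elements of the model space with components of homogeneity below `γ` only. -/
def RegularityStructure.IsBelow (𝒯 : RegularityStructure) (γ : ℝ) (σ : 𝒯.Space) : Prop :=
  ∀ α : 𝒯.A, γ ≤ α → σ α = 0

namespace RegularityStructure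

variable {𝒯 : RegularityStructure} {γ : ℝ}

theorem of_apply_self (α : 𝒯.A) (τ : 𝒯.T α) : (𝒯.of α τ) α = τ := DirectSum.of_eq_same _ _

theorem of_apply_ne {α β : 𝒯.A} (h : α ≠ β) (τ : 𝒯.T α) : (𝒯.of α τ) β = 0 :=
  DirectSum.of_eq_of_ne _ _ _ h.symm

theorem of_zero (α : 𝒯.A) : 𝒯.of α 0 = 0 := (DirectSum.of 𝒯.T α).map_zero

theorem sum_apply {ι : Type*} (S : Finset ι) (f : ι → 𝒯.Space) (β : 𝒯.A) :
    (∑ i ∈ S, f i) β = ∑ i ∈ S, f i β := DFinsupp.finsetSum_apply _ _ _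

theorem IsBelow.eq_sum {σ : 𝒯.Space} (hσ : 𝒯.IsBelow γ σ) :
    σ = ∑ i : 𝒯.Below γ, 𝒯.of i.1 (σ i.1) := by
  refine DFinsupp.ext fun β => ?_
  change σ β = (∑ i : 𝒯.Below γ, 𝒯.of i.1 (σ i.1)) β
  rw [sum_apply]
  by_cases hβ : (β : ℝ) < γ
  · rw [Finset.sum_eq_single (⟨β, hβ⟩ : 𝒯.Below γ), of_apply_self]
    · intro i _ hi
      exact of_apply_ne (fun h => hi (Subtype.ext h)) _
    · intro h; exact absurd (Finset.mem_univ _) h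
  · rw [hσ β (not_lt.1 hβ), Finset.sum_eq_zero]
    intro i _
    exact of_apply_ne (fun h => hβ (by rw [← h]; exact i.2)) _

theorem exists_isBelow (σ : 𝒯.Space) : ∃ γ, 𝒯.IsBelow γ σ := by
  classical
  obtain ⟨M, hM⟩ := Finite.exists_le fun α : ↥(DFinsupp.support σ) => ((α : 𝒯.A) : ℝ)
  refine ⟨M + 1, fun α hα => ?_⟩
  by_contra h
  have := hM ⟨α, DFinsupp.mem_support_iff.2 h⟩
  simp only at this
  linarith

theorem IsBelow.sub {σ τ : 𝒯.Space} (hσ : 𝒯.IsBelow γ σ) (hτ : 𝒯.IsBelow γ τ) :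
    𝒯.IsBelow γ (σ - τ) := fun α hα => by
  rw [DirectSum.sub_apply, hσ α hα, hτ α hα, sub_zero]

end RegularityStructure

section Bounds

variable {d : ℕ} {s : Fin d → ℝ} {ℓ : ℝ} {𝒯 : RegularityStructure} {w ws : (Fin d → ℝ) → ℝ} {γ : ℝ}

/-- Linearity of a family of maps into profiles. -/
def PiLinear (P : (Fin d → ℝ) → 𝒯.Space → Profile d) : Prop :=
  ∀ x t z, IsLinearMap ℝ fun τ => P x τ t z

theorem PiLinear.sub {P₁ P₂ : (Fin d → ℝ) → 𝒯.Space → Profile d} (h₁ : PiLinear P₁)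
    (h₂ : PiLinear P₂) : PiLinear fun x τ => P₁ x τ - P₂ x τ := fun x t z =>
  ⟨fun a b => by
    have e1 := (h₁ x t z).map_add a b
    have e2 := (h₂ x t z).map_add a b
    simp only [Pi.sub_apply, e1, e2]
    ring,
  fun c a => by
    have e1 := (h₁ x t z).map_smul c a
    have e2 := (h₂ x t z).map_smul c a
    simp only [Pi.sub_apply, e1, e2, smul_sub]⟩

theorem PiLinear.map_sub {P : (Fin d → ℝ) → 𝒯.Space → Profile d} (h : PiLinear P) (x : Fin d → ℝ)
    (a b : 𝒯.Space) (t : Set.Ioc (0 : ℝ) 1) (z : Fin d → ℝ) :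
    P x (a - b) t z = P x a t z - P x b t z := (h x t z).map_sub a b

/-- On-diagonal bounds for `Π`, with a time dependent coefficient for every homogeneity. -/
def PiBound (ℓ : ℝ) (w : (Fin d → ℝ) → ℝ) (γ : ℝ) (P : (Fin d → ℝ) → 𝒯.Space → Profile d)
    (p : 𝒯.Below γ → ℝ → ℝ) : Prop :=
  ∀ (i : 𝒯.Below γ) (τ : 𝒯.T i.1) (t : Set.Ioc (0 : ℝ) 1) (x : Fin d → ℝ),
    |P x (𝒯.of i.1 τ) t x| ≤ p i t * (t : ℝ) ^ ((i.1 : ℝ) / ℓ) * (w x)⁻¹ * ‖τ‖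

theorem PiBound.abs_apply_le {P : (Fin d → ℝ) → 𝒯.Space → Profile d} {p : 𝒯.Below γ → ℝ → ℝ}
    (hP : PiBound ℓ w γ P p) (hlin : PiLinear P) {σ : 𝒯.Space} (hσ : 𝒯.IsBelow γ σ)
    (t : Set.Ioc (0 : ℝ) 1) (x : Fin d → ℝ) :
    |P x σ t x| ≤ (w x)⁻¹ * ∑ i : 𝒯.Below γ, p i t * (t : ℝ) ^ ((i.1 : ℝ) / ℓ) * ‖σ i.1‖ := by
  have h1 : P x σ t x = ∑ i : 𝒯.Below γ, P x (𝒯.of i.1 (σ i.1)) t x := by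
    conv_lhs => rw [hσ.eq_sum]
    exact map_sum (hlin x t x).mk' _ _
  rw [h1, Finset.mul_sum]
  refine (Finset.abs_sum_le_sum_abs _ _).trans (Finset.sum_le_sum fun i _ => ?_)
  refine (hP i _ t x).trans (le_of_eq ?_)
  ring

theorem PiBound.of_piNorm (hw : ∀ x, 0 < w x) {P : (Fin d → ℝ) → 𝒯.Space → Profile d}
    (hlin : PiLinear P) {K : ℝ} (hK : 0 ≤ K) (h : piNorm ℓ 𝒯 w γ P ≤ ENNReal.ofReal K) :
    PiBound ℓ w γ P fun _ _ => K := by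
  intro i τ t x
  by_cases hτ : τ = 0
  · subst hτ
    have : P x (𝒯.of i.1 0) t x = 0 := by
      rw [RegularityStructure.of_zero]; exact (hlin x t x).map_zero
    rw [this, norm_zero, mul_zero, abs_zero]
  have h1 : ENNReal.ofReal ((t : ℝ) ^ (-(i.1 : ℝ) / ℓ) * w x * (|P x (𝒯.of i.1 τ) t x| / ‖τ‖)) ≤
      piNorm ℓ 𝒯 w γ P := by
    unfold piNorm
    refine le_trans ?_ (le_iSup₂ (f := fun (α : 𝒯.A) (_ : (α : ℝ) < γ) => _) i.1 i.2)
    refine le_trans ?_ (le_iSup₂ (f := fun (t : Set.Ioc (0 : ℝ) 1) (x : Fin d → ℝ) => _) t x)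
    exact le_iSup₂ (f := fun (τ : 𝒯.T i.1) (_ : τ ≠ 0) => ENNReal.ofReal
      ((t : ℝ) ^ (-(i.1 : ℝ) / ℓ) * w x * (|P x (𝒯.of i.1 τ) t x| / ‖τ‖))) τ hτ
  have h2 := (ENNReal.ofReal_le_ofReal_iff hK).1 (h1.trans h)
  have hn : 0 < ‖τ‖ := norm_pos_iff.2 hτ
  have htp : 0 < (t : ℝ) ^ ((i.1 : ℝ) / ℓ) := Real.rpow_pos_of_pos t.2.1 _
  have hwx := hw x
  rw [neg_div, Real.rpow_neg t.2.1.le] at h2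
  have h3 : |P x (𝒯.of i.1 τ) t x| = (((t : ℝ) ^ ((i.1 : ℝ) / ℓ))⁻¹ * w x *
      (|P x (𝒯.of i.1 τ) t x| / ‖τ‖)) * ((t : ℝ) ^ ((i.1 : ℝ) / ℓ) * (w x)⁻¹ * ‖τ‖) := by
    field_simp
  rw [h3]
  refine (mul_le_mul_of_nonneg_right h2 (by positivity)).trans (le_of_eq ?_)
  ring

theorem piNorm_le_add (hw : ∀ x, 0 < w x) (P₁ P₂ : (Fin d → ℝ) → 𝒯.Space → Profile d) :
    piNorm ℓ 𝒯 w γ P₂ ≤ piNorm ℓ 𝒯 w γ (fun x τ => P₁ x τ - P₂ x τ) + piNorm ℓ 𝒯 w γ P₁ := by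
  refine iSup₂_le fun α hα => iSup₂_le fun t x => iSup₂_le fun τ hτ => ?_
  have hle : ∀ P : (Fin d → ℝ) → 𝒯.Space → Profile d,
      ENNReal.ofReal ((t : ℝ) ^ (-(α : ℝ) / ℓ) * w x * (|P x (𝒯.of α τ) t x| / ‖τ‖)) ≤
      piNorm ℓ 𝒯 w γ P := fun P => by
    unfold piNorm
    refine le_trans ?_ (le_iSup₂ (f := fun (α : 𝒯.A) (_ : (α : ℝ) < γ) => _) α hα)
    refine le_trans ?_ (le_iSup₂ (f := fun (t : Set.Ioc (0 : ℝ) 1) (x : Fin d → ℝ) => _) t x)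
    exact le_iSup₂ (f := fun (τ : 𝒯.T α) (_ : τ ≠ 0) => ENNReal.ofReal
      ((t : ℝ) ^ (-(α : ℝ) / ℓ) * w x * (|P x (𝒯.of α τ) t x| / ‖τ‖))) τ hτ
  have hc : 0 ≤ (t : ℝ) ^ (-(α : ℝ) / ℓ) * w x :=
    mul_nonneg (Real.rpow_nonneg t.2.1.le _) (hw x).le
  refine le_trans ?_ (add_le_add (hle fun x τ => P₁ x τ - P₂ x τ) (hle P₁))
  rw [← ENNReal.ofReal_add (mul_nonneg hc (by positivity)) (mul_nonneg hc (by positivity)),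
    ← mul_add, ← add_div]
  refine ENNReal.ofReal_le_ofReal (mul_le_mul_of_nonneg_left
    (div_le_div_of_nonneg_right ?_ (norm_nonneg _)) hc)
  have := abs_sub_abs_le_abs_sub (P₂ x (𝒯.of α τ) t x) (P₁ x (𝒯.of α τ) t x)
  rw [abs_sub_comm] at this
  simp only [Pi.sub_apply]
  linarith

/-- `Γ` acts as `e` times the identity on the components of homogeneity at least that of the
argument and on the diagonal. -/
structure IsTriangular (Γ : (Fin d → ℝ) → (Fin d → ℝ) → 𝒯.Space →ₗ[ℝ] 𝒯.Space) (e : ℝ) :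
    Prop where
  upper : ∀ x y (α β : 𝒯.A) (τ : 𝒯.T α), (α : ℝ) ≤ β → (Γ x y (𝒯.of α τ)) β = e • (𝒯.of α τ) β
  self : ∀ x σ, Γ x x σ = e • σ

/-- Models have e = 1, differences of two models e = 0. In the latter case the diagonal block
disappears and bounds are linear in the distance of the models. -/
theorem IsTriangular.sub {Γ₁ Γ₂ : (Fin d → ℝ) → (Fin d → ℝ) → 𝒯.Space →ₗ[ℝ] 𝒯.Space} {e₁ e₂ : ℝ}
    (h₁ : IsTriangular Γ₁ e₁) (h₂ : IsTriangular Γ₂ e₂) :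
    IsTriangular (fun x y => Γ₁ x y - Γ₂ x y) (e₁ - e₂) :=
  ⟨fun x y α β τ hαβ => by
    rw [LinearMap.sub_apply, DirectSum.sub_apply, h₁.upper x y α β τ hαβ, h₂.upper x y α β τ hαβ,
      sub_smul],
  fun x σ => by rw [LinearMap.sub_apply, h₁.self, h₂.self, sub_smul]⟩

/-- Bounds for `Γ`, including the diagonal block. -/
def GammaBound (s : Fin d → ℝ) (w ws : (Fin d → ℝ) → ℝ) (γ : ℝ)
    (Γ : (Fin d → ℝ) → (Fin d → ℝ) → 𝒯.Space →ₗ[ℝ] 𝒯.Space) (N : ℝ) : Prop :=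
  ∀ (i : 𝒯.Below γ) (τ : 𝒯.T i.1) (β : 𝒯.A) (y z : Fin d → ℝ),
    ‖(Γ z y (𝒯.of i.1 τ)) β‖ ≤ N * ((w y)⁻¹ * ws (z - y) *
      ((if (β : ℝ) ≤ i.1 then scaledSize s (z - y) ^ ((i.1 : ℝ) - β) else 0) * ‖τ‖))

/-- The norm of Γ sees strictly lower blocks only. Blocks above the diagonal vanish and the diagonal
one is e times the identity, which fits the same scale because w ≤ 1 ≤ w^*. -/
theorem GammaBound.of_gammaNorm (hw : ∀ x, 0 < w x) (hw1 : ∀ x, w x ≤ 1) (hws : ∀ x, 1 ≤ ws x)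
    {Γ : (Fin d → ℝ) → (Fin d → ℝ) → 𝒯.Space →ₗ[ℝ] 𝒯.Space} {e : ℝ} (he : 0 ≤ e)
    (hΓ : IsTriangular Γ e) {K : ℝ} (hK : 0 ≤ K)
    (h : gammaNorm s 𝒯 w ws γ Γ ≤ ENNReal.ofReal K) : GammaBound s w ws γ Γ (e + K) := by
  intro i τ β y z
  have hwy := hw y
  have hwsz : 0 < ws (z - y) := lt_of_lt_of_le one_pos (hws _)
  have hnn : ∀ c : ℝ, 0 ≤ c → 0 ≤ (w y)⁻¹ * ws (z - y) * (c * ‖τ‖) := fun c hc => by positivity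
  rcases lt_trichotomy (β : ℝ) i.1 with hβ | hβ | hβ
  · rw [if_pos hβ.le]
    have hsz : 0 ≤ scaledSize s (z - y) ^ ((i.1 : ℝ) - β) :=
      Real.rpow_nonneg (scaledSize_nonneg _) _
    by_cases hτ : τ = 0
    · subst hτ
      rw [RegularityStructure.of_zero, map_zero, DirectSum.zero_apply, norm_zero, norm_zero, mul_zero, mul_zero,
        mul_zero]
    by_cases hyz : y = z
    · subst hyz
      rw [hΓ.self, DirectSum.smul_apply, RegularityStructure.of_apply_ne (fun h => by
        rw [h] at hβ; exact lt_irrefl _ hβ), smul_zero, norm_zero]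
      exact mul_nonneg (by linarith) (hnn _ hsz)
    have hsp : 0 < scaledSize s (z - y) ^ ((i.1 : ℝ) - β) :=
      Real.rpow_pos_of_pos (scaledSize_pos (sub_ne_zero.2 (Ne.symm hyz))) _
    have h1 : ENNReal.ofReal (w y * ‖(Γ z y (𝒯.of i.1 τ)) β‖ /
        (ws (z - y) * scaledSize s (z - y) ^ ((i.1 : ℝ) - β) * ‖τ‖)) ≤ gammaNorm s 𝒯 w ws γ Γ := by
      unfold gammaNorm
      refine le_trans ?_ (le_iSup₂ (f := fun (α : 𝒯.A) (β : 𝒯.A) => _) i.1 β)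
      refine le_trans ?_ (le_iSup₂ (f := fun (_ : (β : ℝ) < i.1) (_ : (i.1 : ℝ) < γ) => _) hβ i.2)
      refine le_trans ?_ (le_iSup₂ (f := fun (x : Fin d → ℝ) (y : Fin d → ℝ) => _) y z)
      refine le_trans ?_ (le_iSup (fun (_ : y ≠ z) => _) hyz)
      exact le_iSup₂ (f := fun (τ : 𝒯.T i.1) (_ : τ ≠ 0) => ENNReal.ofReal
        (w y * ‖(Γ z y (𝒯.of i.1 τ)) β‖ /
        (ws (z - y) * scaledSize s (z - y) ^ ((i.1 : ℝ) - β) * ‖τ‖))) τ hτ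
    have h2 := (ENNReal.ofReal_le_ofReal_iff hK).1 (h1.trans h)
    have hn : 0 < ‖τ‖ := norm_pos_iff.2 hτ
    rw [div_le_iff₀ (by positivity)] at h2
    have h3 : ‖(Γ z y (𝒯.of i.1 τ)) β‖ = (w y)⁻¹ * (w y * ‖(Γ z y (𝒯.of i.1 τ)) β‖) := by
      field_simp
    rw [h3]
    refine (mul_le_mul_of_nonneg_left h2 (inv_nonneg.2 hwy.le)).trans ?_
    have h4 := mul_nonneg he (hnn _ hsz)
    linarith
  · have hβ' : β = i.1 := Subtype.ext hβ
    subst hβ'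
    rw [hΓ.upper z y _ _ τ le_rfl, RegularityStructure.of_apply_self, norm_smul,
      Real.norm_of_nonneg he, if_pos le_rfl, sub_self, Real.rpow_zero, one_mul]
    have h1 : 1 ≤ (w y)⁻¹ := (one_le_inv₀ hwy).2 (hw1 y)
    have h2 : 1 ≤ (w y)⁻¹ * ws (z - y) := one_le_mul_of_one_le_of_one_le h1 (hws _)
    have h3 : ‖τ‖ ≤ (w y)⁻¹ * ws (z - y) * ‖τ‖ := le_mul_of_one_le_left (norm_nonneg _) h2
    exact mul_le_mul (by linarith) h3 (norm_nonneg _) (by linarith)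
  · rw [hΓ.upper z y _ _ τ hβ.le, RegularityStructure.of_apply_ne (fun h => by
      rw [h] at hβ; exact lt_irrefl _ hβ), smul_zero, norm_zero, if_neg (not_le.2 hβ), zero_mul,
      mul_zero, mul_zero]

theorem GammaBound.norm_apply_le {Γ : (Fin d → ℝ) → (Fin d → ℝ) → 𝒯.Space →ₗ[ℝ] 𝒯.Space} {N : ℝ}
    (hΓ : GammaBound s w ws γ Γ N) {σ : 𝒯.Space} (hσ : 𝒯.IsBelow γ σ) (y z : Fin d → ℝ)
    (β : 𝒯.A) :
    ‖(Γ z y σ) β‖ ≤ N * ((w y)⁻¹ * ws (z - y) * ∑ i : 𝒯.Below γ,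
      (if (β : ℝ) ≤ i.1 then scaledSize s (z - y) ^ ((i.1 : ℝ) - β) else 0) * ‖σ i.1‖) := by
  have h1 : (Γ z y σ) β = ∑ i : 𝒯.Below γ, (Γ z y (𝒯.of i.1 (σ i.1))) β := by
    conv_lhs => rw [hσ.eq_sum]
    rw [map_sum, RegularityStructure.sum_apply]
  rw [h1, Finset.mul_sum, Finset.mul_sum]
  exact (norm_sum_le _ _).trans (Finset.sum_le_sum fun i _ => hΓ i _ β y z)

theorem IsTriangular.isBelow {Γ : (Fin d → ℝ) → (Fin d → ℝ) → 𝒯.Space →ₗ[ℝ] 𝒯.Space} {e : ℝ}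
    (hΓ : IsTriangular Γ e) {σ : 𝒯.Space} (hσ : 𝒯.IsBelow γ σ) (y z : Fin d → ℝ) :
    𝒯.IsBelow γ (Γ z y σ) := by
  intro β hβ
  have h1 : (Γ z y σ) β = ∑ i : 𝒯.Below γ, (Γ z y (𝒯.of i.1 (σ i.1))) β := by
    conv_lhs => rw [hσ.eq_sum]
    rw [map_sum, RegularityStructure.sum_apply]
  rw [h1]
  refine Finset.sum_eq_zero fun i _ => ?_
  have hi : (i.1 : ℝ) < β := i.2.trans_le hβ
  rw [hΓ.upper z y _ _ _ hi.le, RegularityStructure.of_apply_ne (fun h => by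
      rw [h] at hi; exact lt_irrefl _ hi), smul_zero]

theorem gammaNorm_le_add (hw : ∀ x, 0 < w x) (hws : ∀ x, 1 ≤ ws x)
    (Γ₁ Γ₂ : (Fin d → ℝ) → (Fin d → ℝ) → 𝒯.Space →ₗ[ℝ] 𝒯.Space) :
    gammaNorm s 𝒯 w ws γ Γ₂ ≤
      gammaNorm s 𝒯 w ws γ (fun x y => Γ₁ x y - Γ₂ x y) + gammaNorm s 𝒯 w ws γ Γ₁ := by
  refine iSup₂_le fun α β => iSup₂_le fun hβ hα => iSup₂_le fun y z => iSup_le fun hyz =>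
    iSup₂_le fun τ hτ => ?_
  have hle : ∀ Γ : (Fin d → ℝ) → (Fin d → ℝ) → 𝒯.Space →ₗ[ℝ] 𝒯.Space,
      ENNReal.ofReal (w y * ‖(Γ z y (𝒯.of α τ)) β‖ /
        (ws (z - y) * scaledSize s (z - y) ^ ((α : ℝ) - β) * ‖τ‖)) ≤
      gammaNorm s 𝒯 w ws γ Γ := fun Γ => by
    unfold gammaNorm
    refine le_trans ?_ (le_iSup₂ (f := fun (α : 𝒯.A) (β : 𝒯.A) => _) α β)
    refine le_trans ?_ (le_iSup₂ (f := fun (_ : (β : ℝ) < α) (_ : (α : ℝ) < γ) => _) hβ hα)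
    refine le_trans ?_ (le_iSup₂ (f := fun (x : Fin d → ℝ) (y : Fin d → ℝ) => _) y z)
    refine le_trans ?_ (le_iSup (fun (_ : y ≠ z) => _) hyz)
    exact le_iSup₂ (f := fun (τ : 𝒯.T α) (_ : τ ≠ 0) => ENNReal.ofReal
      (w y * ‖(Γ z y (𝒯.of α τ)) β‖ /
      (ws (z - y) * scaledSize s (z - y) ^ ((α : ℝ) - β) * ‖τ‖))) τ hτ
  have hwy := (hw y).le
  have hwz : 0 ≤ ws (z - y) := zero_le_one.trans (hws _)
  have hden : 0 ≤ ws (z - y) * scaledSize s (z - y) ^ ((α : ℝ) - β) * ‖τ‖ :=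
    mul_nonneg (mul_nonneg hwz (Real.rpow_nonneg (scaledSize_nonneg _) _)) (norm_nonneg _)
  refine le_trans ?_ (add_le_add (hle fun x y => Γ₁ x y - Γ₂ x y) (hle Γ₁))
  rw [← ENNReal.ofReal_add (by positivity) (by positivity), ← add_div, ← mul_add]
  refine ENNReal.ofReal_le_ofReal (div_le_div_of_nonneg_right
    (mul_le_mul_of_nonneg_left ?_ hwy) hden)
  rw [LinearMap.sub_apply, DirectSum.sub_apply]
  have := norm_sub_norm_le ((Γ₂ z y (𝒯.of α τ)) β) ((Γ₁ z y (𝒯.of α τ)) β)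
  rw [norm_sub_rev] at this
  linarith

end Bounds

end

/-! ### Models as limits of smooth models. -/

noncomputable section

section Model

variable {d : ℕ} {s : Fin d → ℝ} {ℓ : ℝ} {G : (Fin d → ℝ) → ℝ}
  {Q : ℝ → (Fin d → ℝ) → (Fin d → ℝ) → ℝ} {𝒯 : RegularityStructure}
  {w ws : (Fin d → ℝ) → ℝ}

theorem SmoothModel.isTriangular (S : SmoothModel s ℓ Q 𝒯 w ws) :
    IsTriangular (fun x y => (S.Gamma x y).toLinearMap) 1 :=
  ⟨fun x y α β τ hαβ => by
    have h := 𝒯.triangular _ (S.gamma_mem x y) α τ β hαβ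
    rw [DirectSum.sub_apply, sub_eq_zero] at h
    rw [one_smul]
    exact h,
  fun x σ => by rw [one_smul]; exact S.gamma_self x σ⟩

theorem RSModel.isTriangular (M : RSModel s ℓ Q 𝒯 w ws) : IsTriangular M.Gamma 1 := by
  obtain ⟨S, -, -, -, h⟩ := M.exists_approx
  refine ⟨fun x y α β τ hαβ => ?_, fun x σ => DFinsupp.ext fun β => ?_⟩
  · refine tendsto_nhds_unique (h x y (𝒯.of α τ) β) ?_
    refine tendsto_const_nhds.congr fun n => ?_
    exact ((S n).isTriangular.upper x y α β τ hαβ).symm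
  · refine tendsto_nhds_unique (h x x σ β) ?_
    refine tendsto_const_nhds.congr fun n => ?_
    rw [(S n).gamma_self, one_smul]

theorem RSModel.gammaNorm_lt_top (hw : IsGControlled s ℓ G w ws) (M : RSModel s ℓ Q 𝒯 w ws)
    (γ : ℝ) : gammaNorm s 𝒯 w ws γ M.Gamma < ∞ := by
  obtain ⟨S, -, h, -, -⟩ := M.exists_approx
  obtain ⟨n, hn⟩ := (((h γ).eventually_lt_const ENNReal.zero_lt_top)).exists
  exact (gammaNorm_le_add hw.pos hw.one_le_star _ _).trans_lt
    (ENNReal.add_lt_top.2 ⟨hn, (S n).gammaNorm_lt_top γ⟩)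

theorem RSModel.piNorm_lt_top (hw : IsGControlled s ℓ G w ws) (M : RSModel s ℓ Q 𝒯 w ws)
    (γ : ℝ) : piNorm ℓ 𝒯 w γ M.Pi < ∞ := by
  obtain ⟨S, h, -, -, -⟩ := M.exists_approx
  obtain ⟨n, hn⟩ := (((h γ).eventually_lt_const ENNReal.zero_lt_top)).exists
  exact (piNorm_le_add hw.pos (fun x τ => profile Q ((S n).Pi x τ)) _).trans_lt
    (ENNReal.add_lt_top.2 ⟨hn, (S n).piNorm_lt_top γ⟩)

variable [NeZero d] (hs : ∀ i, 1 ≤ s i) (hℓ : 0 < ℓ) (hG0 : ∀ x, 0 ≤ G x)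
  (hQ : IsGTypeSemigroup s ℓ G Q) (hw : IsGControlled s ℓ G w ws)
include hs hℓ hG0 hQ hw

theorem SmoothModel.piLinear (S : SmoothModel s ℓ Q 𝒯 w ws) :
    PiLinear fun x τ => profile Q (S.Pi x τ) := by
  intro x t z
  have hint : ∀ τ, Integrable fun y => Q t z y * S.Pi x τ y := fun τ => by
    obtain ⟨_, _, h⟩ := kernelOp_dominated hs hℓ hG0 hQ hw
      (dominated_of_mem_weightedContinuous hs hw (S.pi_mem x τ)) t.2.1 (t.2.2.trans one_le_two)
    exact (h z).1
  refine ⟨fun a b => ?_, fun c a => ?_⟩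
  · change (∫ y, Q t z y * S.Pi x (a + b) y) =
      (∫ y, Q t z y * S.Pi x a y) + ∫ y, Q t z y * S.Pi x b y
    rw [← integral_add (hint a) (hint b), map_add]
    simp only [Pi.add_apply, mul_add]
  · change (∫ y, Q t z y * S.Pi x (c • a) y) = c * ∫ y, Q t z y * S.Pi x a y
    rw [map_smul, ← integral_const_mul]
    simp only [Pi.smul_apply, smul_eq_mul, mul_left_comm]

theorem RSModel.piLinear (M : RSModel s ℓ Q 𝒯 w ws) : PiLinear M.Pi := by
  obtain ⟨S, -, -, h, -⟩ := M.exists_approx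
  intro x t z
  refine ⟨fun a b => ?_, fun c a => ?_⟩
  · refine tendsto_nhds_unique (h x (a + b) t z) (((h x a t z).add (h x b t z)).congr fun n => ?_)
    exact (((S n).piLinear hs hℓ hG0 hQ hw x t z).map_add a b).symm
  · refine tendsto_nhds_unique (h x (c • a) t z) (((h x a t z).const_mul c).congr fun n => ?_)
    exact (((S n).piLinear hs hℓ hG0 hQ hw x t z).map_smul c a).symm

/-- Quantitative off-diagonal convergence of the approximating smooth models, and the identity
`Π_z Γ_{zy} = Π_y` in the limit. -/
theorem RSModel.exists_seq (M : RSModel s ℓ Q 𝒯 w ws) :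
    ∃ S : ℕ → SmoothModel s ℓ Q 𝒯 w ws, ∀ y σ t,
      (∀ z, M.Pi z (M.Gamma z y σ) t z = M.Pi y σ t z) ∧
      ∃ (γ : ℝ) (m c : 𝒯.Below γ × 𝒯.Below γ → ℝ) (ε : ℕ → ℝ),
        (∀ j, 0 ≤ m j) ∧ (∀ j, 0 ≤ c j) ∧ (∀ n, 0 ≤ ε n) ∧ Tendsto ε atTop (𝓝 0) ∧
        ∀ᶠ n in atTop, ∀ z, |profile Q ((S n).Pi y σ) t z - M.Pi y σ t z| ≤
          ε n * ((w z)⁻¹ * ((w y)⁻¹ * ws (z - y) *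
            ∑ j, c j * scaledSize s (z - y) ^ m j)) := by
  have hMlin := M.piLinear hs hℓ hG0 hQ hw
  have hMtri := M.isTriangular
  obtain ⟨S, hP, hΓ, hPpt, -⟩ := M.exists_approx
  refine ⟨S, fun y σ t => ?_⟩
  obtain ⟨γ, hσ⟩ := RegularityStructure.exists_isBelow σ
  set m : 𝒯.Below γ × 𝒯.Below γ → ℝ := fun j => max ((j.2.1 : ℝ) - j.1.1) 0 with hm
  set c : 𝒯.Below γ × 𝒯.Below γ → ℝ := fun j =>
    if (j.1.1 : ℝ) ≤ j.2.1 then (t : ℝ) ^ ((j.1.1 : ℝ) / ℓ) * ‖σ j.2.1‖ else 0 with hc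
  set δ : ℕ → ℝ := fun n =>
    (piNorm ℓ 𝒯 w γ (fun x τ => profile Q ((S n).Pi x τ) - M.Pi x τ)).toReal with hδ
  set δ' : ℕ → ℝ := fun n => (gammaNorm s 𝒯 w ws γ
      (fun x y => ((S n).Gamma x y).toLinearMap - M.Gamma x y)).toReal with hδ'
  set K : ℝ := (piNorm ℓ 𝒯 w γ M.Pi).toReal with hK
  set N : ℝ := 1 + (gammaNorm s 𝒯 w ws γ M.Gamma).toReal with hN
  have hδ0 : Tendsto δ atTop (𝓝 0) := by
    have h : Tendsto δ atTop (𝓝 (ENNReal.toReal 0)) :=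
      (ENNReal.tendsto_toReal ENNReal.zero_ne_top).comp (hP γ)
    rwa [ENNReal.toReal_zero] at h
  have hδ'0 : Tendsto δ' atTop (𝓝 0) := by
    have h : Tendsto δ' atTop (𝓝 (ENNReal.toReal 0)) :=
      (ENNReal.tendsto_toReal ENNReal.zero_ne_top).comp (hΓ γ)
    rwa [ENNReal.toReal_zero] at h
  have hδp : ∀ n, 0 ≤ δ n := fun n => ENNReal.toReal_nonneg
  have hδ'p : ∀ n, 0 ≤ δ' n := fun n => ENNReal.toReal_nonneg
  have hK0 : 0 ≤ K := ENNReal.toReal_nonneg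
  have hN0 : 0 ≤ N := add_nonneg zero_le_one ENNReal.toReal_nonneg
  have hPM : PiBound ℓ w γ M.Pi fun _ _ => K := PiBound.of_piNorm hw.pos hMlin hK0
    (ENNReal.ofReal_toReal (M.piNorm_lt_top hw γ).ne).ge
  have hGM : GammaBound s w ws γ M.Gamma N := GammaBound.of_gammaNorm hw.pos hw.le_one
    hw.one_le_star zero_le_one hMtri ENNReal.toReal_nonneg
    (ENNReal.ofReal_toReal (M.gammaNorm_lt_top hw γ).ne).ge
  set H : (Fin d → ℝ) → ℝ := fun z => (w z)⁻¹ * ((w y)⁻¹ * ws (z - y) *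
    ∑ j, c j * scaledSize s (z - y) ^ m j) with hH
  -- the general estimate of a composition
  have hcomp : ∀ (P : (Fin d → ℝ) → 𝒯.Space → Profile d)
      (Γ : (Fin d → ℝ) → (Fin d → ℝ) → 𝒯.Space →ₗ[ℝ] 𝒯.Space) (a b e : ℝ), 0 ≤ a →
      PiLinear P → PiBound ℓ w γ P (fun _ _ => a) → IsTriangular Γ e → GammaBound s w ws γ Γ b →
      ∀ z, |P z (Γ z y σ) t z| ≤ a * b * H z := by
    intro P Γ a b e ha hPl hPb hΓt hΓb z
    refine (hPb.abs_apply_le hPl (hΓt.isBelow hσ y z) t z).trans ?_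
    have hwz : 0 ≤ (w z)⁻¹ := inv_nonneg.2 (hw.pos z).le
    rw [hH]
    simp only
    rw [mul_left_comm]
    refine mul_le_mul_of_nonneg_left ?_ hwz
    rw [Fintype.sum_prod_type]
    simp only [Finset.mul_sum]
    refine Finset.sum_le_sum fun i _ => ?_
    have hti : 0 ≤ a * (t : ℝ) ^ ((i.1 : ℝ) / ℓ) :=
      mul_nonneg ha (Real.rpow_nonneg t.2.1.le _)
    refine (mul_le_mul_of_nonneg_left (hΓb.norm_apply_le hσ y z i.1) hti).trans (le_of_eq ?_)
    simp only [Finset.mul_sum]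
    refine Finset.sum_congr rfl fun k _ => ?_
    simp only [hc, hm]
    split_ifs with hik
    · rw [max_eq_left (sub_nonneg.2 hik)]
      ring
    · ring
  -- The three terms come from Π'Γ' - ΠΓ = (Π'-Π)(Γ'-Γ) + (Π'-Π)Γ + Π(Γ'-Γ), the primes denoting the
  -- smooth approximation.
  set ε : ℕ → ℝ := fun n => δ n * δ' n + δ n * N + K * δ' n with hε
  have hε0 : Tendsto ε atTop (𝓝 0) := by
    have := ((hδ0.mul hδ'0).add (hδ0.mul_const N)).add (hδ'0.const_mul K)
    simpa using this
  have hmain : ∀ᶠ n in atTop, ∀ z,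
      |profile Q ((S n).Pi y σ) t z - M.Pi z (M.Gamma z y σ) t z| ≤ ε n * H z := by
    filter_upwards [(hP γ).eventually_lt_const ENNReal.zero_lt_top,
      (hΓ γ).eventually_lt_const ENNReal.zero_lt_top] with n hn1 hn2 z
    have hSlin := (S n).piLinear hs hℓ hG0 hQ hw
    have hDlin := hSlin.sub hMlin
    have hDb : PiBound ℓ w γ (fun x τ => profile Q ((S n).Pi x τ) - M.Pi x τ) fun _ _ => δ n :=
      PiBound.of_piNorm hw.pos hDlin (hδp n) (ENNReal.ofReal_toReal hn1.ne).ge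
    have hDt : IsTriangular (fun x y => ((S n).Gamma x y).toLinearMap - M.Gamma x y) 0 := by
      have := (S n).isTriangular.sub hMtri
      rwa [sub_self] at this
    have hDg : GammaBound s w ws γ
        (fun x y => ((S n).Gamma x y).toLinearMap - M.Gamma x y) (0 + δ' n) :=
      GammaBound.of_gammaNorm hw.pos hw.le_one hw.one_le_star le_rfl hDt (hδ'p n)
        (ENNReal.ofReal_toReal hn2.ne).ge
    rw [zero_add] at hDg
    have e1 := hcomp _ _ _ _ _ (hδp n) hDlin hDb hDt hDg z
    have e2 := hcomp _ _ _ _ _ (hδp n) hDlin hDb hMtri hGM z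
    have e3 := hcomp _ _ _ _ _ hK0 hMlin hPM hDt hDg z
    -- The norms control Π at its base point only, so the functional is first recentred at the
    -- evaluation point z.
    have hpg : profile Q ((S n).Pi y σ) = profile Q ((S n).Pi z ((S n).Gamma z y σ)) := by
      rw [(S n).pi_gamma]
    have hsum : profile Q ((S n).Pi y σ) t z - M.Pi z (M.Gamma z y σ) t z =
        (profile Q ((S n).Pi z ((((S n).Gamma z y).toLinearMap - M.Gamma z y) σ)) -
          M.Pi z ((((S n).Gamma z y).toLinearMap - M.Gamma z y) σ)) t z +
        (profile Q ((S n).Pi z (M.Gamma z y σ)) - M.Pi z (M.Gamma z y σ)) t z +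
        M.Pi z ((((S n).Gamma z y).toLinearMap - M.Gamma z y) σ) t z := by
      have h1 := hSlin.map_sub z ((S n).Gamma z y σ) (M.Gamma z y σ) t z
      rw [hpg]
      simp only [LinearMap.sub_apply, LinearEquiv.coe_coe, Pi.sub_apply]
      rw [h1]
      ring
    rw [hsum]
    refine (abs_add_three _ _ _).trans ?_
    rw [hε]
    simp only
    linarith
  -- Both sides are limits of the same sequence: the left by the estimate above, the right by the
  -- definition of the model.
  have hid : ∀ z, M.Pi z (M.Gamma z y σ) t z = M.Pi y σ t z := by
    intro z
    refine tendsto_nhds_unique (f := fun n => profile Q ((S n).Pi y σ) t z) ?_ (hPpt y σ t z)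
    rw [tendsto_iff_dist_tendsto_zero]
    have h0 : Tendsto (fun n => ε n * H z) atTop (𝓝 0) := by simpa using hε0.mul_const (H z)
    refine squeeze_zero' (Eventually.of_forall fun n => dist_nonneg) ?_ h0
    filter_upwards [hmain] with n hn
    exact hn z
  refine ⟨hid, γ, m, c, ε, fun j => le_max_right _ _, fun j => ?_, fun n => ?_, hε0, ?_⟩
  · simp only [hc]
    split_ifs
    · exact mul_nonneg (Real.rpow_nonneg t.2.1.le _) (norm_nonneg _)
    · exact le_rfl
  · exact add_nonneg (add_nonneg (mul_nonneg (hδp n) (hδ'p n)) (mul_nonneg (hδp n) hN0))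
      (mul_nonneg hK0 (hδ'p n))
  · filter_upwards [hmain] with n hn z
    rw [← hid z]
    exact hn z

theorem RSModel.pi_gamma (M : RSModel s ℓ Q 𝒯 w ws) (y z : Fin d → ℝ) (σ : 𝒯.Space)
    (t : Set.Ioc (0 : ℝ) 1) : M.Pi z (M.Gamma z y σ) t z = M.Pi y σ t z := by
  obtain ⟨S, h⟩ := M.exists_seq hs hℓ hG0 hQ hw
  exact (h y σ t).1 z

theorem SmoothModel.profile_continuous (S : SmoothModel s ℓ Q 𝒯 w ws) (y : Fin d → ℝ)
    (σ : 𝒯.Space) (t : Set.Ioc (0 : ℝ) 1) : Continuous (profile Q (S.Pi y σ) t) :=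
  kernelOp_continuous hs hℓ hG0 hQ hw
    (dominated_of_mem_weightedContinuous hs hw (S.pi_mem y σ)) t.2.1 (t.2.2.trans one_le_two)

/-- The off-diagonal error is ε_n times a fixed continuous function of z, so the smooth profiles
converge locally uniformly. -/
theorem RSModel.pi_continuous (M : RSModel s ℓ Q 𝒯 w ws) (y : Fin d → ℝ) (σ : 𝒯.Space)
    (t : Set.Ioc (0 : ℝ) 1) : Continuous (M.Pi y σ t) := by
  obtain ⟨S, h⟩ := M.exists_seq hs hℓ hG0 hQ hw
  obtain ⟨-, γ, m, c, ε, hm, hc, hε, hε0, hb⟩ := h y σ t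
  set H : (Fin d → ℝ) → ℝ := fun z => (w z)⁻¹ * ((w y)⁻¹ * ws (z - y) *
    ∑ j, c j * scaledSize s (z - y) ^ m j) with hH
  have hsub : Continuous fun z : Fin d → ℝ => z - y := continuous_id.sub continuous_const
  have hHc : Continuous H := by
    refine (hw.continuous.inv₀ fun z => (hw.pos z).ne').mul
      ((continuous_const.mul (hw.star_continuous.comp hsub)).mul ?_)
    exact continuous_finsetSum _ fun j _ => continuous_const.mul
      (((scaledSize_continuous hs).comp hsub).rpow_const fun z => Or.inr (hm j))
  have hunif : TendstoLocallyUniformly (fun n => profile Q ((S n).Pi y σ) t) (M.Pi y σ t)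
      atTop := by
    rw [Metric.tendstoLocallyUniformly_iff]
    intro e he z₀
    refine ⟨{z | H z < |H z₀| + 1}, (isOpen_lt hHc continuous_const).mem_nhds
      (show H z₀ < |H z₀| + 1 from lt_of_le_of_lt (le_abs_self _) (lt_add_one _)), ?_⟩
    have h0 : Tendsto (fun n => ε n * (|H z₀| + 1)) atTop (𝓝 0) := by
      simpa using hε0.mul_const (|H z₀| + 1)
    filter_upwards [hb, h0.eventually_lt_const he] with n hn1 hn2 z hz
    rw [dist_comm, Real.dist_eq]
    exact (hn1 z).trans_lt ((mul_le_mul_of_nonneg_left (le_of_lt hz) (hε n)).trans_lt hn2)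
  exact hunif.continuous
    (Frequently.of_forall fun n => (S n).profile_continuous hs hℓ hG0 hQ hw y σ t)

/-- The semigroup property of `Q_t(·, Π_y σ)` at the base point. -/
theorem RSModel.kernelOp_pi {u us : (Fin d → ℝ) → ℝ} (hu : IsGControlled s ℓ G u us)
    (hus : ∀ x, ws x ^ 2 ≤ us x) (hws : ∀ x, ws (-x) = ws x)
    (M : RSModel s ℓ Q 𝒯 w ws) (y : Fin d → ℝ) (σ : 𝒯.Space) (r t : Set.Ioc (0 : ℝ) 1)
    (hrt : (r : ℝ) < t) : Integrable (fun z => Q ((t : ℝ) - r) y z * M.Pi y σ r z) ∧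
    kernelOp Q ((t : ℝ) - r) (M.Pi y σ r) y = M.Pi y σ t y := by
  have hcont := M.pi_continuous hs hℓ hG0 hQ hw y σ r
  obtain ⟨S, h⟩ := M.exists_seq hs hℓ hG0 hQ hw
  obtain ⟨-, γ, m, c, ε, hm, hc, hε, hε0, hb⟩ := h y σ r
  obtain ⟨-, γ', m', c', ε', -, -, -, hε0', hb'⟩ := h y σ t
  have htr : 0 < (t : ℝ) - r := sub_pos.2 hrt
  have htr2 : (t : ℝ) - r ≤ 2 := by linarith [t.2.2, r.2.1]
  obtain ⟨C, hC, hint⟩ := IsGTypeSemigroup.integral_le hs hℓ hG0 hQ hu m (fun _ => 0) hm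
    (fun _ => le_rfl) (fun _ => lt_of_lt_of_le one_pos (hs 0))
  set B : ℝ := C * ∑ j, (w y)⁻¹ ^ 2 * c j * ((t : ℝ) - r) ^ ((m j - 0) / ℓ) with hB
  have hwy : 0 ≤ (w y)⁻¹ := inv_nonneg.2 (hw.pos y).le
  have hdiff : ∀ᶠ n in atTop, Integrable (fun z => Q ((t : ℝ) - r) y z * M.Pi y σ r z) ∧
      |profile Q ((S n).Pi y σ) t y -
      kernelOp Q ((t : ℝ) - r) (M.Pi y σ r) y| ≤ ε n * B := by
    filter_upwards [hb] with n hn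
    have hpc := (S n).profile_continuous hs hℓ hG0 hQ hw y σ r
    have hdom := dominated_of_mem_weightedContinuous hs hw ((S n).pi_mem y σ)
    have hsg := kernelOp_kernelOp hs hℓ hG0 hQ hw hdom htr htr2 r.2.1
      (r.2.2.trans one_le_two) y
    rw [sub_add_cancel] at hsg
    have hpd := kernelOp_hyperplaneDominated hs hℓ hG0 hQ hw hdom r.2.1 (r.2.2.trans one_le_two)
    obtain ⟨_, _, hi1⟩ := kernelOp_dominated hs hℓ hG0 hQ hw hpd htr htr2
    obtain ⟨hi, hI, -⟩ := hint _ htr htr2 y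
      (fun z => profile Q ((S n).Pi y σ) r z - M.Pi y σ r z) (hpc.sub hcont).measurable
      (fun j => ε n * ((w y)⁻¹ ^ 2 * c j))
      (fun j => mul_nonneg (hε n) (mul_nonneg (sq_nonneg _) (hc j))) (fun z _ => by
        refine (hn z).trans ?_
        have h1 := hw.inv_le y z
        have h2 : ws (z - y) = ws (y - z) := by rw [← hws, neg_sub]
        rw [h2, scaledSize_sub_comm z y]
        have hS : 0 ≤ ∑ j, c j * scaledSize s (y - z) ^ m j := Finset.sum_nonneg fun j _ =>
          mul_nonneg (hc j) (Real.rpow_nonneg (scaledSize_nonneg _) _)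
        have hwst : 0 ≤ ws (y - z) := zero_le_one.trans (hw.one_le_star _)
        have h3 : 0 ≤ (w y)⁻¹ * ws (y - z) * ∑ j, c j * scaledSize s (y - z) ^ m j := by
          positivity
        -- Moving the weight from z to y adds a second factor w^*, so the error grows like (w^*)²
        -- and has to be integrated with a control function that dominates this square.
        calc _ ≤ ε n * ((ws (y - z) * (w y)⁻¹) * ((w y)⁻¹ * ws (y - z) *
              ∑ j, c j * scaledSize s (y - z) ^ m j)) :=
              mul_le_mul_of_nonneg_left (mul_le_mul_of_nonneg_right h1 h3) (hε n)
          _ = ws (y - z) ^ 2 * (ε n * (w y)⁻¹ ^ 2 * ∑ j, c j * scaledSize s (y - z) ^ m j) := by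
              ring
          _ ≤ us (y - z) * (ε n * (w y)⁻¹ ^ 2 * ∑ j, c j * scaledSize s (y - z) ^ m j) :=
              mul_le_mul_of_nonneg_right (hus _)
                (mul_nonneg (mul_nonneg (hε n) (sq_nonneg _)) hS)
          _ = _ := by
              congr 1
              rw [Finset.mul_sum]
              refine Finset.sum_congr rfl fun j _ => ?_
              rw [neg_zero, Real.rpow_zero]
              ring)
    have hi2 : Integrable fun z => Q ((t : ℝ) - r) y z * M.Pi y σ r z := by
      refine ((hi1 y).1.sub hi).congr (Eventually.of_forall fun z => ?_)
      simp only [Pi.sub_apply]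
      change Q ((t : ℝ) - r) y z * profile Q ((S n).Pi y σ) r z - _ = _
      ring
    have heq : profile Q ((S n).Pi y σ) t y - kernelOp Q ((t : ℝ) - r) (M.Pi y σ r) y =
        ∫ z, Q ((t : ℝ) - r) y z * (profile Q ((S n).Pi y σ) r z - M.Pi y σ r z) := by
      change kernelOp Q t ((S n).Pi y σ) y - _ = _
      rw [← hsg]
      change (∫ z, Q ((t : ℝ) - r) y z * kernelOp Q r ((S n).Pi y σ) z) -
        ∫ z, Q ((t : ℝ) - r) y z * M.Pi y σ r z = _
      rw [← integral_sub (hi1 y).1 hi2]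
      simp only [mul_sub]
      rfl
    refine ⟨hi2, ?_⟩
    rw [heq]
    refine (abs_integral_le_integral_abs.trans hI).trans (le_of_eq ?_)
    rw [hB, mul_left_comm]
    congr 1
    rw [Finset.mul_sum]
    exact Finset.sum_congr rfl fun j _ => by ring
  have hlim1 : Tendsto (fun n => profile Q ((S n).Pi y σ) t y) atTop
      (𝓝 (kernelOp Q ((t : ℝ) - r) (M.Pi y σ r) y)) := by
    rw [tendsto_iff_dist_tendsto_zero]
    have h0 : Tendsto (fun n => ε n * B) atTop (𝓝 0) := by simpa using hε0.mul_const B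
    exact squeeze_zero' (Eventually.of_forall fun n => dist_nonneg)
      (hdiff.mono fun _ hn => hn.2) h0
  have hlim2 : Tendsto (fun n => profile Q ((S n).Pi y σ) t y) atTop (𝓝 (M.Pi y σ t y)) := by
    rw [tendsto_iff_dist_tendsto_zero]
    have h0 : Tendsto (fun n => ε' n * ((w y)⁻¹ * ((w y)⁻¹ * ws (y - y) *
        ∑ j, c' j * scaledSize s (y - y) ^ m' j))) atTop (𝓝 0) := by
      simpa using hε0'.mul_const ((w y)⁻¹ * ((w y)⁻¹ * ws (y - y) *
        ∑ j, c' j * scaledSize s (y - y) ^ m' j))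
    refine squeeze_zero' (Eventually.of_forall fun n => dist_nonneg) ?_ h0
    filter_upwards [hb'] with n hn
    exact hn y
  exact ⟨hdiff.exists.choose_spec.1, tendsto_nhds_unique hlim1 hlim2⟩

/-- In the lowest homogeneity, when it is negative, the model is little-o of its natural size. -/
theorem RSModel.exists_lowest_le (M : RSModel s ℓ Q 𝒯 w ws) (hreg : 𝒯.reg < 0) (α : 𝒯.A)
    (hα : (α : ℝ) = 𝒯.reg) {ε : ℝ} (hε : 0 < ε) :
    ∃ δ : ℝ, 0 < δ ∧ ∀ (t : Set.Ioc (0 : ℝ) 1), (t : ℝ) ≤ δ → ∀ (x : Fin d → ℝ) (τ : 𝒯.T α),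
      |M.Pi x (𝒯.of α τ) t x| ≤ ε * (t : ℝ) ^ ((α : ℝ) / ℓ) * (w x)⁻¹ * ‖τ‖ := by
  have hMlin := M.piLinear hs hℓ hG0 hQ hw
  obtain ⟨S, hP, -, -, -⟩ := M.exists_approx
  obtain ⟨n, hn⟩ := (ENNReal.tendsto_nhds_zero.1 (hP ((α : ℝ) + 1)) (ENNReal.ofReal (ε / 2))
    (ENNReal.ofReal_pos.2 (half_pos hε))).exists
  have hSlin := (S n).piLinear hs hℓ hG0 hQ hw
  -- One smooth approximation is fixed, within ε/2 of the model; the level α + 1 only serves to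
  -- include α itself.
  have hDb := PiBound.of_piNorm (γ := (α : ℝ) + 1) hw.pos (hSlin.sub hMlin) (half_pos hε).le hn
  -- Γ acts trivially in the lowest homogeneity, so Π_x τ is a single function in C(w). Its image
  -- under Q_t is bounded by a multiple of w⁻¹ uniformly in t, which is little-o of t^{α/ℓ} since α
  -- < 0.
  have hconst : ∀ x (τ : 𝒯.T α), (S n).Pi x (𝒯.of α τ) = (S n).Pi 0 (𝒯.of α τ) := by
    intro x τ
    have hid : (S n).Gamma 0 x (𝒯.of α τ) = 𝒯.of α τ := by
      refine DFinsupp.ext fun β => ?_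
      have hβ : (α : ℝ) ≤ β := hα ▸ 𝒯.isLeast_reg.2 β.2
      have := (S n).isTriangular.upper 0 x α β τ hβ
      rwa [one_smul] at this
    rw [← (S n).pi_gamma 0 x, hid]
  obtain ⟨K, hK⟩ := (S n).pi_bounded 0 α
  obtain ⟨C, hC, hint⟩ := IsGTypeSemigroup.integral_weighted_le hs hℓ hG0 hQ hw
    (fun _ : Unit => 0) (fun _ => le_rfl) (fun _ => lt_of_lt_of_le one_pos (hs 0))
  have hSb : ∀ (t : Set.Ioc (0 : ℝ) 1) x (τ : 𝒯.T α),
      |profile Q ((S n).Pi x (𝒯.of α τ)) t x| ≤ C * (K * ‖τ‖) * (w x)⁻¹ := by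
    intro t x τ
    rw [hconst]
    have hKτ : 0 ≤ (K : ℝ) * ‖τ‖ := by positivity
    have hb := abs_le_of_weightedSup_le hw hKτ (f := (S n).Pi 0 (𝒯.of α τ)) (by
      rw [ENNReal.ofReal_mul K.coe_nonneg, ENNReal.ofReal_coe_nnreal]
      exact hK τ)
    obtain ⟨-, h2, -⟩ := hint t t.2.1 (t.2.2.trans one_le_two) x _
      ((S n).pi_mem 0 (𝒯.of α τ)).1.measurable (fun _ => K * ‖τ‖) (fun _ => hKτ)
      (fun y _ => by simpa [mul_comm] using hb y)
    refine (abs_integral_le_integral_abs.trans h2).trans (le_of_eq ?_)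
    simp only [Finset.univ_unique, Finset.sum_const, Finset.card_singleton, one_smul, neg_zero,
      zero_div, Real.rpow_zero, mul_one]
    ring
  have hexp : 0 < -(α : ℝ) / ℓ := div_pos (by rw [hα]; linarith) hℓ
  have hlim : Tendsto (fun r : ℝ => C * K * r ^ (-(α : ℝ) / ℓ)) (𝓝 0) (𝓝 0) := by
    have h1 : Tendsto (fun r : ℝ => r ^ (-(α : ℝ) / ℓ)) (𝓝 0) (𝓝 (0 ^ (-(α : ℝ) / ℓ))) :=
      (continuousAt_id.rpow_const (Or.inr hexp.le)).tendsto
    rw [Real.zero_rpow hexp.ne'] at h1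
    simpa using h1.const_mul (C * (K : ℝ))
  obtain ⟨δ, hδ, hδb⟩ := Metric.eventually_nhds_iff.1 (hlim.eventually_lt_const (half_pos hε))
  refine ⟨δ / 2, half_pos hδ, fun t ht x τ => ?_⟩
  have h1 := hDb ⟨α, lt_add_one _⟩ τ t x
  have h2 := hSb t x τ
  have h3 : C * K * (t : ℝ) ^ (-(α : ℝ) / ℓ) < ε / 2 := hδb (by
    rw [Real.dist_eq, sub_zero, abs_of_pos t.2.1]; linarith)
  have h4 : (t : ℝ) ^ (-(α : ℝ) / ℓ) * (t : ℝ) ^ ((α : ℝ) / ℓ) = 1 := by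
    rw [← Real.rpow_add t.2.1]; simp [neg_div]
  have htp : 0 ≤ (t : ℝ) ^ ((α : ℝ) / ℓ) := Real.rpow_nonneg t.2.1.le _
  have h5 : C * K ≤ ε / 2 * (t : ℝ) ^ ((α : ℝ) / ℓ) := by
    calc C * K = (C * K * (t : ℝ) ^ (-(α : ℝ) / ℓ)) * (t : ℝ) ^ ((α : ℝ) / ℓ) := by
          rw [mul_assoc (C * (K : ℝ)), h4, mul_one]
      _ ≤ _ := mul_le_mul_of_nonneg_right h3.le htp
  have h6 : 0 ≤ ‖τ‖ * (w x)⁻¹ := mul_nonneg (norm_nonneg _) (inv_nonneg.2 (hw.pos x).le)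
  have h7 := mul_le_mul_of_nonneg_right h5 h6
  have h8 := abs_sub_abs_le_abs_sub (M.Pi x (𝒯.of α τ) t x) (profile Q ((S n).Pi x (𝒯.of α τ)) t x)
  rw [abs_sub_comm] at h8
  simp only [Pi.sub_apply] at h1
  linarith

end Model

end

noncomputable section

/-! ## The germ of a singular modelled distribution -/

section ModelledDistribution

variable {d : ℕ} [NeZero d] {s : Fin d → ℝ} {ℓ : ℝ} {𝒯 : RegularityStructure}
  {w ws v vs : (Fin d → ℝ) → ℝ} {γ η : ℝ}

/-- The germ `Q_t(z, Π_y f(y))`, extended by zero. -/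
def modelGerm (P : (Fin d → ℝ) → 𝒯.Space → Profile d) (f : Punctured d → 𝒯.Space)
    (y : Fin d → ℝ) (t : ℝ) (z : Fin d → ℝ) : ℝ :=
  open Classical in
  if h : (0 < t ∧ t ≤ 1) ∧ y 0 ≠ 0 then P y (f ⟨y, h.2⟩) ⟨t, h.1⟩ z else 0

theorem modelGerm_apply (P : (Fin d → ℝ) → 𝒯.Space → Profile d) (f : Punctured d → 𝒯.Space)
    {y : Fin d → ℝ} (hy : y 0 ≠ 0) {t : ℝ} (ht : 0 < t) (ht1 : t ≤ 1) (z : Fin d → ℝ) :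
    modelGerm P f y t z = P y (f ⟨y, hy⟩) ⟨t, ht, ht1⟩ z := dif_pos ⟨⟨ht, ht1⟩, hy⟩

theorem modelGerm_zero (P : (Fin d → ℝ) → 𝒯.Space → Profile d) (f : Punctured d → 𝒯.Space)
    {y : Fin d → ℝ} (hy : y 0 = 0) (t : ℝ) (z : Fin d → ℝ) :
    modelGerm P f y t z = 0 := dif_neg fun h => h.2 hy

/-- Pointwise form of the bound on `sizeNorm`. -/
def SizeBound (s : Fin d → ℝ) (v : (Fin d → ℝ) → ℝ) (γ η : ℝ) (g : Punctured d → 𝒯.Space)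
    (B : ℝ) : Prop :=
  ∀ (i : 𝒯.Below γ) (x : Punctured d),
    ‖(g x) i.1‖ ≤ B * ((v x)⁻¹ * temporalWeight s x ^ (min (η - i.1) 0))

theorem SizeBound.of_sizeNorm (hv : ∀ x, 0 < v x) {g : Punctured d → 𝒯.Space} {B : ℝ}
    (hB : 0 ≤ B) (h : sizeNorm s 𝒯 v γ η g ≤ ENNReal.ofReal B) : SizeBound s v γ η g B := by
  intro i x
  have h1 : ENNReal.ofReal (v x * ‖(g x) i.1‖ / temporalWeight s x ^ (min (η - i.1) 0)) ≤
      sizeNorm s 𝒯 v γ η g := by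
    unfold sizeNorm
    refine le_trans ?_ (le_iSup₂ (f := fun (α : 𝒯.A) (_ : (α : ℝ) < γ) => _) i.1 i.2)
    exact le_iSup (fun x : Punctured d => ENNReal.ofReal
      (v x * ‖(g x) i.1‖ / temporalWeight s x ^ (min (η - i.1) 0))) x
  have h2 := (ENNReal.ofReal_le_ofReal_iff hB).1 (h1.trans h)
  rw [div_le_iff₀ (Real.rpow_pos_of_pos (temporalWeight_pos x.2) _)] at h2
  have hvx := hv x
  have h3 : ‖(g x) i.1‖ = (v x)⁻¹ * (v x * ‖(g x) i.1‖) := by field_simp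
  rw [h3]
  refine (mul_le_mul_of_nonneg_left h2 (inv_nonneg.2 hvx.le)).trans (le_of_eq (by ring))

/-- The scale of increments `f(z) - Γ_{zy} f(y)` in homogeneity `β`, valid for all `y ≠ z`. -/
def incrementScale (s : Fin d → ℝ) (w ws v vs : (Fin d → ℝ) → ℝ) (γ η : ℝ) (y z : Fin d → ℝ)
    (β : ℝ) : ℝ :=
  (w y)⁻¹ * (v y)⁻¹ * (ws (y - z) * vs (y - z)) *
    (scaledSize s (y - z) ^ (γ - β) *
      min (temporalWeight s y) (temporalWeight s z) ^ (-(γ - min η β)))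

/-- Pointwise bounds on the increments, without restriction on the distance of the points. -/
def IncrementBound (s : Fin d → ℝ) (w ws v vs : (Fin d → ℝ) → ℝ) (γ η : ℝ)
    (D : Punctured d → Punctured d → 𝒯.Space) (E : ℝ) : Prop :=
  ∀ (i : 𝒯.Below γ) (y z : Punctured d), y ≠ z →
    ‖(D z y) i.1‖ ≤ E * incrementScale s w ws v vs γ η y z i.1

/-- The exchange of powers for distant points: ρ is φ(y,z), φ its value at one of them and δ their
distance. The missing power γ - α of the distance is taken from ρ^{γ-α} ≤ δ^{γ-α}, and (η-α) ∧ 0 ≥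
(η∧β) - α because β ≤ α. -/
theorem rpow_mul_rpow_le_of_le {ρ φ δ α β : ℝ} (hρ : 0 < ρ) (hρ1 : ρ ≤ 1) (hρφ : ρ ≤ φ)
    (hρδ : ρ ≤ δ) (hβα : β ≤ α) (hαγ : α ≤ γ) :
    δ ^ (α - β) * φ ^ (min (η - α) 0) ≤ δ ^ (γ - β) * ρ ^ (-(γ - min η β)) := by
  have hδ : 0 < δ := hρ.trans_le hρδ
  have h1 : φ ^ (min (η - α) 0) ≤ ρ ^ (min (η - α) 0) :=
    Real.rpow_le_rpow_of_nonpos hρ hρφ (min_le_right _ _)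
  have h2 : ρ ^ (min (η - α) 0) ≤ ρ ^ (min η β - α) := by
    refine Real.rpow_le_rpow_of_exponent_ge hρ hρ1 (le_min ?_ ?_)
    · linarith [min_le_left η β]
    · linarith [min_le_right η β]
  have h3 : ρ ^ (min η β - α) = ρ ^ (-(γ - min η β)) * ρ ^ (γ - α) := by
    rw [← Real.rpow_add hρ]; congr 1; ring
  have h4 : ρ ^ (γ - α) ≤ δ ^ (γ - α) := Real.rpow_le_rpow hρ.le hρδ (by linarith)
  have h5 : δ ^ (γ - β) = δ ^ (α - β) * δ ^ (γ - α) := by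
    rw [← Real.rpow_add hδ]; congr 1; ring
  have h6 : 0 ≤ ρ ^ (-(γ - min η β)) := Real.rpow_nonneg hρ.le _
  rw [h5, mul_assoc]
  refine mul_le_mul_of_nonneg_left ?_ (Real.rpow_nonneg hδ.le _)
  calc _ ≤ ρ ^ (-(γ - min η β)) * ρ ^ (γ - α) := (h1.trans h2).trans h3.le
    _ ≤ ρ ^ (-(γ - min η β)) * δ ^ (γ - α) := mul_le_mul_of_nonneg_left h4 h6
    _ = _ := mul_comm _ _

variable {G : (Fin d → ℝ) → ℝ}

theorem incrementScale_nonneg (hw : IsGControlled s ℓ G w ws) (hv : IsGControlled s ℓ G v vs)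
    (y z : Fin d → ℝ) (β : ℝ) : 0 ≤ incrementScale s w ws v vs γ η y z β := by
  have h1 := hw.pos y
  have h2 := hv.pos y
  have h3 := zero_le_one.trans (hw.one_le_star (y - z))
  have h4 := zero_le_one.trans (hv.one_le_star (y - z))
  have h5 : 0 ≤ scaledSize s (y - z) ^ (γ - β) := Real.rpow_nonneg (scaledSize_nonneg _) _
  have h6 : 0 ≤ min (temporalWeight s y) (temporalWeight s z) ^ (-(γ - min η β)) :=
    Real.rpow_nonneg (le_min (temporalWeight_nonneg _) (temporalWeight_nonneg _)) _
  unfold incrementScale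
  positivity

theorem norm_le_incrementScale_of_incrementNorm (hw : IsGControlled s ℓ G w ws)
    (hv : IsGControlled s ℓ G v vs) {D : Punctured d → Punctured d → 𝒯.Space} {I : ℝ}
    (hI : 0 ≤ I) (h : incrementNorm s 𝒯 v vs γ η D ≤ ENNReal.ofReal I) (i : 𝒯.Below γ)
    {y z : Punctured d} (hyz : y ≠ z)
    (hclose : scaledSize s ((z : Fin d → ℝ) - y) ≤ min (temporalWeight s y) (temporalWeight s z)) :
    ‖(D z y) i.1‖ ≤ I * incrementScale s w ws v vs γ η y z i.1 := by
  set ρ := min (temporalWeight s (y : Fin d → ℝ)) (temporalWeight s (z : Fin d → ℝ)) with hρ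
  have hρ0 : 0 < ρ := lt_min (temporalWeight_pos y.2) (temporalWeight_pos z.2)
  have hρ1 : ρ ≤ 1 := (min_le_left _ _).trans (temporalWeight_le_one _)
  have hne : (z : Fin d → ℝ) - y ≠ 0 := fun h => hyz (Subtype.ext (sub_eq_zero.1 h).symm)
  have hδ := scaledSize_pos (s := s) hne
  have hvs : 0 < vs ((y : Fin d → ℝ) - z) := lt_of_lt_of_le one_pos (hv.one_le_star _)
  have hws := hw.one_le_star ((y : Fin d → ℝ) - z)
  have h1 : ENNReal.ofReal (v y * ‖(D z y) i.1‖ / (ρ ^ (η - γ) * vs ((y : Fin d → ℝ) - z) *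
      scaledSize s ((z : Fin d → ℝ) - y) ^ (γ - (i.1 : ℝ)))) ≤
      incrementNorm s 𝒯 v vs γ η D := by
    unfold incrementNorm
    refine le_trans ?_ (le_iSup₂ (f := fun (α : 𝒯.A) (_ : (α : ℝ) < γ) => _) i.1 i.2)
    refine le_trans ?_ (le_iSup₂ (f := fun (x : Punctured d) (y : Punctured d) => _) y z)
    exact le_iSup₂ (f := fun (_ : y ≠ z) (_ : scaledSize s ((z : Fin d → ℝ) - y) ≤ ρ) =>
      ENNReal.ofReal (v y * ‖(D z y) i.1‖ / (ρ ^ (η - γ) * vs ((y : Fin d → ℝ) - z) *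
      scaledSize s ((z : Fin d → ℝ) - y) ^ (γ - (i.1 : ℝ))))) hyz hclose
  have h2 := (ENNReal.ofReal_le_ofReal_iff hI).1 (h1.trans h)
  have hρp : 0 < ρ ^ (η - γ) := Real.rpow_pos_of_pos hρ0 _
  have hδp : 0 < scaledSize s ((z : Fin d → ℝ) - y) ^ (γ - (i.1 : ℝ)) :=
    Real.rpow_pos_of_pos hδ _
  rw [div_le_iff₀ (by positivity)] at h2
  have hvy := hv.pos y
  have h3 : ‖(D z y) i.1‖ = (v y)⁻¹ * (v y * ‖(D z y) i.1‖) := by field_simp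
  rw [h3]
  refine (mul_le_mul_of_nonneg_left h2 (inv_nonneg.2 hvy.le)).trans ?_
  unfold incrementScale
  rw [scaledSize_sub_comm (y : Fin d → ℝ) z, ← hρ]
  have h4 : ρ ^ (η - γ) ≤ ρ ^ (-(γ - min η i.1)) :=
    Real.rpow_le_rpow_of_exponent_ge hρ0 hρ1 (by linarith [min_le_left η (i.1 : ℝ)])
  have h5 : 1 ≤ (w y)⁻¹ := (one_le_inv₀ (hw.pos y)).2 (hw.le_one y)
  have h6 : ρ ^ (η - γ) ≤ ((w y)⁻¹ * ws ((y : Fin d → ℝ) - z)) * ρ ^ (-(γ - min η i.1)) :=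
    h4.trans (le_mul_of_one_le_left (hρp.le.trans h4) (one_le_mul_of_one_le_of_one_le h5 hws))
  have h7 : 0 ≤ (v y)⁻¹ * I * vs ((y : Fin d → ℝ) - z) *
      scaledSize s ((z : Fin d → ℝ) - y) ^ (γ - (i.1 : ℝ)) := by positivity
  have h8 := mul_le_mul_of_nonneg_left h6 h7
  linarith

theorem SizeBound.norm_le_incrementScale (hw : IsGControlled s ℓ G w ws)
    (hv : IsGControlled s ℓ G v vs) {g : Punctured d → 𝒯.Space} {B : ℝ} (hB : 0 ≤ B)
    (hg : SizeBound s v γ η g B) (i : 𝒯.Below γ) {y z : Punctured d}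
    (hfar : min (temporalWeight s y) (temporalWeight s z) ≤ scaledSize s ((z : Fin d → ℝ) - y)) :
    ‖(g z) i.1‖ ≤ B * incrementScale s w ws v vs γ η y z i.1 := by
  refine (hg i z).trans (mul_le_mul_of_nonneg_left ?_ hB)
  unfold incrementScale
  rw [scaledSize_sub_comm (y : Fin d → ℝ) z]
  have hρ0 : 0 < min (temporalWeight s (y : Fin d → ℝ)) (temporalWeight s (z : Fin d → ℝ)) :=
    lt_min (temporalWeight_pos y.2) (temporalWeight_pos z.2)
  have hkey := rpow_mul_rpow_le_of_le (γ := γ) (η := η) hρ0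
    ((min_le_left _ _).trans (temporalWeight_le_one _)) (min_le_right _ _) hfar
    (le_refl (i.1 : ℝ)) i.2.le
  rw [sub_self, Real.rpow_zero, one_mul] at hkey
  have h1 := hv.inv_le y z
  have h5 : 1 ≤ (w y)⁻¹ := (one_le_inv₀ (hw.pos y)).2 (hw.le_one y)
  have h6 := one_le_mul_of_one_le_of_one_le h5 (hw.one_le_star ((y : Fin d → ℝ) - z))
  have hvy : 0 ≤ (v y)⁻¹ := inv_nonneg.2 (hv.pos y).le
  have hvs : 0 ≤ vs ((y : Fin d → ℝ) - z) := zero_le_one.trans (hv.one_le_star _)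
  have h7 : (v z)⁻¹ ≤ (w y)⁻¹ * (v y)⁻¹ * (ws ((y : Fin d → ℝ) - z) * vs ((y : Fin d → ℝ) - z)) := by
    refine h1.trans ((le_mul_of_one_le_left (mul_nonneg hvs hvy) h6).trans (le_of_eq (by ring)))
  exact mul_le_mul h7 hkey (Real.rpow_nonneg (temporalWeight_nonneg _) _)
    ((inv_nonneg.2 (hv.pos z).le).trans h7)

theorem GammaBound.norm_le_incrementScale (hw : IsGControlled s ℓ G w ws)
    (hv : IsGControlled s ℓ G v vs) (hws : ∀ x, ws (-x) = ws x)
    {Γ : (Fin d → ℝ) → (Fin d → ℝ) → 𝒯.Space →ₗ[ℝ] 𝒯.Space} {N : ℝ} (hN : 0 ≤ N)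
    (hΓ : GammaBound s w ws γ Γ N) {g : Punctured d → 𝒯.Space} {B : ℝ} (hB : 0 ≤ B)
    (hg : SizeBound s v γ η g B) (hgb : ∀ x, 𝒯.IsBelow γ (g x)) (i : 𝒯.Below γ)
    {y z : Punctured d}
    (hfar : min (temporalWeight s y) (temporalWeight s z) ≤ scaledSize s ((z : Fin d → ℝ) - y)) :
    ‖(Γ z y (g y)) i.1‖ ≤
      (Fintype.card (𝒯.Below γ) * N * B) * incrementScale s w ws v vs γ η y z i.1 := by
  refine (hΓ.norm_apply_le (hgb y) y z i.1).trans ?_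
  have hρ0 : 0 < min (temporalWeight s (y : Fin d → ℝ)) (temporalWeight s (z : Fin d → ℝ)) :=
    lt_min (temporalWeight_pos y.2) (temporalWeight_pos z.2)
  have hwy : 0 ≤ (w y)⁻¹ := inv_nonneg.2 (hw.pos y).le
  have hvy : 0 ≤ (v y)⁻¹ := inv_nonneg.2 (hv.pos y).le
  have hwsn : 0 ≤ ws ((y : Fin d → ℝ) - z) := zero_le_one.trans (hw.one_le_star _)
  set Y := scaledSize s ((z : Fin d → ℝ) - y) ^ (γ - (i.1 : ℝ)) *
    min (temporalWeight s (y : Fin d → ℝ)) (temporalWeight s (z : Fin d → ℝ)) ^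
      (-(γ - min η (i.1 : ℝ))) with hY
  have hY0 : 0 ≤ Y := mul_nonneg (Real.rpow_nonneg (scaledSize_nonneg _) _)
    (Real.rpow_nonneg hρ0.le _)
  have hterm : ∀ k : 𝒯.Below γ, (if (i.1 : ℝ) ≤ k.1 then
      scaledSize s ((z : Fin d → ℝ) - y) ^ ((k.1 : ℝ) - i.1) else 0) * ‖(g y) k.1‖ ≤
      B * ((v y)⁻¹ * Y) := by
    intro k
    split_ifs with hik
    · have hkey := rpow_mul_rpow_le_of_le (γ := γ) (η := η) hρ0
        ((min_le_left _ _).trans (temporalWeight_le_one _)) (min_le_left _ _) hfar hik k.2.le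
      have h0 : 0 ≤ scaledSize s ((z : Fin d → ℝ) - y) ^ ((k.1 : ℝ) - i.1) :=
        Real.rpow_nonneg (scaledSize_nonneg _) _
      have h1 := mul_le_mul_of_nonneg_left (hg k y) h0
      have h2 := mul_le_mul_of_nonneg_left hkey (mul_nonneg hB hvy)
      linarith
    · rw [zero_mul]
      exact mul_nonneg hB (mul_nonneg hvy hY0)
  have hsum := Finset.sum_le_card_nsmul Finset.univ _ _ fun k _ => hterm k
  rw [nsmul_eq_mul, Finset.card_univ] at hsum
  have hwz : ws ((z : Fin d → ℝ) - y) = ws ((y : Fin d → ℝ) - z) := by rw [← hws, neg_sub]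
  unfold incrementScale
  rw [scaledSize_sub_comm (y : Fin d → ℝ) z, ← hY, hwz]
  have hvs := hv.one_le_star ((y : Fin d → ℝ) - z)
  have h1 := mul_le_mul_of_nonneg_left hsum (mul_nonneg hN (mul_nonneg hwy hwsn))
  have h2 : 0 ≤ N * ((w y)⁻¹ * ws ((y : Fin d → ℝ) - z)) *
      (Fintype.card (𝒯.Below γ) * (B * ((v y)⁻¹ * Y))) := by positivity
  have h3 := mul_le_mul_of_nonneg_left hvs h2
  linarith

/-- The norm of a modelled distribution controls increments only for points closer than φ(y,z), but
the integrals run over all pairs. For the others the two terms of the increment are bounded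
separately by the size of f, with no cancellation. -/
theorem IncrementBound.of_close_of_far (hw : IsGControlled s ℓ G w ws)
    (hv : IsGControlled s ℓ G v vs) {D : Punctured d → Punctured d → 𝒯.Space} {I F : ℝ}
    (hI : 0 ≤ I) (hF : 0 ≤ F) (h : incrementNorm s 𝒯 v vs γ η D ≤ ENNReal.ofReal I)
    (hfar : ∀ (i : 𝒯.Below γ) (y z : Punctured d), y ≠ z →
      min (temporalWeight s y) (temporalWeight s z) ≤ scaledSize s ((z : Fin d → ℝ) - y) →
      ‖(D z y) i.1‖ ≤ F * incrementScale s w ws v vs γ η y z i.1) :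
    IncrementBound s w ws v vs γ η D (I + F) := by
  intro i y z hyz
  have h0 := incrementScale_nonneg (γ := γ) (η := η) hw hv (y : Fin d → ℝ) z i.1
  rw [add_mul]
  rcases le_total (scaledSize s ((z : Fin d → ℝ) - y))
    (min (temporalWeight s (y : Fin d → ℝ)) (temporalWeight s (z : Fin d → ℝ))) with hc | hc
  · exact (norm_le_incrementScale_of_incrementNorm hw hv hI h i hyz hc).trans
      (le_add_of_nonneg_right (mul_nonneg hF h0))
  · exact (hfar i y z hyz hc).trans (le_add_of_nonneg_left (mul_nonneg hI h0))

/-- Increments of a modelled distribution. -/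
theorem IncrementBound.of_increment (hw : IsGControlled s ℓ G w ws)
    (hv : IsGControlled s ℓ G v vs) (hws : ∀ x, ws (-x) = ws x)
    {Γ : (Fin d → ℝ) → (Fin d → ℝ) → 𝒯.Space →ₗ[ℝ] 𝒯.Space} {N : ℝ} (hN : 0 ≤ N)
    (hΓ : GammaBound s w ws γ Γ N) {f : Punctured d → 𝒯.Space} {B I : ℝ} (hB : 0 ≤ B)
    (hI : 0 ≤ I) (hf : SizeBound s v γ η f B) (hfb : ∀ x, 𝒯.IsBelow γ (f x))
    (h : incrementNorm s 𝒯 v vs γ η (increment Γ f) ≤ ENNReal.ofReal I) :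
    IncrementBound s w ws v vs γ η (increment Γ f)
      (I + (B + Fintype.card (𝒯.Below γ) * N * B)) := by
  refine IncrementBound.of_close_of_far hw hv hI (by positivity) h fun i y z _ hfar => ?_
  have h1 := hf.norm_le_incrementScale hw hv hB i hfar
  have h2 := hΓ.norm_le_incrementScale hw hv hws hN hB hf hfb i hfar
  rw [increment, DirectSum.sub_apply, add_mul]
  exact (norm_sub_le _ _).trans (add_le_add h1 h2)

/-- Differences of increments of two modelled distributions. -/
theorem IncrementBound.of_increment_sub (hw : IsGControlled s ℓ G w ws)
    (hv : IsGControlled s ℓ G v vs) (hws : ∀ x, ws (-x) = ws x)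
    {Γ₁ Γ₂ : (Fin d → ℝ) → (Fin d → ℝ) → 𝒯.Space →ₗ[ℝ] 𝒯.Space} {N N' : ℝ} (hN : 0 ≤ N)
    (hN' : 0 ≤ N') (hΓ : GammaBound s w ws γ Γ₂ N)
    (hΓ' : GammaBound s w ws γ (fun x y => Γ₁ x y - Γ₂ x y) N')
    {f₁ f₂ : Punctured d → 𝒯.Space} {B B' I : ℝ} (hB : 0 ≤ B) (hB' : 0 ≤ B')
    (hI : 0 ≤ I) (hf : SizeBound s v γ η f₁ B)
    (hf' : SizeBound s v γ η (fun x => f₁ x - f₂ x) B') (hfb₁ : ∀ x, 𝒯.IsBelow γ (f₁ x))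
    (hfb₂ : ∀ x, 𝒯.IsBelow γ (f₂ x))
    (h : incrementNorm s 𝒯 v vs γ η (fun y x => increment Γ₁ f₁ y x - increment Γ₂ f₂ y x) ≤
      ENNReal.ofReal I) :
    IncrementBound s w ws v vs γ η (fun y x => increment Γ₁ f₁ y x - increment Γ₂ f₂ y x)
      (I + (B' + Fintype.card (𝒯.Below γ) * N * B' + Fintype.card (𝒯.Below γ) * N' * B)) := by
  refine IncrementBound.of_close_of_far hw hv hI (by positivity) h fun i y z _ hfar => ?_
  have h1 := hf'.norm_le_incrementScale hw hv hB' i hfar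
  have h2 := hΓ.norm_le_incrementScale hw hv hws hN hB' hf'
    (fun x => (hfb₁ x).sub (hfb₂ x)) i hfar
  have h3 := hΓ'.norm_le_incrementScale hw hv hws hN' hB hf hfb₁ i hfar
  -- Telescoping, so that every term carries exactly one difference: of the modelled distributions
  -- or of the Γ.
  have heq : increment Γ₁ f₁ z y - increment Γ₂ f₂ z y =
      (f₁ z - f₂ z) - Γ₂ z y (f₁ y - f₂ y) - (Γ₁ z y - Γ₂ z y) (f₁ y) := by
    simp only [increment, map_sub, LinearMap.sub_apply]
    abel
  simp only [heq]
  rw [DirectSum.sub_apply, DirectSum.sub_apply, add_mul, add_mul]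
  exact (norm_sub_le _ _).trans (add_le_add ((norm_sub_le _ _).trans (add_le_add h1 h2)) h3)

theorem PiBound.abs_size_le (hw : IsGControlled s ℓ G w ws) (hv : IsGControlled s ℓ G v vs)
    {P : (Fin d → ℝ) → 𝒯.Space → Profile d} {p : 𝒯.Below γ → ℝ → ℝ}
    (hp : ∀ i t, 0 ≤ p i t) (hP : PiBound ℓ w γ P p) (hlin : PiLinear P)
    {g : Punctured d → 𝒯.Space} {B : ℝ} (hB : 0 ≤ B) (hg : SizeBound s v γ η g B)
    (hgb : ∀ x, 𝒯.IsBelow γ (g x)) (t : Set.Ioc (0 : ℝ) 1) (y : Punctured d) :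
    |P y (g y) t y| ≤ (w y ^ 2 * v y)⁻¹ * ∑ i : 𝒯.Below γ, B * p i t *
      (t : ℝ) ^ ((i.1 : ℝ) / ℓ) * temporalWeight s (y : Fin d → ℝ) ^ (-(i.1 - min η (i.1 : ℝ))) := by
  refine (hP.abs_apply_le hlin (hgb y) t y).trans ?_
  have hwy := hw.pos y
  have hvy := hv.pos y
  rw [Finset.mul_sum, Finset.mul_sum]
  refine Finset.sum_le_sum fun i _ => ?_
  have hti : 0 ≤ p i t * (t : ℝ) ^ ((i.1 : ℝ) / ℓ) :=
    mul_nonneg (hp i t) (Real.rpow_nonneg t.2.1.le _)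
  have h1 := mul_le_mul_of_nonneg_left (hg i y) hti
  have hexp : -((i.1 : ℝ) - min η (i.1 : ℝ)) = min (η - i.1) 0 := by
    rw [neg_sub, ← min_sub_sub_right, sub_self]
  rw [hexp]
  -- Only one factor w⁻¹ is needed on the diagonal; the second is given away so that size and
  -- coherence share the weight w²v.
  have hwinv : (w y)⁻¹ ≤ (w y ^ 2)⁻¹ := by
    refine inv_anti₀ (by positivity) ?_
    have := hw.le_one y
    nlinarith
  have hφ : 0 ≤ temporalWeight s (y : Fin d → ℝ) ^ (min (η - (i.1 : ℝ)) 0) :=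
    Real.rpow_nonneg (temporalWeight_nonneg _) _
  have h2 := mul_le_mul_of_nonneg_left h1 (inv_nonneg.2 hwy.le)
  refine h2.trans ?_
  have h3 : 0 ≤ (v y)⁻¹ * (B * (p i t * (t : ℝ) ^ ((i.1 : ℝ) / ℓ)) *
      temporalWeight s (y : Fin d → ℝ) ^ (min (η - (i.1 : ℝ)) 0)) := by positivity
  have h4 := mul_le_mul_of_nonneg_right hwinv h3
  rw [mul_inv]
  linarith

theorem PiBound.abs_increment_le (hw : IsGControlled s ℓ G w ws)
    {P : (Fin d → ℝ) → 𝒯.Space → Profile d} {p : 𝒯.Below γ → ℝ → ℝ}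
    (hp : ∀ i t, 0 ≤ p i t) (hP : PiBound ℓ w γ P p) (hlin : PiLinear P)
    {D : Punctured d → Punctured d → 𝒯.Space} {E : ℝ}
    (hD : IncrementBound s w ws v vs γ η D E)
    (hDb : ∀ y z, 𝒯.IsBelow γ (D z y)) (t : Set.Ioc (0 : ℝ) 1) {y z : Punctured d} (hyz : y ≠ z) :
    |P z (D z y) t z| ≤ (w y ^ 2 * v y)⁻¹ * (ws ((y : Fin d → ℝ) - z) ^ 2 *
      vs ((y : Fin d → ℝ) - z)) * ∑ i : 𝒯.Below γ, E * p i t * (t : ℝ) ^ ((i.1 : ℝ) / ℓ) *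
      (scaledSize s ((y : Fin d → ℝ) - z) ^ (γ - (i.1 : ℝ)) *
        min (temporalWeight s (y : Fin d → ℝ)) (temporalWeight s (z : Fin d → ℝ)) ^
          (-(γ - min η (i.1 : ℝ)))) := by
  refine (hP.abs_apply_le hlin (hDb y z) t z).trans ?_
  have hS : 0 ≤ ∑ i : 𝒯.Below γ, p i t * (t : ℝ) ^ ((i.1 : ℝ) / ℓ) * ‖(D z y) i.1‖ :=
    Finset.sum_nonneg fun i _ => mul_nonneg
      (mul_nonneg (hp i t) (Real.rpow_nonneg t.2.1.le _)) (norm_nonneg _)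
  refine (mul_le_mul_of_nonneg_right (hw.inv_le y z) hS).trans ?_
  have hwy := hw.pos y
  have hws : 0 ≤ ws ((y : Fin d → ℝ) - z) := zero_le_one.trans (hw.one_le_star _)
  rw [Finset.mul_sum, Finset.mul_sum]
  refine Finset.sum_le_sum fun i _ => ?_
  have hti : 0 ≤ (ws ((y : Fin d → ℝ) - z) * (w y)⁻¹) * (p i t * (t : ℝ) ^ ((i.1 : ℝ) / ℓ)) :=
    mul_nonneg (by positivity) (mul_nonneg (hp i t) (Real.rpow_nonneg t.2.1.le _))
  have h1 := mul_le_mul_of_nonneg_left (hD i y z hyz) hti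
  rw [mul_assoc] at h1
  refine h1.trans (le_of_eq ?_)
  unfold incrementScale
  rw [mul_inv, ← inv_pow]
  ring

variable {Q : ℝ → (Fin d → ℝ) → (Fin d → ℝ) → ℝ}
variable (hs : ∀ i, 1 ≤ s i) (hℓ : 0 < ℓ) (hG0 : ∀ x, 0 ≤ G x)
  (hQ : IsGTypeSemigroup s ℓ G Q) (hw : IsGControlled s ℓ G w ws)
  (hv : IsGControlled s ℓ G v vs)
  (hwwv : IsGControlled s ℓ G (fun x => w x ^ 2 * v x) (fun x => ws x ^ 2 * vs x))
  (hws : ∀ x, ws (-x) = ws x)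
include hs hℓ hG0 hQ hw hv hwwv hws

omit hv in
theorem RSModel.modelGerm_semigroup (hvs : ∀ x, 1 ≤ vs x) (M : RSModel s ℓ Q 𝒯 w ws)
    (f : Punctured d → 𝒯.Space)
    (y : Fin d → ℝ) (hy : y 0 ≠ 0) (r t : ℝ) (hr : 0 < r) (hrt : r < t) (ht1 : t ≤ 1) :
    Continuous (modelGerm M.Pi f y r) ∧
    Integrable (fun z => Q (t - r) y z * modelGerm M.Pi f y r z) ∧
    kernelOp Q (t - r) (modelGerm M.Pi f y r) y = modelGerm M.Pi f y t y := by
  have h1 : modelGerm M.Pi f y r = M.Pi y (f ⟨y, hy⟩) ⟨r, hr, hrt.le.trans ht1⟩ := by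
    funext z
    exact modelGerm_apply _ _ hy hr (hrt.le.trans ht1) z
  rw [h1, modelGerm_apply _ _ hy (hr.trans hrt) ht1]
  refine ⟨M.pi_continuous hs hℓ hG0 hQ hw _ _ _, ?_⟩
  exact M.kernelOp_pi hs hℓ hG0 hQ hw hwwv
    (fun x => le_mul_of_one_le_right (sq_nonneg _) (hvs x)) hws y (f ⟨y, hy⟩)
    ⟨r, hr, hrt.le.trans ht1⟩ ⟨t, hr.trans hrt, ht1⟩ hrt

theorem RSModel.coherentGerm (M : RSModel s ℓ Q 𝒯 w ws) {p : 𝒯.Below γ → ℝ → ℝ}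
    (hp : ∀ i t, 0 ≤ p i t) (hpm : ∀ i, Monotone (p i)) (hP : PiBound ℓ w γ M.Pi p)
    {f : Punctured d → 𝒯.Space} {B E : ℝ} (hB : 0 ≤ B) (hE : 0 ≤ E)
    (hf : SizeBound s v γ η f B) (hfb : ∀ x, 𝒯.IsBelow γ (f x))
    (hD : IncrementBound s w ws v vs γ η (increment M.Gamma f) E) :
    CoherentGerm s ℓ Q (fun x => w x ^ 2 * v x) (fun x => ws x ^ 2 * vs x) γ
      (fun i : 𝒯.Below γ => (i.1 : ℝ)) (fun i => min η i.1) (modelGerm M.Pi f)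
      (fun i t => (B + E) * p i t) := by
  have hlin := M.piLinear hs hℓ hG0 hQ hw
  refine ⟨fun i t => mul_nonneg (by positivity) (hp i t),
    fun i => (hpm i).const_mul (by positivity), fun y t hy => modelGerm_zero _ _ hy _ _,
    fun y hy t ht ht1 => ?_, fun y hy r t hr hrt ht1 =>
      (M.modelGerm_semigroup hs hℓ hG0 hQ hw hwwv hws hv.one_le_star f y hy r t hr hrt ht1).2.2,
    fun t ht ht1 y hy => ?_, fun t ht ht1 y z hy hz => ?_⟩
  · have h1 : modelGerm M.Pi f y t = M.Pi y (f ⟨y, hy⟩) ⟨t, ht, ht1⟩ := by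
      funext z
      exact modelGerm_apply _ _ hy ht ht1 z
    rw [h1]
    exact M.pi_continuous hs hℓ hG0 hQ hw _ _ _
  · rw [modelGerm_apply _ _ hy ht ht1]
    refine (hP.abs_size_le hw hv hp hlin hB hf hfb ⟨t, ht, ht1⟩ ⟨y, hy⟩).trans
      (mul_le_mul_of_nonneg_left ?_ (inv_nonneg.2 (hwwv.pos y).le))
    refine Finset.sum_le_sum fun i _ => mul_le_mul_of_nonneg_right
      (mul_le_mul_of_nonneg_right (mul_le_mul_of_nonneg_right (by linarith) (hp i t))
        (Real.rpow_nonneg ht.le _)) (Real.rpow_nonneg (temporalWeight_nonneg y) _)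
  · have hWs : 0 ≤ ws (y - z) ^ 2 * vs (y - z) := zero_le_one.trans (hwwv.one_le_star (y - z))
    have hmono : ∀ c : ℝ, 0 ≤ c → c ≤ B + E →
        (w y ^ 2 * v y)⁻¹ * (ws (y - z) ^ 2 * vs (y - z)) * ∑ i : 𝒯.Below γ, c * p i t *
          t ^ ((i.1 : ℝ) / ℓ) * (scaledSize s (y - z) ^ (γ - (i.1 : ℝ)) *
          min (temporalWeight s y) (temporalWeight s z) ^ (-(γ - min η (i.1 : ℝ)))) ≤
        (w y ^ 2 * v y)⁻¹ * (ws (y - z) ^ 2 * vs (y - z)) * ∑ i : 𝒯.Below γ, (B + E) * p i t *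
          t ^ ((i.1 : ℝ) / ℓ) * (scaledSize s (y - z) ^ (γ - (i.1 : ℝ)) *
          min (temporalWeight s y) (temporalWeight s z) ^ (-(γ - min η (i.1 : ℝ)))) := by
      intro c _ hc
      refine mul_le_mul_of_nonneg_left ?_ (mul_nonneg (inv_nonneg.2 (hwwv.pos y).le) hWs)
      refine Finset.sum_le_sum fun i _ => mul_le_mul_of_nonneg_right
        (mul_le_mul_of_nonneg_right (mul_le_mul_of_nonneg_right hc (hp i t))
          (Real.rpow_nonneg ht.le _)) (mul_nonneg (Real.rpow_nonneg (scaledSize_nonneg _) _)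
          (Real.rpow_nonneg (le_min (temporalWeight_nonneg _) (temporalWeight_nonneg _)) _))
    by_cases hyz : y = z
    · subst hyz
      rw [sub_self, abs_zero]
      refine le_trans ?_ (hmono 0 le_rfl (by positivity))
      simp
    · rw [modelGerm_apply _ _ hy ht ht1, modelGerm_apply _ _ hz ht ht1,
        ← M.pi_gamma hs hℓ hG0 hQ hw y z, ← hlin.map_sub, ← abs_neg]
      -- After recentring at z, a change of base point is Π_z applied to an increment of f,
      -- evaluated at its own base point, where the model bound applies.
      have hneg : -M.Pi z (M.Gamma z y (f ⟨y, hy⟩) - f ⟨z, hz⟩) ⟨t, ht, ht1⟩ z =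
          M.Pi z (increment M.Gamma f ⟨z, hz⟩ ⟨y, hy⟩) ⟨t, ht, ht1⟩ z := by
        rw [increment, hlin.map_sub, hlin.map_sub, neg_sub]
      rw [hneg]
      refine (hP.abs_increment_le hw hp hlin hD (fun y z => (hfb z).sub
        (M.isTriangular.isBelow (hfb y) y z)) ⟨t, ht, ht1⟩ (y := ⟨y, hy⟩) (z := ⟨z, hz⟩)
        (fun h => hyz (congrArg Subtype.val h))).trans (hmono E hE (by linarith))

/-- The difference of the germs of two modelled distributions. -/
theorem RSModel.coherentGerm_sub (M₁ M₂ : RSModel s ℓ Q 𝒯 w ws) {K K' : ℝ}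
    (hK : 0 ≤ K) (hK' : 0 ≤ K') (hP : PiBound ℓ w γ M₂.Pi fun _ _ => K)
    (hP' : PiBound ℓ w γ (fun x τ => M₁.Pi x τ - M₂.Pi x τ) fun _ _ => K')
    {f₁ f₂ : Punctured d → 𝒯.Space} {B E B' E' : ℝ} (hB : 0 ≤ B) (hE : 0 ≤ E) (hB' : 0 ≤ B')
    (hE' : 0 ≤ E') (hf : SizeBound s v γ η f₁ B)
    (hf' : SizeBound s v γ η (fun x => f₁ x - f₂ x) B')
    (hfb₁ : ∀ x, 𝒯.IsBelow γ (f₁ x)) (hfb₂ : ∀ x, 𝒯.IsBelow γ (f₂ x))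
    (hD : IncrementBound s w ws v vs γ η (increment M₁.Gamma f₁) E)
    (hD' : IncrementBound s w ws v vs γ η
      (fun y x => increment M₁.Gamma f₁ y x - increment M₂.Gamma f₂ y x) E') :
    CoherentGerm s ℓ Q (fun x => w x ^ 2 * v x) (fun x => ws x ^ 2 * vs x) γ
      (fun i : 𝒯.Below γ => (i.1 : ℝ)) (fun i => min η i.1)
      (fun y t z => modelGerm M₁.Pi f₁ y t z - modelGerm M₂.Pi f₂ y t z)
      (fun _ _ => K' * (B + E) + K * (B' + E')) := by
  have hlin₁ := M₁.piLinear hs hℓ hG0 hQ hw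
  have hlin₂ := M₂.piLinear hs hℓ hG0 hQ hw
  have hsg₁ := M₁.modelGerm_semigroup hs hℓ hG0 hQ hw hwwv hws hv.one_le_star f₁
  have hsg₂ := M₂.modelGerm_semigroup hs hℓ hG0 hQ hw hwwv hws hv.one_le_star f₂
  have hsum : ∀ (c : ℝ) (b e : ℝ) (X Y : 𝒯.Below γ → ℝ), 0 ≤ c → (∀ i, 0 ≤ X i) →
      (∀ i, 0 ≤ Y i) → b * K' + e * K ≤ K' * (B + E) + K * (B' + E') →
      c * (∑ i, b * K' * X i * Y i) + c * (∑ i, e * K * X i * Y i) ≤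
        c * ∑ i, (K' * (B + E) + K * (B' + E')) * X i * Y i := by
    intro c b e X Y hc hX hY h
    rw [← mul_add, ← Finset.sum_add_distrib]
    refine mul_le_mul_of_nonneg_left (Finset.sum_le_sum fun i _ => ?_) hc
    rw [← add_mul, ← add_mul]
    exact mul_le_mul_of_nonneg_right (mul_le_mul_of_nonneg_right h (hX i)) (hY i)
  have hle₁ : B * K' + B' * K ≤ K' * (B + E) + K * (B' + E') := by
    nlinarith [mul_nonneg hK' hE, mul_nonneg hK hE']
  have hle₂ : E * K' + E' * K ≤ K' * (B + E) + K * (B' + E') := by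
    nlinarith [mul_nonneg hK' hB, mul_nonneg hK hB']
  refine ⟨fun i t => by positivity, fun i => monotone_const, fun y t hy => ?_,
    fun y hy t ht ht1 => ?_, fun y hy r t hr hrt ht1 => ?_,
    fun t ht ht1 y hy => ?_, fun t ht ht1 y z hy hz => ?_⟩
  · rw [modelGerm_zero _ _ hy, modelGerm_zero _ _ hy, sub_zero]
  · have hcont : ∀ (M : RSModel s ℓ Q 𝒯 w ws) (f : Punctured d → 𝒯.Space),
        Continuous (modelGerm M.Pi f y t) := fun M f => by
      have h1 : modelGerm M.Pi f y t = M.Pi y (f ⟨y, hy⟩) ⟨t, ht, ht1⟩ := by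
        funext z
        exact modelGerm_apply _ _ hy ht ht1 z
      rw [h1]
      exact M.pi_continuous hs hℓ hG0 hQ hw _ _ _
    exact (hcont M₁ f₁).sub (hcont M₂ f₂)
  · obtain ⟨-, i₁, e₁⟩ := hsg₁ y hy r t hr hrt ht1
    obtain ⟨-, i₂, e₂⟩ := hsg₂ y hy r t hr hrt ht1
    rw [← e₁, ← e₂]
    unfold kernelOp
    rw [← integral_sub i₁ i₂]
    simp only [mul_sub]
  · rw [modelGerm_apply _ _ hy ht ht1, modelGerm_apply _ _ hy ht ht1]
    -- Π¹f¹ - Π²f² = (Π¹-Π²)f¹ + Π²(f¹-f²); the same splitting is used for the increments below.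
    have heq : M₁.Pi y (f₁ ⟨y, hy⟩) ⟨t, ht, ht1⟩ y - M₂.Pi y (f₂ ⟨y, hy⟩) ⟨t, ht, ht1⟩ y =
        (M₁.Pi y (f₁ ⟨y, hy⟩) - M₂.Pi y (f₁ ⟨y, hy⟩)) ⟨t, ht, ht1⟩ y +
        M₂.Pi y (f₁ ⟨y, hy⟩ - f₂ ⟨y, hy⟩) ⟨t, ht, ht1⟩ y := by
      rw [hlin₂.map_sub]
      simp only [Pi.sub_apply]
      ring
    rw [heq]
    have h1 := hP'.abs_size_le hw hv (fun _ _ => hK') (hlin₁.sub hlin₂) hB hf hfb₁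
      ⟨t, ht, ht1⟩ ⟨y, hy⟩
    have h2 := hP.abs_size_le hw hv (fun _ _ => hK) hlin₂ hB' hf'
      (fun x => (hfb₁ x).sub (hfb₂ x)) ⟨t, ht, ht1⟩ ⟨y, hy⟩
    refine (abs_add_le _ _).trans ((add_le_add h1 h2).trans ?_)
    exact hsum _ _ _ _ _ (inv_nonneg.2 (hwwv.pos y).le) (fun i => Real.rpow_nonneg ht.le _)
      (fun i => Real.rpow_nonneg (temporalWeight_nonneg y) _) hle₁
  · have hWs : 0 ≤ ws (y - z) ^ 2 * vs (y - z) := zero_le_one.trans (hwwv.one_le_star (y - z))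
    have hc : 0 ≤ (w y ^ 2 * v y)⁻¹ * (ws (y - z) ^ 2 * vs (y - z)) :=
      mul_nonneg (inv_nonneg.2 (hwwv.pos y).le) hWs
    have hY : ∀ i : 𝒯.Below γ, 0 ≤ scaledSize s (y - z) ^ (γ - (i.1 : ℝ)) *
        min (temporalWeight s y) (temporalWeight s z) ^ (-(γ - min η (i.1 : ℝ))) := fun i =>
      mul_nonneg (Real.rpow_nonneg (scaledSize_nonneg _) _)
        (Real.rpow_nonneg (le_min (temporalWeight_nonneg _) (temporalWeight_nonneg _)) _)
    by_cases hyz : y = z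
    · subst hyz
      rw [sub_self, abs_zero]
      exact mul_nonneg hc (Finset.sum_nonneg fun i _ => mul_nonneg
        (mul_nonneg (by positivity) (Real.rpow_nonneg ht.le _)) (hY i))
    · rw [modelGerm_apply _ _ hy ht ht1, modelGerm_apply _ _ hz ht ht1,
        modelGerm_apply _ _ hy ht ht1, modelGerm_apply _ _ hz ht ht1,
        ← M₁.pi_gamma hs hℓ hG0 hQ hw y z, ← M₂.pi_gamma hs hℓ hG0 hQ hw y z]
      have heq : M₁.Pi z (M₁.Gamma z y (f₁ ⟨y, hy⟩)) ⟨t, ht, ht1⟩ z -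
            M₂.Pi z (M₂.Gamma z y (f₂ ⟨y, hy⟩)) ⟨t, ht, ht1⟩ z -
          (M₁.Pi z (f₁ ⟨z, hz⟩) ⟨t, ht, ht1⟩ z - M₂.Pi z (f₂ ⟨z, hz⟩) ⟨t, ht, ht1⟩ z) =
          -((M₁.Pi z (increment M₁.Gamma f₁ ⟨z, hz⟩ ⟨y, hy⟩) -
              M₂.Pi z (increment M₁.Gamma f₁ ⟨z, hz⟩ ⟨y, hy⟩)) ⟨t, ht, ht1⟩ z +
            M₂.Pi z (increment M₁.Gamma f₁ ⟨z, hz⟩ ⟨y, hy⟩ -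
              increment M₂.Gamma f₂ ⟨z, hz⟩ ⟨y, hy⟩) ⟨t, ht, ht1⟩ z) := by
        simp only [increment, hlin₁.map_sub, hlin₂.map_sub, Pi.sub_apply]
        ring
      rw [heq, abs_neg]
      have hb₁ : ∀ y z : Punctured d, 𝒯.IsBelow γ (increment M₁.Gamma f₁ z y) := fun y z =>
        (hfb₁ z).sub (M₁.isTriangular.isBelow (hfb₁ y) y z)
      have hb₂ : ∀ y z : Punctured d, 𝒯.IsBelow γ (increment M₂.Gamma f₂ z y) := fun y z =>
        (hfb₂ z).sub (M₂.isTriangular.isBelow (hfb₂ y) y z)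
      have hne : (⟨y, hy⟩ : Punctured d) ≠ ⟨z, hz⟩ := fun h => hyz (congrArg Subtype.val h)
      have h1 := hP'.abs_increment_le hw (fun _ _ => hK') (hlin₁.sub hlin₂) hD hb₁
        ⟨t, ht, ht1⟩ hne
      have h2 := hP.abs_increment_le hw (fun _ _ => hK) hlin₂ hD'
        (fun y z => (hb₁ y z).sub (hb₂ y z)) ⟨t, ht, ht1⟩ hne
      refine (abs_add_le _ _).trans ((add_le_add h1 h2).trans ?_)
      exact hsum _ _ _ _ _ hc (fun i => Real.rpow_nonneg ht.le _) hY hle₂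

end ModelledDistribution

end

noncomputable section

/-! ## The reconstruction as an element of the Besov spaces -/

section Reconstruction

variable {d : ℕ} [NeZero d] {s : Fin d → ℝ} {ℓ : ℝ} {G : (Fin d → ℝ) → ℝ}
  {Q : ℝ → (Fin d → ℝ) → (Fin d → ℝ) → ℝ} {W Ws : (Fin d → ℝ) → ℝ}
  {γ : ℝ} {ι : Type*} [Fintype ι] {α θ : ι → ℝ}

/-- The reconstruction, restricted to times in `(0, 1]`. -/
def reconstructionProfile (Q : ℝ → (Fin d → ℝ) → (Fin d → ℝ) → ℝ)
    (F : ℝ → (Fin d → ℝ) → ℝ) : Profile d := fun t x => reconstruction Q F t x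

variable (hs : ∀ i, 1 ≤ s i) (hℓ : 0 < ℓ) (hG0 : ∀ x, 0 ≤ G x)
  (hQ : IsGTypeSemigroup s ℓ G Q) (hW : IsGControlled s ℓ G W Ws)
  (hαγ : ∀ i, α i < γ) (hθα : ∀ i, θ i ≤ α i) (hθs : ∀ i, γ - s 0 < θ i) (hγ : 0 < γ)
include hs hℓ hG0 hQ hW hαγ hθα hθs hγ

/-- For t ≤ 1 and φ ≤ 1 the smallest θ_i gives the worst powers, so the sums over homogeneities
collapse at the price of their number. -/
theorem GermBound.exists_abs_reconstruction_le {ζ θ₀ : ℝ} (hθ₀ : ∀ i, θ₀ ≤ θ i) (hζ : ζ ≤ θ₀) :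
    ∃ C : ℝ, 0 < C ∧ ∀ (F : ℝ → (Fin d → ℝ) → ℝ) (κ : ℝ), 0 ≤ κ →
      GermBound s ℓ Q W γ α θ F (fun _ _ => κ) →
      (∀ t, 0 < t → t ≤ 1 → ∀ x, |reconstruction Q F t x| ≤ C * κ * t ^ (ζ / ℓ) * (W x)⁻¹) ∧
      ∀ t, 0 < t → t ≤ 1 → ∀ x, x 0 ≠ 0 → |reconstruction Q F t x - F t x| ≤
        C * κ * t ^ (γ / ℓ) * temporalWeight s x ^ (-(γ - θ₀)) * (W x)⁻¹ := by
  obtain ⟨C, hC, h⟩ := GermBound.exists_reconstruction_le hs hℓ hG0 hQ hW hαγ hθα hθs hγ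
  refine ⟨C * (Fintype.card ι + 1), by positivity, fun F κ hκ hF => ?_⟩
  have hfin : ∀ (x : Fin d → ℝ) (b : ℝ) (g : ι → ℝ), 0 ≤ b → (∀ i, g i ≤ κ * b) →
      C * ((W x)⁻¹ * ∑ i, g i) ≤ C * (Fintype.card ι + 1) * κ * b * (W x)⁻¹ := by
    intro x b g hb hg
    have h1 := Finset.sum_le_card_nsmul Finset.univ g _ fun i _ => hg i
    rw [nsmul_eq_mul, Finset.card_univ] at h1
    have h2 : 0 ≤ C * (W x)⁻¹ := mul_nonneg hC.le (inv_nonneg.2 (hW.pos x).le)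
    have h3 : ∑ i, g i ≤ (Fintype.card ι + 1) * (κ * b) := by nlinarith [mul_nonneg hκ hb]
    have h4 := mul_le_mul_of_nonneg_left h3 h2
    linarith
  refine ⟨fun t ht ht1 x => ?_, fun t ht ht1 x hx => ?_⟩
  · refine ((h F _ hF t ht).1 (ht1.trans one_le_two) x).trans
      (hfin x _ _ (Real.rpow_nonneg ht.le _) fun i => mul_le_mul_of_nonneg_left ?_ hκ)
    exact Real.rpow_le_rpow_of_exponent_ge ht ht1
      (div_le_div_of_nonneg_right (hζ.trans (hθ₀ i)) hℓ.le)
  · have hφ := temporalWeight_pos (s := s) hx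
    have := hfin x (t ^ (γ / ℓ) * temporalWeight s x ^ (-(γ - θ₀)))
      (fun i => κ * t ^ (γ / ℓ) * temporalWeight s x ^ (-(γ - θ i))) (by positivity) fun i => by
        rw [mul_assoc]
        refine mul_le_mul_of_nonneg_left (mul_le_mul_of_nonneg_left ?_
          (Real.rpow_nonneg ht.le _)) hκ
        exact Real.rpow_le_rpow_of_exponent_ge hφ (temporalWeight_le_one x)
          (by linarith [hθ₀ i])
    refine ((h F _ hF t ht).2 ht1 x hx).trans (this.trans (le_of_eq (by ring)))

omit [NeZero d] hs hℓ hG0 hQ hαγ hθα hθs hγ in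
theorem besovNorm_le_ofReal {ζ κ : ℝ} {Λ : Profile d}
    (h : ∀ (t : Set.Ioc (0 : ℝ) 1) x, |Λ t x| ≤ κ * (t : ℝ) ^ (ζ / ℓ) * (W x)⁻¹) :
    besovNorm ℓ ζ W Λ ≤ ENNReal.ofReal κ := by
  refine besovNorm_le fun t x => ?_
  have htp : 0 < (t : ℝ) ^ (ζ / ℓ) := Real.rpow_pos_of_pos t.2.1 _
  have hWx := hW.pos x
  rw [← ENNReal.ofReal_mul (Real.rpow_nonneg t.2.1.le _), neg_div, Real.rpow_neg t.2.1.le]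
  refine ENNReal.ofReal_le_ofReal ?_
  calc ((t : ℝ) ^ (ζ / ℓ))⁻¹ * (W x * |Λ t x|)
      ≤ ((t : ℝ) ^ (ζ / ℓ))⁻¹ * (W x * (κ * (t : ℝ) ^ (ζ / ℓ) * (W x)⁻¹)) := by
        gcongr
        exact h t x
    _ = κ := by field_simp

omit hs hℓ hG0 hQ hαγ hθα hθs hγ in
theorem errorNorm_le_ofReal {θ₀ κ : ℝ} {e : Set.Ioc (0 : ℝ) 1 → Punctured d → ℝ}
    (h : ∀ (t : Set.Ioc (0 : ℝ) 1) (x : Punctured d), |e t x| ≤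
      κ * (t : ℝ) ^ (γ / ℓ) * temporalWeight s (x : Fin d → ℝ) ^ (-(γ - θ₀)) * (W x)⁻¹) :
    errorNorm s ℓ W γ θ₀ e ≤ ENNReal.ofReal κ := by
  refine iSup₂_le fun t x => ENNReal.ofReal_le_ofReal ?_
  have htp : 0 < (t : ℝ) ^ (γ / ℓ) := Real.rpow_pos_of_pos t.2.1 _
  have hφ : 0 < temporalWeight s (x : Fin d → ℝ) ^ (γ - θ₀) :=
    Real.rpow_pos_of_pos (temporalWeight_pos x.2) _
  have hWx := hW.pos (x : Fin d → ℝ)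
  have hx := h t x
  rw [Real.rpow_neg (temporalWeight_nonneg _)] at hx
  rw [neg_div, Real.rpow_neg t.2.1.le]
  calc _ ≤ ((t : ℝ) ^ (γ / ℓ))⁻¹ * temporalWeight s (x : Fin d → ℝ) ^ (γ - θ₀) * W x *
        (κ * (t : ℝ) ^ (γ / ℓ) * (temporalWeight s (x : Fin d → ℝ) ^ (γ - θ₀))⁻¹ * (W x)⁻¹) :=
        mul_le_mul_of_nonneg_left hx (by positivity)
    _ = κ := by field_simp

omit hs hℓ hG0 hQ hαγ hθα hθs hγ in
theorem abs_le_of_errorNorm_le {θ₀ κ : ℝ} {e : Set.Ioc (0 : ℝ) 1 → Punctured d → ℝ} (hκ : 0 ≤ κ)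
    (h : errorNorm s ℓ W γ θ₀ e ≤ ENNReal.ofReal κ) (t : Set.Ioc (0 : ℝ) 1) (x : Punctured d) :
    |e t x| ≤
      κ * (t : ℝ) ^ (γ / ℓ) * temporalWeight s (x : Fin d → ℝ) ^ (-(γ - θ₀)) * (W x)⁻¹ := by
  have h1 := (ENNReal.ofReal_le_ofReal_iff hκ).1
    ((le_iSup₂ (f := fun (t : Set.Ioc (0 : ℝ) 1) (x : Punctured d) =>
      ENNReal.ofReal ((t : ℝ) ^ (-γ / ℓ) * temporalWeight s (x : Fin d → ℝ) ^ (γ - θ₀) * W x *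
        |e t x|)) t x).trans h)
  have htp : 0 < (t : ℝ) ^ (γ / ℓ) := Real.rpow_pos_of_pos t.2.1 _
  have hφ : 0 < temporalWeight s (x : Fin d → ℝ) ^ (γ - θ₀) :=
    Real.rpow_pos_of_pos (temporalWeight_pos x.2) _
  have hWx := hW.pos (x : Fin d → ℝ)
  rw [neg_div, Real.rpow_neg t.2.1.le] at h1
  rw [Real.rpow_neg (temporalWeight_nonneg _)]
  calc |e t x| = (((t : ℝ) ^ (γ / ℓ))⁻¹ * temporalWeight s (x : Fin d → ℝ) ^ (γ - θ₀) * W x *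
        |e t x|) * ((t : ℝ) ^ (γ / ℓ) * (temporalWeight s (x : Fin d → ℝ) ^ (γ - θ₀))⁻¹ *
        (W x)⁻¹) := by field_simp
    _ ≤ κ * ((t : ℝ) ^ (γ / ℓ) * (temporalWeight s (x : Fin d → ℝ) ^ (γ - θ₀))⁻¹ * (W x)⁻¹) :=
        mul_le_mul_of_nonneg_right h1 (by positivity)
    _ = _ := by ring

/-- A criterion for the reconstruction to belong to the completion of order `β`. -/
theorem GermBound.mem_besovCompletion {F : ℝ → (Fin d → ℝ) → ℝ} {p : ι → ℝ → ℝ}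
    (hF : GermBound s ℓ Q W γ α θ F p) {β K e : ℝ} (hβ : β ≤ 0) (hK : 0 ≤ K)
    (hb : ∀ t, 0 < t → t ≤ 1 → ∀ x, |reconstruction Q F t x| ≤ K * t ^ e * (W x)⁻¹)
    (hsmall : ∀ ε : ℝ, 0 < ε → ∃ δ : ℝ, 0 < δ ∧ ∀ t, 0 < t → t ≤ δ → t ≤ 1 → ∀ x,
      t ^ (-β / ℓ) * |reconstruction Q F t x| ≤ ε * (W x)⁻¹) :
    reconstructionProfile Q F ∈ besovCompletion ℓ Q β W :=
  mem_besovCompletion_of_semigroup hs hℓ hG0 hQ hW hβ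
    (fun _ ht ht1 => hF.reconstruction_measurable hs hℓ hG0 hQ hW hαγ hθα hθs hγ ht
      (ht1.trans one_le_two))
    (fun _ _ hr ht hrt x => hF.kernelOp_reconstruction hs hℓ hG0 hQ hW hαγ hθα hθs hγ hr ht hrt x)
    hK hb hsmall

omit [NeZero d] hs hG0 hQ hW hαγ hθα hθs hγ in
theorem exists_forall_mul_rpow_le {a : ℝ} (ha : 0 < a) {K ε : ℝ} (hε : 0 < ε) :
    ∃ δ : ℝ, 0 < δ ∧ ∀ t, 0 < t → t ≤ δ → K * t ^ (a / ℓ) ≤ ε := by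
  have hexp : 0 < a / ℓ := div_pos ha hℓ
  have hlim : Tendsto (fun r : ℝ => K * r ^ (a / ℓ)) (𝓝 0) (𝓝 0) := by
    have h1 : Tendsto (fun r : ℝ => r ^ (a / ℓ)) (𝓝 0) (𝓝 (0 ^ (a / ℓ))) :=
      (continuousAt_id.rpow_const (Or.inr hexp.le)).tendsto
    rw [Real.zero_rpow hexp.ne'] at h1
    simpa using h1.const_mul K
  obtain ⟨δ, hδ, hδb⟩ := Metric.eventually_nhds_iff.1 (hlim.eventually_lt_const hε)
  refine ⟨δ / 2, half_pos hδ, fun t ht htδ => (hδb ?_).le⟩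
  rw [Real.dist_eq, sub_zero, abs_of_pos ht]
  linarith

/-- At order ζ - ε the bound t^{ζ/ℓ} leaves a factor t^{ε/ℓ}, which supplies the smallness at small
times. -/
theorem GermBound.mem_besovSpace {F : ℝ → (Fin d → ℝ) → ℝ} {κ ζ θ₀ : ℝ} (hκ : 0 ≤ κ)
    (hF : GermBound s ℓ Q W γ α θ F fun _ _ => κ) (hθ₀ : ∀ i, θ₀ ≤ θ i) (hζ : ζ ≤ θ₀)
    (hζ0 : ζ ≤ 0) : reconstructionProfile Q F ∈ besovSpace ℓ Q ζ W := by
  obtain ⟨C, hC, h⟩ :=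
    GermBound.exists_abs_reconstruction_le hs hℓ hG0 hQ hW hαγ hθα hθs hγ hθ₀ hζ
  have hb := (h F κ hκ hF).1
  refine ⟨(besovNorm_le_ofReal hW fun t x => hb t t.2.1 t.2.2 x).trans_lt
    ENNReal.ofReal_lt_top, fun ε hε => ?_⟩
  refine hF.mem_besovCompletion hs hℓ hG0 hQ hW hαγ hθα hθs hγ (by linarith)
    (mul_nonneg hC.le hκ) hb fun e he => ?_
  obtain ⟨δ, hδ, hd⟩ := exists_forall_mul_rpow_le hℓ hε (K := C * κ) he
  refine ⟨δ, hδ, fun t ht htδ ht1 x => ?_⟩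
  have h1 := mul_le_mul_of_nonneg_left (hb t ht ht1 x) (Real.rpow_nonneg ht.le (-(ζ - ε) / ℓ))
  refine h1.trans (le_trans (le_of_eq ?_)
    (mul_le_mul_of_nonneg_right (hd t ht htδ) (inv_nonneg.2 (hW.pos x).le)))
  have h2 : t ^ (-(ζ - ε) / ℓ) * t ^ (ζ / ℓ) = t ^ (ε / ℓ) := by
    rw [← Real.rpow_add ht]
    congr 1
    ring
  rw [← h2]
  ring

/-- If all homogeneities are positive, the reconstruction vanishes. -/
theorem GermBound.reconstruction_eq_zero {F : ℝ → (Fin d → ℝ) → ℝ} {κ : ℝ}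
    (hF : GermBound s ℓ Q W γ α θ F fun _ _ => κ) (hα : ∀ i, 0 < α i) {t : ℝ} (ht : 0 < t)
    (ht2 : t ≤ 2) (x : Fin d → ℝ) : reconstruction Q F t x = 0 := by
  obtain ⟨C, hC, h⟩ := GermBound.exists_seq_le hs hℓ hG0 hQ hW hαγ hθα hθs
  have hlim := hF.tendsto_reconstruction hs hℓ hG0 hQ hW hαγ hθα hθs hγ ht ht2 x
  refine tendsto_nhds_unique hlim ?_
  have h2 : Tendsto (fun n : ℕ => (2⁻¹ : ℝ) ^ n) atTop (𝓝 0) :=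
    tendsto_pow_atTop_nhds_zero_of_lt_one (by norm_num) (by norm_num)
  have h0 : Tendsto (fun n : ℕ => C * ((W x)⁻¹ * ∑ i, κ * ((2⁻¹ : ℝ) ^ n) ^ (α i / ℓ) *
      t ^ (-(α i - θ i) / ℓ))) atTop (𝓝 0) := by
    have h3 : Tendsto (fun n : ℕ => ∑ i, κ * ((2⁻¹ : ℝ) ^ n) ^ (α i / ℓ) *
        t ^ (-(α i - θ i) / ℓ)) atTop (𝓝 (∑ i : ι, (0 : ℝ))) := by
      refine tendsto_finsetSum _ fun i _ => ?_
      have hexp := div_pos (hα i) hℓ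
      have h4 := ((h2.rpow_const (Or.inr hexp.le)).const_mul κ).mul_const
        (t ^ (-(α i - θ i) / ℓ))
      rwa [Real.zero_rpow hexp.ne', mul_zero, zero_mul] at h4
    simpa using (h3.const_mul (W x)⁻¹).const_mul C
  refine squeeze_zero_norm' ?_ h0
  filter_upwards [h2.eventually_le_const (half_pos ht)] with n hn
  exact h F _ hF t ht ht2 x n hn

omit [NeZero d] hs hℓ hG0 hQ hW hαγ hθα hθs hγ in
theorem zero_mem_besovCompletion (β : ℝ) :
    (0 : Profile d) ∈ besovCompletion ℓ Q β W := by
  have h0 : ∀ {α : ℝ}, besovNorm ℓ α W (0 : Profile d) = 0 := by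
    intro α
    simp [besovNorm, weightedSup]
  have hp : profile Q (fun _ => 0) = (0 : Profile d) := by
    funext t x
    simp [profile]
  refine ⟨fun _ _ => 0, fun _ => ⟨continuous_const, by simp [weightedSup]⟩, ?_⟩
  simp [hp, h0]

/-- If the coefficients of the germ can be chosen small at small times, the reconstruction belongs
to the completion of order `ζ`. -/
theorem GermBound.mem_besovCompletion_of_small {F : ℝ → (Fin d → ℝ) → ℝ} {κ ζ θ₀ : ℝ}
    (hκ : 0 ≤ κ) (hF : GermBound s ℓ Q W γ α θ F fun _ _ => κ) (hθ₀ : ∀ i, θ₀ ≤ θ i)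
    (hζ : ζ ≤ θ₀) (hζ0 : ζ ≤ 0)
    (hsmall : ∀ ε : ℝ, 0 < ε → ∃ p : ι → ℝ → ℝ, GermBound s ℓ Q W γ α θ F p ∧
      ∃ δ : ℝ, 0 < δ ∧ ∀ i t, 0 < t → t ≤ δ → t ≤ 1 → p i t * t ^ ((θ i - ζ) / ℓ) ≤ ε) :
    reconstructionProfile Q F ∈ besovCompletion ℓ Q ζ W := by
  obtain ⟨C, hC, h⟩ :=
    GermBound.exists_abs_reconstruction_le hs hℓ hG0 hQ hW hαγ hθα hθs hγ hθ₀ hζ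
  obtain ⟨C', hC', h'⟩ := GermBound.exists_reconstruction_le hs hℓ hG0 hQ hW hαγ hθα hθs hγ
  refine hF.mem_besovCompletion hs hℓ hG0 hQ hW hαγ hθα hθs hγ hζ0
    (mul_nonneg hC.le hκ) (h F κ hκ hF).1 fun e he => ?_
  obtain ⟨p, hp, δ, hδ, hd⟩ := hsmall (e / (C' * (Fintype.card ι + 1))) (by positivity)
  refine ⟨δ, hδ, fun t ht htδ ht1 x => ?_⟩
  have h1 := mul_le_mul_of_nonneg_left ((h' F p hp t ht).1 (ht1.trans one_le_two) x)
    (Real.rpow_nonneg ht.le (-ζ / ℓ))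
  refine h1.trans ?_
  have h2 : t ^ (-ζ / ℓ) * ∑ i, p i t * t ^ (θ i / ℓ) ≤ e / C' := by
    rw [Finset.mul_sum]
    have h3 : ∀ i ∈ Finset.univ, t ^ (-ζ / ℓ) * (p i t * t ^ (θ i / ℓ)) ≤
        e / (C' * (Fintype.card ι + 1)) := fun i _ => by
      refine (le_of_eq ?_).trans (hd i t ht htδ ht1)
      rw [mul_left_comm, ← Real.rpow_add ht]
      congr 2
      ring
    have h4 := Finset.sum_le_card_nsmul Finset.univ _ _ h3
    rw [nsmul_eq_mul, Finset.card_univ] at h4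
    refine h4.trans ?_
    rw [mul_div_assoc', div_le_div_iff₀ (by positivity) hC']
    have : 0 ≤ e * C' := by positivity
    nlinarith
  have hWx : 0 ≤ (W x)⁻¹ := inv_nonneg.2 (hW.pos x).le
  have h5 := mul_le_mul_of_nonneg_left h2 (mul_nonneg hC'.le hWx)
  have h6 : C' * (W x)⁻¹ * (e / C') = e * (W x)⁻¹ := by field_simp
  linarith

/-- Linearity of the construction in the germ: the bounds for a single germ, applied to a
difference, become Lipschitz bounds. -/
theorem reconstruction_sub {F₁ F₂ : ℝ → (Fin d → ℝ) → ℝ} {p₁ p₂ p : ι → ℝ → ℝ}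
    (h₁ : GermBound s ℓ Q W γ α θ F₁ p₁) (h₂ : GermBound s ℓ Q W γ α θ F₂ p₂)
    (h : GermBound s ℓ Q W γ α θ (fun t y => F₁ t y - F₂ t y) p) {t : ℝ} (ht : 0 < t)
    (ht2 : t ≤ 2) (x : Fin d → ℝ) :
    reconstruction Q (fun t y => F₁ t y - F₂ t y) t x =
      reconstruction Q F₁ t x - reconstruction Q F₂ t x := by
  have l := h.tendsto_reconstruction hs hℓ hG0 hQ hW hαγ hθα hθs hγ ht ht2 x
  have l₁ := h₁.tendsto_reconstruction hs hℓ hG0 hQ hW hαγ hθα hθs hγ ht ht2 x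
  have l₂ := h₂.tendsto_reconstruction hs hℓ hG0 hQ hW hαγ hθα hθs hγ ht ht2 x
  refine tendsto_nhds_unique l ((l₁.sub l₂).congr' ?_)
  have h2 : Tendsto (fun n : ℕ => (2⁻¹ : ℝ) ^ n) atTop (𝓝 0) :=
    tendsto_pow_atTop_nhds_zero_of_lt_one (by norm_num) (by norm_num)
  filter_upwards [h2.eventually_lt_const ht] with n hn
  exact (kernelOp_sub hs hℓ hG0 hQ hW
    (h₁.dominated hs hW hαγ hθs (inv_two_pow_pos n) (inv_two_pow_le_one n))
    (h₂.dominated hs hW hαγ hθs (inv_two_pow_pos n) (inv_two_pow_le_one n))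
    (sub_pos.2 hn) (by linarith [inv_two_pow_pos n]) x).symm

omit hαγ hθα hθs in
theorem IsReconstruction.unique {𝒯 : RegularityStructure}
    {P : (Fin d → ℝ) → 𝒯.Space → Profile d} {f : Punctured d → 𝒯.Space} {ζ θ₀ : ℝ}
    (hθγ : θ₀ ≤ γ) (hθs : γ - s 0 < θ₀) {Λ Λ' : Profile d}
    (h : IsReconstruction s ℓ Q P ζ γ θ₀ W f Λ) (h' : IsReconstruction s ℓ Q P ζ γ θ₀ W f Λ') :
    Λ = Λ' := by
  -- Only the semigroup property is extracted from the Besov space, so any loss of order will do;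
  -- here it is 1.
  obtain ⟨hd, hsg⟩ := semigroup_of_mem_besovCompletion hs hℓ hG0 hQ hW (h.1.2 1 one_pos)
  obtain ⟨hd', hsg'⟩ := semigroup_of_mem_besovCompletion hs hℓ hG0 hQ hW (h'.1.2 1 one_pos)
  set κ := (errorNorm s ℓ W γ θ₀ (localError P f Λ)).toReal
  set κ' := (errorNorm s ℓ W γ θ₀ (localError P f Λ')).toReal
  have hb := abs_le_of_errorNorm_le hW ENNReal.toReal_nonneg (ENNReal.ofReal_toReal h.2.ne).ge
  have hb' := abs_le_of_errorNorm_le hW ENNReal.toReal_nonneg (ENNReal.ofReal_toReal h'.2.ne).ge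
  classical
  set D : ℝ → (Fin d → ℝ) → ℝ := fun t x =>
    if h : 0 < t ∧ t ≤ 1 then Λ ⟨t, h⟩ x - Λ' ⟨t, h⟩ x else 0 with hD
  have hDt : ∀ (t : ℝ) (ht : 0 < t ∧ t ≤ 1), D t = fun x => Λ ⟨t, ht⟩ x - Λ' ⟨t, ht⟩ x :=
    fun t ht => funext fun x => dif_pos ht
  funext t x
  have := eq_zero_of_semigroup_of_le hs hℓ hG0 hQ hW hγ (a := γ - θ₀) (κ := κ + κ')
    (sub_nonneg.2 hθγ) (by linarith) (add_nonneg ENNReal.toReal_nonneg ENNReal.toReal_nonneg)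
    (D := D) (fun t ht ht1 => ?_) (fun r t hr hrt ht1 x => ?_) (fun t ht ht1 x hx => ?_)
    t.2.1 t.2.2 x
  · rw [hDt t t.2] at this
    exact sub_eq_zero.1 this
  · rw [hDt t ⟨ht, ht1⟩]
    exact (hd ⟨t, ht, ht1⟩).1.sub (hd' ⟨t, ht, ht1⟩).1
  · rw [hDt r ⟨hr, hrt.le.trans ht1⟩, hDt t ⟨hr.trans hrt, ht1⟩,
      kernelOp_sub hs hℓ hG0 hQ hW (hd _) (hd' _) (sub_pos.2 hrt) (by linarith)]
    have e := hsg ⟨r, hr, hrt.le.trans ht1⟩ ⟨t, hr.trans hrt, ht1⟩ hrt x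
    have e' := hsg' ⟨r, hr, hrt.le.trans ht1⟩ ⟨t, hr.trans hrt, ht1⟩ hrt x
    exact congrArg₂ (· - ·) e e'
  · rw [hDt t ⟨ht, ht1⟩]
    have e := hb ⟨t, ht, ht1⟩ ⟨x, hx⟩
    have e' := hb' ⟨t, ht, ht1⟩ ⟨x, hx⟩
    have hsub : Λ ⟨t, ht, ht1⟩ x - Λ' ⟨t, ht, ht1⟩ x =
        localError P f Λ ⟨t, ht, ht1⟩ ⟨x, hx⟩ - localError P f Λ' ⟨t, ht, ht1⟩ ⟨x, hx⟩ := by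
      simp only [localError]
      ring
    simp only [hsub]
    refine (abs_sub _ _).trans ((add_le_add e e').trans (le_of_eq ?_))
    ring

end Reconstruction

end

/-! ### Reconstruction of singular modelled distributions. -/

noncomputable section

section ModelReconstruction

variable {d : ℕ} [NeZero d] {s : Fin d → ℝ} {ℓ : ℝ} {G : (Fin d → ℝ) → ℝ}
  {Q : ℝ → (Fin d → ℝ) → (Fin d → ℝ) → ℝ} {𝒯 : RegularityStructure}
  {w ws v vs : (Fin d → ℝ) → ℝ} {γ η : ℝ}

/-- The values of the germ of a modelled distribution at its base points. -/
def modelDiagonal (P : (Fin d → ℝ) → 𝒯.Space → Profile d) (f : Punctured d → 𝒯.Space)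
    (t : ℝ) (y : Fin d → ℝ) : ℝ := modelGerm P f y t y

theorem GermBound.of_le {W : (Fin d → ℝ) → ℝ} (hW : ∀ x, 0 < W x) {ι : Type*} [Fintype ι]
    {α θ : ι → ℝ} {F : ℝ → (Fin d → ℝ) → ℝ}
    {p p' : ι → ℝ → ℝ} (hF : GermBound s ℓ Q W γ α θ F p) (hle : ∀ i t, p i t ≤ p' i t)
    (hm : ∀ i, Monotone (p' i)) : GermBound s ℓ Q W γ α θ F p' := by
  refine ⟨hF.measurable, fun i t => (hF.nonneg i t).trans (hle i t), hm,
    fun t ht ht1 y hy => (hF.size t ht ht1 y hy).trans ?_,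
    fun t ht ht1 r h1 h2 y hy => (hF.step t ht ht1 r h1 h2 y hy).trans ?_⟩
  all_goals
    refine mul_le_mul_of_nonneg_left (Finset.sum_le_sum fun i _ => ?_) (inv_nonneg.2 (hW y).le)
    exact mul_le_mul_of_nonneg_right (mul_le_mul_of_nonneg_right (hle i t)
      (Real.rpow_nonneg ht.le _)) (Real.rpow_nonneg (temporalWeight_nonneg y) _)

variable (hs : ∀ i, 1 ≤ s i) (hℓ : 0 < ℓ) (hG0 : ∀ x, 0 ≤ G x)
  (hQ : IsGTypeSemigroup s ℓ G Q) (hw : IsGControlled s ℓ G w ws)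
  (hv : IsGControlled s ℓ G v vs)
  (hwwv : IsGControlled s ℓ G (fun x => w x ^ 2 * v x) (fun x => ws x ^ 2 * vs x))
  (hws : ∀ x, ws (-x) = ws x) (hη : γ - s 0 < min η 𝒯.reg)
include hs hℓ hG0 hQ hw hv hwwv hws hη

omit hs hℓ hG0 hQ hw hv hwwv hws in
theorem lt_min_of_below (i : 𝒯.Below γ) : γ - s 0 < min η (i.1 : ℝ) :=
  hη.trans_le (min_le_min_left _ (𝒯.isLeast_reg.2 i.1.2))

theorem RSModel.exists_germBound : ∃ C : ℝ, 0 < C ∧ ∀ (M : RSModel s ℓ Q 𝒯 w ws),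
    ∀ f ∈ singularMD s 𝒯 v vs γ η M.Gamma, ∀ p : 𝒯.Below γ → ℝ → ℝ, (∀ i t, 0 ≤ p i t) →
    (∀ i, Monotone (p i)) → PiBound ℓ w γ M.Pi p →
    GermBound s ℓ Q (fun x => w x ^ 2 * v x) γ (fun i : 𝒯.Below γ => (i.1 : ℝ))
      (fun i => min η i.1) (modelDiagonal M.Pi f)
      (fun i t => C * ((1 + (gammaNorm s 𝒯 w ws γ M.Gamma).toReal) *
        (mdNorm s 𝒯 v vs γ η M.Gamma f).toReal) * p i t) := by
  obtain ⟨C, hC, h⟩ := CoherentGerm.exists_germBound (γ := γ)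
    (α := fun i : 𝒯.Below γ => (i.1 : ℝ)) (θ := fun i => min η i.1) hs hℓ hG0 hQ hwwv
    (fun i => i.2) (fun i => min_le_right _ _) (lt_min_of_below hη)
  refine ⟨C * (3 + Fintype.card (𝒯.Below γ)), by positivity, fun M f hf p hp hpm hP => ?_⟩
  set g := (gammaNorm s 𝒯 w ws γ M.Gamma).toReal
  set m := (mdNorm s 𝒯 v vs γ η M.Gamma f).toReal with hm
  have hg : 0 ≤ g := ENNReal.toReal_nonneg
  have hm0 : 0 ≤ m := ENNReal.toReal_nonneg
  have hmd : mdNorm s 𝒯 v vs γ η M.Gamma f ≤ ENNReal.ofReal m := (ENNReal.ofReal_toReal hf.2.ne).ge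
  have hsize := SizeBound.of_sizeNorm (s := s) hv.pos hm0 (le_self_add.trans hmd)
  have hΓ := GammaBound.of_gammaNorm hw.pos hw.le_one hw.one_le_star zero_le_one M.isTriangular
    hg (ENNReal.ofReal_toReal (M.gammaNorm_lt_top hw γ).ne).ge
  have hinc := IncrementBound.of_increment hw hv hws (by positivity) hΓ hm0 hm0 hsize hf.1
    (le_add_self.trans hmd)
  have hA := h _ _ (M.coherentGerm hs hℓ hG0 hQ hw hv hwwv hws hp hpm hP hm0 (by positivity)
    hsize hf.1 hinc)
  refine hA.of_le hwwv.pos (fun i t => ?_) fun i => (hpm i).const_mul (by positivity)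
  rw [← mul_assoc]
  refine mul_le_mul_of_nonneg_right ?_ (hp i t)
  rw [mul_assoc C]
  refine mul_le_mul_of_nonneg_left ?_ hC.le
  -- The size contributes m and the increments m + (m + c(1+g)m), c being the number of
  -- homogeneities below γ; together at most (3 + c)(1+g)m.
  nlinarith [mul_nonneg hg hm0]

theorem RSModel.exists_germBound_sub : ∃ C : ℝ, 0 < C ∧ ∀ (M₁ M₂ : RSModel s ℓ Q 𝒯 w ws),
    ∀ f₁ ∈ singularMD s 𝒯 v vs γ η M₁.Gamma, ∀ f₂ ∈ singularMD s 𝒯 v vs γ η M₂.Gamma,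
    ∀ R D : ℝ, 0 ≤ R → 0 ≤ D →
    piNorm ℓ 𝒯 w γ M₂.Pi ≤ ENNReal.ofReal R →
    gammaNorm s 𝒯 w ws γ M₁.Gamma ≤ ENNReal.ofReal R →
    gammaNorm s 𝒯 w ws γ M₂.Gamma ≤ ENNReal.ofReal R →
    mdNorm s 𝒯 v vs γ η M₁.Gamma f₁ ≤ ENNReal.ofReal R →
    piNorm ℓ 𝒯 w γ (fun x τ => M₁.Pi x τ - M₂.Pi x τ) ≤ ENNReal.ofReal D →
    gammaNorm s 𝒯 w ws γ (fun x y => M₁.Gamma x y - M₂.Gamma x y) ≤ ENNReal.ofReal D →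
    mdDist s 𝒯 v vs γ η M₁.Gamma M₂.Gamma f₁ f₂ ≤ ENNReal.ofReal D →
    GermBound s ℓ Q (fun x => w x ^ 2 * v x) γ (fun i : 𝒯.Below γ => (i.1 : ℝ))
      (fun i => min η i.1) (fun t y => modelDiagonal M₁.Pi f₁ t y - modelDiagonal M₂.Pi f₂ t y)
      (fun _ _ => C * ((1 + R) ^ 2 * D)) := by
  obtain ⟨C, hC, h⟩ := CoherentGerm.exists_germBound (γ := γ)
    (α := fun i : 𝒯.Below γ => (i.1 : ℝ)) (θ := fun i => min η i.1) hs hℓ hG0 hQ hwwv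
    (fun i => i.2) (fun i => min_le_right _ _) (lt_min_of_below hη)
  refine ⟨C * (6 + 3 * Fintype.card (𝒯.Below γ)), by positivity,
    fun M₁ M₂ f₁ hf₁ f₂ hf₂ R D hR hD hK₂ hΓ₁ hΓ₂ hmd₁ hK hΓ hmd => ?_⟩
  have hPi := PiBound.of_piNorm hw.pos (M₂.piLinear hs hℓ hG0 hQ hw) hR hK₂
  have hPi' := PiBound.of_piNorm hw.pos ((M₁.piLinear hs hℓ hG0 hQ hw).sub
    (M₂.piLinear hs hℓ hG0 hQ hw)) hD hK
  have hG₁ := GammaBound.of_gammaNorm hw.pos hw.le_one hw.one_le_star zero_le_one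
    M₁.isTriangular hR hΓ₁
  have hG₂ := GammaBound.of_gammaNorm hw.pos hw.le_one hw.one_le_star zero_le_one
    M₂.isTriangular hR hΓ₂
  have htri := M₁.isTriangular.sub M₂.isTriangular
  rw [sub_self] at htri
  have hG' := GammaBound.of_gammaNorm hw.pos hw.le_one hw.one_le_star le_rfl htri hD hΓ
  rw [zero_add] at hG'
  have hsize := SizeBound.of_sizeNorm (s := s) hv.pos hR (le_self_add.trans hmd₁)
  have hsize' := SizeBound.of_sizeNorm (s := s) hv.pos hD (le_self_add.trans hmd)
  have hinc := IncrementBound.of_increment hw hv hws (by positivity) hG₁ hR hR hsize hf₁.1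
    (le_add_self.trans hmd₁)
  have hinc' := IncrementBound.of_increment_sub hw hv hws (by positivity) hD hG₂ hG' hR hD hD
    hsize hsize' hf₁.1 hf₂.1 (le_add_self.trans hmd)
  have hA := h _ _ (M₁.coherentGerm_sub hs hℓ hG0 hQ hw hv hwwv hws M₂ hR hD hPi hPi' hR
    (by positivity) hD (by positivity) hsize hsize' hf₁.1 hf₂.1 hinc hinc')
  refine hA.of_le hwwv.pos (fun i t => ?_) fun i => monotone_const
  rw [mul_assoc C]
  refine mul_le_mul_of_nonneg_left ?_ hC.le
  -- The coefficient of the difference germ is 6RD + 2cRD + 3cR²D, which is at most (6 + 3c)(1+R)²D.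
  set c : ℝ := (Fintype.card (𝒯.Below γ) : ℝ)
  have hc : 0 ≤ c := Nat.cast_nonneg _
  have hRD : 0 ≤ R * D := mul_nonneg hR hD
  have hcD : 0 ≤ c * D := mul_nonneg hc hD
  have hcRD : 0 ≤ c * (R * D) := mul_nonneg hc hRD
  have hRRD : 0 ≤ R * (R * D) := mul_nonneg hR hRD
  linarith

theorem RSModel.reconstruction_mem_besovCompletion (hγ : 0 < γ)
    (hreg : 0 < 𝒯.reg ∨ (𝒯.reg < 0 ∧ 𝒯.reg < η)) (M : RSModel s ℓ Q 𝒯 w ws)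
    {f : Punctured d → 𝒯.Space} (hf : f ∈ singularMD s 𝒯 v vs γ η M.Gamma) :
    reconstructionProfile Q (modelDiagonal M.Pi f) ∈
      besovCompletion ℓ Q (min (min η 𝒯.reg) 0) (fun x => w x ^ 2 * v x) := by
  obtain ⟨C, hC, h⟩ := RSModel.exists_germBound hs hℓ hG0 hQ hw hv hwwv hws hη
  have hαγ : ∀ i : 𝒯.Below γ, (i.1 : ℝ) < γ := fun i => i.2
  have hθα : ∀ i : 𝒯.Below γ, min η (i.1 : ℝ) ≤ i.1 := fun i => min_le_right _ _
  have hθs := lt_min_of_below (γ := γ) hη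
  set K := (piNorm ℓ 𝒯 w γ M.Pi).toReal
  have hK : 0 ≤ K := ENNReal.toReal_nonneg
  have hPi := PiBound.of_piNorm hw.pos (M.piLinear hs hℓ hG0 hQ hw) hK
    (ENNReal.ofReal_toReal (M.piNorm_lt_top hw γ).ne).ge
  set A := C * ((1 + (gammaNorm s 𝒯 w ws γ M.Gamma).toReal) *
        (mdNorm s 𝒯 v vs γ η M.Gamma f).toReal) with hA
  have hA0 : 0 ≤ A := by positivity
  have hF := h M f hf _ (fun _ _ => hK) (fun _ => monotone_const) hPi
  rcases hreg with hreg | ⟨hreg, hregη⟩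
  · have h0 : reconstructionProfile Q (modelDiagonal M.Pi f) = 0 := by
      funext t x
      exact hF.reconstruction_eq_zero hs hℓ hG0 hQ hwwv hαγ hθα hθs hγ
        (fun i => hreg.trans_le (𝒯.isLeast_reg.2 i.1.2)) t.2.1 (t.2.2.trans one_le_two) x
    rw [h0]
    exact zero_mem_besovCompletion _
  rw [min_eq_right hregη.le, min_eq_left hreg.le]
  refine hF.mem_besovCompletion_of_small hs hℓ hG0 hQ hwwv hαγ hθα hθs hγ (θ₀ := 𝒯.reg)
    (mul_nonneg hA0 hK) (fun i => le_min hregη.le (𝒯.isLeast_reg.2 i.1.2)) le_rfl hreg.le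
    fun ε hε => ?_
  have hε' : 0 < ε / (A + 1) := by positivity
  obtain ⟨δ₁, hδ₁, hlow⟩ := M.exists_lowest_le hs hℓ hG0 hQ hw hreg ⟨𝒯.reg, 𝒯.isLeast_reg.1⟩ rfl
    hε'
  -- The lowest homogeneity gets a coefficient that is small up to time δ₁. Beyond δ₁ it jumps to a
  -- value that dominates both K and the small one, which keeps it monotone.
  set p : 𝒯.Below γ → ℝ → ℝ := fun i t =>
    if (i.1 : ℝ) = 𝒯.reg then (if t ≤ δ₁ then ε / (A + 1) else max K (ε / (A + 1))) else K with hp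
  have hp0 : ∀ i t, 0 ≤ p i t := fun i t => by
    simp only [hp]
    split_ifs
    exacts [hε'.le, hK.trans (le_max_left _ _), hK]
  have hpm : ∀ i, Monotone (p i) := fun i a b hab => by
    simp only [hp]
    split_ifs with h1 h2 h3 h3
    exacts [le_rfl, le_max_right _ _, absurd (hab.trans h3) h2, le_rfl, le_rfl]
  have hpPi : PiBound ℓ w γ M.Pi p := by
    intro i τ t x
    have hi := hPi i τ t x
    simp only [hp]
    split_ifs with h1 h2
    · obtain ⟨⟨a, ha⟩, hia⟩ := i
      obtain rfl : a = 𝒯.reg := h1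
      exact hlow t h2 x τ
    · refine hi.trans (mul_le_mul_of_nonneg_right (mul_le_mul_of_nonneg_right
        (mul_le_mul_of_nonneg_right (le_max_left _ _) (Real.rpow_nonneg t.2.1.le _))
        (inv_nonneg.2 (hw.pos x).le)) (norm_nonneg _))
    · exact hi
  refine ⟨_, h M f hf p hp0 hpm hpPi, ?_⟩
  -- In the lowest homogeneity the exponent is zero and the coefficient is small. In all others η ∧
  -- α > α₀, because α₀ < η, so a positive power of t does the work. Finitely many homogeneities
  -- allow a common δ.
  have hev : ∀ᶠ δ in 𝓝[>] (0 : ℝ), ∀ i : 𝒯.Below γ, ∀ t, 0 < t → t ≤ δ → t ≤ 1 →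
      A * p i t * t ^ ((min η (i.1 : ℝ) - 𝒯.reg) / ℓ) ≤ ε := by
    refine eventually_all.2 fun i => ?_
    by_cases hi : (i.1 : ℝ) = 𝒯.reg
    · refine eventually_of_mem (Ioc_mem_nhdsGT hδ₁) fun δ hδ t ht htδ _ => ?_
      simp only [hp]
      rw [if_pos hi, if_pos (htδ.trans hδ.2), hi, min_eq_right hregη.le, sub_self, zero_div,
        Real.rpow_zero, mul_one, mul_div_assoc', div_le_iff₀ (by positivity)]
      nlinarith
    · have hlt : 𝒯.reg < i.1 := lt_of_le_of_ne (𝒯.isLeast_reg.2 i.1.2) (Ne.symm hi)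
      obtain ⟨δ₂, hδ₂, hd⟩ := exists_forall_mul_rpow_le hℓ (sub_pos.2 (lt_min hregη hlt))
        (K := A * K) hε
      refine eventually_of_mem (Ioc_mem_nhdsGT hδ₂) fun δ hδ t ht htδ _ => ?_
      simp only [hp]
      rw [if_neg hi]
      exact hd t ht (htδ.trans hδ.2)
  obtain ⟨δ, hδ, hδ0⟩ := (hev.and self_mem_nhdsWithin).exists
  exact ⟨δ, hδ0, hδ⟩

end ModelReconstruction

end

/-! ### The reconstruction theorem. -/

theorem mainTheorem3 {d : ℕ} [NeZero d]
    (s : Fin d → ℝ) (hs : ∀ i, 1 ≤ s i) (ℓ : ℝ) (hℓ : 0 < ℓ)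
    (G : (Fin d → ℝ) → ℝ) (hG : Measurable G) (hG0 : ∀ x, 0 ≤ G x)
    (Q : ℝ → (Fin d → ℝ) → (Fin d → ℝ) → ℝ) (hQ : IsGTypeSemigroup s ℓ G Q)
    (𝒯 : RegularityStructure)
    (w ws v vs : (Fin d → ℝ) → ℝ)
    (hw : IsGControlled s ℓ G w ws) (hv : IsGControlled s ℓ G v vs)
    (hwv : IsGControlled s ℓ G (fun x => w x * v x) (fun x => ws x * vs x))
    (hwwv : IsGControlled s ℓ G (fun x => w x ^ 2 * v x) (fun x => ws x ^ 2 * vs x))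
    (hws : ∀ x, ws (-x) = ws x)
    (γ η : ℝ) (hγ : 0 < γ) (hηγ : η ≤ γ)
    (hη : min η 𝒯.reg ∈ Set.Ioc (γ - s 0) γ)
    (θ ζ : ℝ) (hθ : θ = min η 𝒯.reg) (hζ : ζ = min θ 0)
    (W : (Fin d → ℝ) → ℝ) (hW : W = fun x => w x ^ 2 * v x) :
    ∃ C : ℝ≥0, 0 < C ∧
      (∀ (M : RSModel s ℓ Q 𝒯 w ws), ∀ f ∈ singularMD s 𝒯 v vs γ η M.Gamma,
        ∃ Λ : Profile d,
          IsReconstruction s ℓ Q M.Pi ζ γ θ W f Λ ∧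
          (∀ Λ' : Profile d, IsReconstruction s ℓ Q M.Pi ζ γ θ W f Λ' → Λ' = Λ) ∧
          ((0 < 𝒯.reg ∨ (𝒯.reg < 0 ∧ 𝒯.reg < η)) → Λ ∈ besovCompletion ℓ Q ζ W) ∧
          besovNorm ℓ ζ W Λ ≤
            C * (piNorm ℓ 𝒯 w γ M.Pi * (1 + gammaNorm s 𝒯 w ws γ M.Gamma) *
              mdNorm s 𝒯 v vs γ η M.Gamma f) ∧
          errorNorm s ℓ W γ θ (localError M.Pi f Λ) ≤
            C * (piNorm ℓ 𝒯 w γ M.Pi * (1 + gammaNorm s 𝒯 w ws γ M.Gamma) *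
              mdNorm s 𝒯 v vs γ η M.Gamma f)) ∧
      (∀ (R : ℝ≥0) (M₁ M₂ : RSModel s ℓ Q 𝒯 w ws),
        ∀ f₁ ∈ singularMD s 𝒯 v vs γ η M₁.Gamma, ∀ f₂ ∈ singularMD s 𝒯 v vs γ η M₂.Gamma,
        ∀ Λ₁ Λ₂ : Profile d,
          IsReconstruction s ℓ Q M₁.Pi ζ γ θ W f₁ Λ₁ →
          IsReconstruction s ℓ Q M₂.Pi ζ γ θ W f₂ Λ₂ →
          piNorm ℓ 𝒯 w γ M₁.Pi + gammaNorm s 𝒯 w ws γ M₁.Gamma ≤ R →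
          piNorm ℓ 𝒯 w γ M₂.Pi + gammaNorm s 𝒯 w ws γ M₂.Gamma ≤ R →
          mdNorm s 𝒯 v vs γ η M₁.Gamma f₁ ≤ R →
          mdNorm s 𝒯 v vs γ η M₂.Gamma f₂ ≤ R →
          besovNorm ℓ ζ W (Λ₁ - Λ₂) ≤
            C * (1 + R) ^ 2 *
              ((piNorm ℓ 𝒯 w γ (fun x τ => M₁.Pi x τ - M₂.Pi x τ) +
                gammaNorm s 𝒯 w ws γ (fun x y => M₁.Gamma x y - M₂.Gamma x y)) +
                mdDist s 𝒯 v vs γ η M₁.Gamma M₂.Gamma f₁ f₂) ∧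
          errorNorm s ℓ W γ θ
              (fun t x => localError M₁.Pi f₁ Λ₁ t x - localError M₂.Pi f₂ Λ₂ t x) ≤
            C * (1 + R) ^ 2 *
              ((piNorm ℓ 𝒯 w γ (fun x τ => M₁.Pi x τ - M₂.Pi x τ) +
                gammaNorm s 𝒯 w ws γ (fun x y => M₁.Gamma x y - M₂.Gamma x y)) +
                mdDist s 𝒯 v vs γ η M₁.Gamma M₂.Gamma f₁ f₂)) := by
  subst hθ hζ hW
  have hηl := hη.1
  have hαγ : ∀ i : 𝒯.Below γ, (i.1 : ℝ) < γ := fun i => i.2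
  have hθα : ∀ i : 𝒯.Below γ, min η (i.1 : ℝ) ≤ i.1 := fun i => min_le_right _ _
  have hθs := lt_min_of_below (γ := γ) hηl
  have hθ₀ : ∀ i : 𝒯.Below γ, min η 𝒯.reg ≤ min η (i.1 : ℝ) := fun i =>
    min_le_min_left _ (𝒯.isLeast_reg.2 i.1.2)
  obtain ⟨C₀, hC₀, hgerm⟩ := RSModel.exists_germBound hs hℓ hG0 hQ hw hv hwwv hws hηl
  obtain ⟨C₁, hC₁, hrec⟩ := GermBound.exists_abs_reconstruction_le hs hℓ hG0 hQ hwwv hαγ hθα hθs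
    hγ hθ₀ (min_le_left (min η 𝒯.reg) 0)
  obtain ⟨C₂, hC₂, hdiff⟩ := RSModel.exists_germBound_sub hs hℓ hG0 hQ hw hv hwwv hws hηl
  have hF : ∀ (M : RSModel s ℓ Q 𝒯 w ws), ∀ f ∈ singularMD s 𝒯 v vs γ η M.Gamma,
      GermBound s ℓ Q (fun x => w x ^ 2 * v x) γ (fun i : 𝒯.Below γ => (i.1 : ℝ))
      (fun i => min η i.1) (modelDiagonal M.Pi f)
      (fun _ _ => C₀ * ((1 + (gammaNorm s 𝒯 w ws γ M.Gamma).toReal) *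
        (mdNorm s 𝒯 v vs γ η M.Gamma f).toReal) * (piNorm ℓ 𝒯 w γ M.Pi).toReal) :=
    fun M f hf => hgerm M f hf _ (fun _ _ => ENNReal.toReal_nonneg) (fun _ => monotone_const)
      (PiBound.of_piNorm hw.pos (M.piLinear hs hℓ hG0 hQ hw) ENNReal.toReal_nonneg
        (ENNReal.ofReal_toReal (M.piNorm_lt_top hw γ).ne).ge)
  have herr : ∀ (P : (Fin d → ℝ) → 𝒯.Space → Profile d) (f : Punctured d → 𝒯.Space)
      (t : Set.Ioc (0 : ℝ) 1) (x : Punctured d),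
      localError P f (reconstructionProfile Q (modelDiagonal P f)) t x =
        reconstruction Q (modelDiagonal P f) t x - modelDiagonal P f t x := fun P f t x => by
    rw [modelDiagonal, modelGerm_apply P f x.2 t.2.1 t.2.2]
    rfl
  have hone : ∀ (M : RSModel s ℓ Q 𝒯 w ws), ∀ f ∈ singularMD s 𝒯 v vs γ η M.Gamma,
      IsReconstruction s ℓ Q M.Pi (min (min η 𝒯.reg) 0) γ (min η 𝒯.reg)
        (fun x => w x ^ 2 * v x) f (reconstructionProfile Q (modelDiagonal M.Pi f)) ∧
      besovNorm ℓ (min (min η 𝒯.reg) 0) (fun x => w x ^ 2 * v x)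
        (reconstructionProfile Q (modelDiagonal M.Pi f)) ≤ ENNReal.ofReal (C₁ * C₀) *
          (piNorm ℓ 𝒯 w γ M.Pi * (1 + gammaNorm s 𝒯 w ws γ M.Gamma) *
            mdNorm s 𝒯 v vs γ η M.Gamma f) ∧
      errorNorm s ℓ (fun x => w x ^ 2 * v x) γ (min η 𝒯.reg)
        (localError M.Pi f (reconstructionProfile Q (modelDiagonal M.Pi f))) ≤
          ENNReal.ofReal (C₁ * C₀) *
          (piNorm ℓ 𝒯 w γ M.Pi * (1 + gammaNorm s 𝒯 w ws γ M.Gamma) *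
            mdNorm s 𝒯 v vs γ η M.Gamma f) := by
    intro M f hf
    have hFM := hF M f hf
    have hg := ENNReal.ofReal_toReal (M.gammaNorm_lt_top hw γ).ne
    have hp := ENNReal.ofReal_toReal (M.piNorm_lt_top hw γ).ne
    have hm := ENNReal.ofReal_toReal hf.2.ne
    set g := (gammaNorm s 𝒯 w ws γ M.Gamma).toReal
    set p := (piNorm ℓ 𝒯 w γ M.Pi).toReal
    set m := (mdNorm s 𝒯 v vs γ η M.Gamma f).toReal
    have hg0 : 0 ≤ g := ENNReal.toReal_nonneg
    have hp0 : 0 ≤ p := ENNReal.toReal_nonneg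
    have hm0 : 0 ≤ m := ENNReal.toReal_nonneg
    have hκ : 0 ≤ C₀ * ((1 + g) * m) * p := by positivity
    obtain ⟨h1, h2⟩ := hrec _ _ hκ hFM
    have hC : ENNReal.ofReal (C₁ * (C₀ * ((1 + g) * m) * p)) = ENNReal.ofReal (C₁ * C₀) *
          (piNorm ℓ 𝒯 w γ M.Pi * (1 + gammaNorm s 𝒯 w ws γ M.Gamma) *
            mdNorm s 𝒯 v vs γ η M.Gamma f) := by
      rw [← hg, ← hp, ← hm, ← ENNReal.ofReal_one, ← ENNReal.ofReal_add zero_le_one hg0,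
        ← ENNReal.ofReal_mul hp0, ← ENNReal.ofReal_mul (by positivity),
        ← ENNReal.ofReal_mul (by positivity)]
      congr 1
      ring
    have hb := besovNorm_le_ofReal hwwv
      (Λ := reconstructionProfile Q (modelDiagonal M.Pi f)) fun t x => h1 t t.2.1 t.2.2 x
    have he := errorNorm_le_ofReal hwwv
      (e := localError M.Pi f (reconstructionProfile Q (modelDiagonal M.Pi f))) fun t x => by
        rw [herr]
        exact h2 t t.2.1 t.2.2 x x.2
    refine ⟨⟨hFM.mem_besovSpace hs hℓ hG0 hQ hwwv hαγ hθα hθs hγ hκ hθ₀ (min_le_left _ _)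
      (min_le_right _ _), he.trans_lt ENNReal.ofReal_lt_top⟩, ?_, ?_⟩
    · rw [← hC]; exact hb
    · rw [← hC]; exact he
  have huniq : ∀ (M : RSModel s ℓ Q 𝒯 w ws), ∀ f ∈ singularMD s 𝒯 v vs γ η M.Gamma,
      ∀ Λ : Profile d, IsReconstruction s ℓ Q M.Pi (min (min η 𝒯.reg) 0) γ (min η 𝒯.reg)
        (fun x => w x ^ 2 * v x) f Λ → Λ = reconstructionProfile Q (modelDiagonal M.Pi f) :=
    fun M f hf Λ hΛ => hΛ.unique hs hℓ hG0 hQ hwwv hγ hη.2 hηl (hone M f hf).1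
  -- C₀ comes from a single germ, C₂ from the difference of two, and C₁ from the passage to the
  -- reconstruction; the sum serves both parts.
  have hCpos : 0 < C₁ * (C₀ + C₂) := by positivity
  have hCle₀ : ENNReal.ofReal (C₁ * C₀) ≤ ((C₁ * (C₀ + C₂)).toNNReal : ℝ≥0∞) :=
    ENNReal.ofReal_le_ofReal (mul_le_mul_of_nonneg_left (by linarith) hC₁.le)
  have hCle₂ : ENNReal.ofReal (C₁ * C₂) ≤ ((C₁ * (C₀ + C₂)).toNNReal : ℝ≥0∞) :=
    ENNReal.ofReal_le_ofReal (mul_le_mul_of_nonneg_left (by linarith) hC₁.le)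
  refine ⟨(C₁ * (C₀ + C₂)).toNNReal, Real.toNNReal_pos.2 hCpos, fun M f hf => ?_, ?_⟩
  · obtain ⟨h1, h2, h3⟩ := hone M f hf
    exact ⟨_, h1, huniq M f hf, fun hreg => M.reconstruction_mem_besovCompletion hs hℓ hG0 hQ hw
      hv hwwv hws hηl hγ hreg hf, h2.trans (mul_le_mul_left hCle₀ _),
      h3.trans (mul_le_mul_left hCle₀ _)⟩
  intro R M₁ M₂ f₁ hf₁ f₂ hf₂ Λ₁ Λ₂ hΛ₁ hΛ₂ hM₁ hM₂ hR₁ _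
  -- Uniqueness identifies arbitrary reconstructions with the constructed ones, to which linearity
  -- applies.
  rw [huniq M₁ f₁ hf₁ Λ₁ hΛ₁, huniq M₂ f₂ hf₂ Λ₂ hΛ₂]
  set S := (piNorm ℓ 𝒯 w γ (fun x τ => M₁.Pi x τ - M₂.Pi x τ) +
    gammaNorm s 𝒯 w ws γ (fun x y => M₁.Gamma x y - M₂.Gamma x y)) +
    mdDist s 𝒯 v vs γ η M₁.Gamma M₂.Gamma f₁ f₂ with hS
  -- If the distance is infinite there is nothing to prove, the prefactor being nonzero; otherwise
  -- all quantities become real numbers.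
  by_cases hStop : S = ∞
  · have htop : ((C₁ * (C₀ + C₂)).toNNReal : ℝ≥0∞) * (1 + R) ^ 2 * S = ∞ := by
      rw [hStop]
      refine ENNReal.mul_top (mul_ne_zero ?_ (pow_ne_zero _ (by simp)))
      exact (ENNReal.coe_pos.2 (Real.toNNReal_pos.2 hCpos)).ne'
    rw [htop]
    exact ⟨le_top, le_top⟩
  have hD := ENNReal.ofReal_toReal hStop
  set D := S.toReal
  have hD0 : 0 ≤ D := ENNReal.toReal_nonneg
  have hRR : ENNReal.ofReal (R : ℝ) = R := ENNReal.ofReal_coe_nnreal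
  have hgerm' := hdiff M₁ M₂ f₁ hf₁ f₂ hf₂ R D R.2 hD0
    (by rw [hRR]; exact le_self_add.trans hM₂) (by rw [hRR]; exact le_add_self.trans hM₁)
    (by rw [hRR]; exact le_add_self.trans hM₂) (by rw [hRR]; exact hR₁)
    (by rw [hD, hS]; exact le_self_add.trans le_self_add)
    (by rw [hD, hS]; exact le_add_self.trans le_self_add)
    (by rw [hD, hS]; exact le_add_self)
  obtain ⟨h1, h2⟩ := hrec _ _ (by positivity) hgerm'
  have hsub : ∀ (t : Set.Ioc (0 : ℝ) 1) x, reconstruction Q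
      (fun t y => modelDiagonal M₁.Pi f₁ t y - modelDiagonal M₂.Pi f₂ t y) t x =
      reconstruction Q (modelDiagonal M₁.Pi f₁) t x -
        reconstruction Q (modelDiagonal M₂.Pi f₂) t x := fun t x =>
    reconstruction_sub hs hℓ hG0 hQ hwwv hαγ hθα hθs hγ (hF M₁ f₁ hf₁) (hF M₂ f₂ hf₂) hgerm'
      t.2.1 (t.2.2.trans one_le_two) x
  have hfin : ENNReal.ofReal (C₁ * (C₂ * ((1 + (R : ℝ)) ^ 2 * D))) ≤
      ((C₁ * (C₀ + C₂)).toNNReal : ℝ≥0∞) * (1 + R) ^ 2 * S := by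
    have hR1 : ENNReal.ofReal ((1 + (R : ℝ)) ^ 2) = (1 + (R : ℝ≥0∞)) ^ 2 := by
      rw [ENNReal.ofReal_pow (by positivity), ENNReal.ofReal_add zero_le_one R.coe_nonneg,
        ENNReal.ofReal_one, hRR]
    rw [← mul_assoc, ENNReal.ofReal_mul (mul_pos hC₁ hC₂).le,
      ENNReal.ofReal_mul (sq_nonneg _), hR1, hD, mul_assoc]
    exact mul_le_mul_left hCle₂ _
  constructor
  · refine le_trans (besovNorm_le_ofReal hwwv fun t x => ?_) hfin
    have := h1 t t.2.1 t.2.2 x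
    rwa [hsub] at this
  · refine le_trans (errorNorm_le_ofReal hwwv fun t x => ?_) hfin
    have := h2 t t.2.1 t.2.2 x x.2
    rw [hsub] at this
    rw [herr, herr]
    refine le_trans (le_of_eq ?_) this
    congr 1
    ring
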